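/- **Setting.** Let $M\subset\mathbb R^N$ be an embedded $C^\infty$ submanifold and $f:M\to M$ a $C^\infty$ diffeomorphism. Assume that $f$ and $f^{-1}$ are given together with extensions that are $C^\infty$ around every point of $M$; derivatives and norms below are those of the extensions. Let $\Lambda\subset M$ be compact with $f(\Lambda)=\Lambda$, and let $$T_xM=E^c_1(x)\oplus E^u_1(x)\oplus E^s_1(x)\qquad(x\in\Lambda)$$ be a splitting. Write $E^{sc}_1=E^s_1\oplus E^c_1$ and $E^{uc}_1=E^u_1\oplus E^c_1$. For a subset $S$ let $T^0S=S$ and $T^{k+1}S=T(T^kS)$, the set of pairs $(\xi,v)$ with $\xi\in T^kS$ and $v$ tangent to $T^kS$ at $\xi$; the foot point of $\xi=(\dots((x,v_1),v_2)\dots,v_k)\in T^kS$ is $x$. Let $f_0=f$ and $f_k(\xi,v)=(f_{k-1}(\xi),Df_{k-1}(\xi)v)$ be the jet maps. Fix $i\ge1$. For $x\in\Lambda$ let $W^{sc}(x),W^{uc}(x)\subset M$ contain $x$, be $C^i$ submanifolds near $x$, and satisfy $T_xW^{sc}(x)=E_1^{sc}(x)$ and $T_xW^{uc}(x)=E_1^{uc}(x)$,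 with derivatives up to order $i$ at $x$ bounded uniformly in $x\in\Lambda$. Let them be locally invariant: $f$ maps a neighbourhood of $x$ in $W^{sc}(x)$ into $W^{sc}(f(x))$, and $f^{-1}$ maps a neighbourhood of $x$ in $W^{uc}(x)$ into $W^{uc}(f^{-1}(x))$. Let $W^c(x)$ be the center manifold through $x$, i.e. $W^c(x)=W^{uc}(x)\cap W^{sc}(x)$ near $x$ (the leaf of $\Lambda$ through $x$, when $\Lambda$ is laminated by its center manifolds). **Theorem B.1.** 1. (Jet splitting.) For every $\xi\in T^{i-1}W^c(x)$ with foot point $x\in\Lambda$ there is a splitting $T_\xi(T^{i-1}M)=E^c_i\oplus E^u_i\oplus E^s_i$ such that $E_i^u\oplus E_i^c=E^{uc}_i(\xi):=T_\xi(T^{i-1}W^{uc}(x))$, $E_i^s\oplus E_i^c=E^{sc}_i(\xi):=T_\xi(T^{i-1}W^{sc}(x))$ and $E^{uc}_i(\xi)\cap E^{sc}_i(\xi)=E^c_i=T_\xi(T^{i-1}W^c(x))$. Moreover, at the points $\xi$ with foot point $x\in\Lambda$, the map $f_{i-1}$ carries $T^{i-1}W^{sc}(x)$ into $T^{i-1}W^{sc}(f(x))$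 and $Df_{i-1}(\xi)$ carries $E_i^{sc}(\xi)$ into $E_i^{sc}(f_{i-1}(\xi))$; the same holds for $W^{uc}$, $E_i^{uc}$ and $f^{-1}$. 2. (Center-stable distribution.) Suppose $0<\lambda^{sc}_+<\lambda^u_+$ and that for some $C>0$ $$\|Df^n(x)v\|\le C(\lambda_+^{sc})^n\|v\|\ \ (v\in E_1^{sc}(x)),\qquad \|Df^n(x)v\|\ge C^{-1}(\lambda_+^u)^n\|v\|\ \ (v\in E_1^u(x))$$ for all $x\in\Lambda$ and $n\in\mathbb N$. Suppose that $E^u_1$ is not zero at every point of $\Lambda$, that $(\lambda_+^{sc})^{i+1}<\lambda_+^u$ in case $i\ge2$, and that $\|f\|_{C^{i+3}}\ge1$, where $\|f\|_{C^k}=\sup_{x\in\Lambda}\max_{0\le j\le k}\|D^jf(x)\|$. Put $$b_i^+=3^{4i}\,(i+1)!\,2^{(i+2)(i+3)/2}\,\|f\|_{C^{i+3}}^{\,i+3},\qquad \varphi_i^{sc}=\frac{\ln\lambda_+^u-\ln\lambda_+^{sc}}{\ln b_i^+-\ln\lambda_+^{sc}} .$$ Then $E_i^{sc}$ is Hölder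 continuous with exponent $\varphi_i^{sc}$: there is a constant $C'$ such that $\mathrm{dist}(E_i^{sc}(\xi),E_i^{sc}(\eta))\le C'\|\xi-\eta\|^{\varphi_i^{sc}}$ for all $\xi\in T^{i-1}W^{sc}(x)$ and $\eta\in T^{i-1}W^{sc}(y)$ with foot points $x,y\in\Lambda$ all of whose velocities have norm at most $1$ (in particular for such $\xi,\eta$ in $T^{i-1}W^c(x)$, $T^{i-1}W^c(y)$). Here $\mathrm{dist}(A,B)$ is the larger of $\max_{v\in A,\|v\|=1}\mathrm{dist}(v,B)$ and $\max_{w\in B,\|w\|=1}\mathrm{dist}(w,A)$. 3. (Center-unstable distribution.) Likewise, suppose $0<\lambda^{uc}_-<\lambda^s_-$ and that for some $C>0$ one has $\|Df^{-n}(x)v\|\le C(\lambda_-^{uc})^n\|v\|$ on $E_1^{uc}$ and $\|Df^{-n}(x)v\|\ge C^{-1}(\lambda_-^s)^n\|v\|$ on $E_1^s$ for all $x\in\Lambda$, $n\in\mathbb N$. Suppose that $E_1^s$ is not zero at every point of $\Lambda$, $(\lambda_-^{uc})^{i+1}<\lambda_-^s$ in case $i\ge2$, and $\|f^{-1}\|_{C^{i+3}}\ge1$.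 Then, with $b_i^-$ defined like $b_i^+$ from $\|f^{-1}\|_{C^{i+3}}$, the distribution $E_i^{uc}$ is Hölder continuous, in the same sense with $W^{uc}$ in place of $W^{sc}$, with exponent $$\varphi_i^{uc}=\frac{\ln\lambda_-^s-\ln\lambda_-^{uc}}{\ln b_i^--\ln\lambda_-^{uc}} .$$ -/

import Mathlib

open Set Filter Topology
open scoped ContDiff

noncomputable section

/-- The iterated tangent space `T^k V = T(T(⋯ T V))` of a vector space `V`:
`T^0 V = V`, `T^(k+1) V = T^k V × T^k V`, an element `(x, v)` being a point `x` of `T^k V` and a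
velocity `v` at this point. It carries the maximum norm of the components. -/
def JetSpace (V : Type*) : ℕ → Type _
  | 0 => V
  | k + 1 => JetSpace V k × JetSpace V k

instance JetSpace.instNormedAddCommGroup (V : Type*) [NormedAddCommGroup V] :
    (k : ℕ) → NormedAddCommGroup (JetSpace V k)
  | 0 => inferInstanceAs (NormedAddCommGroup V)
  | k + 1 =>
    letI := JetSpace.instNormedAddCommGroup V k
    inferInstanceAs (NormedAddCommGroup (JetSpace V k × JetSpace V k))

instance JetSpace.instNormedSpace (V : Type*) [NormedAddCommGroup V] [NormedSpace ℝ V] :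
    (k : ℕ) → NormedSpace ℝ (JetSpace V k)
  | 0 => inferInstanceAs (NormedSpace ℝ V)
  | k + 1 =>
    letI := JetSpace.instNormedSpace V k
    inferInstanceAs (NormedSpace ℝ (JetSpace V k × JetSpace V k))

/-- The foot point in `V` of an element of `T^k V`. -/
def jetBase {V : Type*} : (k : ℕ) → JetSpace V k → V
  | 0, x => x
  | k + 1, p => jetBase k p.1

/-- All the velocities occurring in an element `(⋯((x, v₁), v₂)⋯, v_k)` of `T^k V` have norm at
most one. -/
def VelocitiesLeOne {V : Type*} [NormedAddCommGroup V] : (k : ℕ) → JetSpace V k → Prop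
  | 0, _ => True
  | k + 1, p => VelocitiesLeOne k p.1 ∧ ‖p.2‖ ≤ 1

/-- The jet maps of `f`: `f_0 = f` and `f_(k+1) (x, v) = (f_k x, D f_k (x) v)`. -/
def jetMap {V : Type*} [NormedAddCommGroup V] [NormedSpace ℝ V] (f : V → V) :
    (k : ℕ) → JetSpace V k → JetSpace V k
  | 0, x => f x
  | k + 1, p => (jetMap f k p.1, fderiv ℝ (jetMap f k) p.1 p.2)

/-- The iterated tangent bundle `T^k S ⊆ T^k V` of a subset `S` of `V`: `T^0 S = S`, and
`T^(k+1) S` consists of the points of `T^k S` together with the vectors tangent to `T^k S`. -/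
def jetSet {V : Type*} [NormedAddCommGroup V] [NormedSpace ℝ V] (S : Set V) :
    (k : ℕ) → Set (JetSpace V k)
  | 0 => S
  | k + 1 => {p : JetSpace V k × JetSpace V k |
      p.1 ∈ jetSet S k ∧ p.2 ∈ tangentConeAt ℝ (jetSet S k) p.1}

/-- The tangent space of `S` at `x`. The tangent cone of a `C^1` submanifold is already a linear
subspace; the span only serves to give it the type of a subspace. -/
def tangentSpaceOf {V : Type*} [NormedAddCommGroup V] [NormedSpace ℝ V] (S : Set V) (x : V) :
    Submodule ℝ V :=
  Submodule.span ℝ (tangentConeAt ℝ S x)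

/-- `Φ` is a `C^n` change of coordinates of `V` near `x` which carries `S` to the linear
subspace `A`. -/
structure Flattens {V : Type*} [NormedAddCommGroup V] [NormedSpace ℝ V] (n : WithTop ℕ∞)
    (Φ : OpenPartialHomeomorph V V) (S : Set V) (x : V) (A : Submodule ℝ V) : Prop where
  mem_source : x ∈ Φ.source
  contDiffOn : ContDiffOn ℝ n Φ Φ.source
  contDiffOn_symm : ContDiffOn ℝ n Φ.symm Φ.target
  mem_iff : ∀ y ∈ Φ.source, y ∈ S ↔ Φ y ∈ A

/-- `S` is an embedded `C^n` submanifold (without boundary) of `V`. -/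
def IsEmbeddedSubmanifold {V : Type*} [NormedAddCommGroup V] [NormedSpace ℝ V] (n : WithTop ℕ∞)
    (S : Set V) : Prop :=
  ∀ x ∈ S, ∃ (Φ : OpenPartialHomeomorph V V) (A : Submodule ℝ V), Flattens n Φ S x A

/-- `f` restricts to a `C^∞` diffeomorphism of the submanifold `M`, with inverse `g`. Both maps
are given together with extensions that are smooth around every point of `M`; the values of
the extensions far from `M` are irrelevant. -/
structure IsDiffeoOf {V : Type*} [NormedAddCommGroup V] [NormedSpace ℝ V] (M : Set V)
    (f g : V → V) : Prop where
  mapsTo : MapsTo f M M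
  mapsTo_inv : MapsTo g M M
  invOn : InvOn g f M M
  contDiffAt : ∀ x ∈ M, ContDiffAt ℝ ∞ f x
  contDiffAt_inv : ∀ x ∈ M, ContDiffAt ℝ ∞ g x

/-- `T` is the direct sum of its subspaces `A`, `B` and `C`. -/
def IsSplitting {V : Type*} [AddCommGroup V] [Module ℝ V] (T A B C : Submodule ℝ V) : Prop :=
  A ⊔ B ⊔ C = T ∧ iSupIndep ![A, B, C]

/-- `‖D h^n (x) v‖ ≤ C l^n ‖v‖` for `v ∈ A x` and `‖D h^n (x) v‖ ≥ C⁻¹ m^n ‖v‖` for `v ∈ B x`, with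
a constant `C` that does not depend on `x ∈ Λ`, `n` and `v`. -/
def HasRates {V : Type*} [NormedAddCommGroup V] [NormedSpace ℝ V] (h : V → V) (Λ : Set V)
    (A B : V → Submodule ℝ V) (l m : ℝ) : Prop :=
  ∃ C : ℝ, 0 < C ∧ ∀ x ∈ Λ, ∀ n : ℕ,
    (∀ v ∈ A x, ‖fderiv ℝ h^[n] x v‖ ≤ C * l ^ n * ‖v‖) ∧
    (∀ v ∈ B x, C⁻¹ * m ^ n * ‖v‖ ≤ ‖fderiv ℝ h^[n] x v‖)

/-- `W x`, `x ∈ Λ`, is a family of `C^n` submanifolds of `M` passing through the points of `Λ` in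
the direction of the distribution `A`, with derivatives up to order `n` bounded uniformly in
`x`, and locally invariant under `h`: the image under `h` of the germ of `W x` at `x` lies in
`W (h x)`. -/
structure IsInvariantLeafFamily {V : Type*} [NormedAddCommGroup V] [NormedSpace ℝ V] (n : ℕ)
    (M Λ : Set V) (h : V → V) (A : V → Submodule ℝ V) (W : V → Set V) : Prop where
  mem : ∀ x ∈ Λ, x ∈ W x
  subset : ∀ x ∈ Λ, W x ⊆ M
  tangent : ∀ x ∈ Λ, tangentSpaceOf (W x) x = A x
  smooth : ∃ K : ℝ, ∀ x ∈ Λ, ∃ (Φ : OpenPartialHomeomorph V V) (B : Submodule ℝ V),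
    Flattens n Φ (W x) x B ∧ ∀ j : ℕ, 1 ≤ j → j ≤ n →
      ‖iteratedFDeriv ℝ j Φ x‖ ≤ K ∧ ‖iteratedFDeriv ℝ j Φ.symm (Φ x)‖ ≤ K
  invariant : ∀ x ∈ Λ, ∀ᶠ y in 𝓝 x, y ∈ W x → h y ∈ W (h x)

/-- The `C^k` norm of `f` on `Λ`: the supremum over `Λ` of the norms of the derivatives of order
`0, …, k`. -/
def cNorm {V : Type*} [NormedAddCommGroup V] [NormedSpace ℝ V] (k : ℕ) (f : V → V) (Λ : Set V) :
    ℝ :=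
  ⨆ x : Λ, ⨆ j : Fin (k + 1), ‖iteratedFDeriv ℝ (j : ℕ) f (x : V)‖

/-- The constant `b_i = 3^(4i) (i+1)! 2^((i+2)(i+3)/2) ‖f‖_{C^(i+3)}^(i+3)`. -/
def bConst {V : Type*} [NormedAddCommGroup V] [NormedSpace ℝ V] (i : ℕ) (f : V → V)
    (Λ : Set V) : ℝ :=
  3 ^ (4 * i) * ((i + 1).factorial : ℝ) * 2 ^ ((i + 2) * (i + 3) / 2) *
    cNorm (i + 3) f Λ ^ (i + 3)

/-- The Hölder exponent `(ln m - ln l) / (ln b - ln l)`. -/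
def holderExponent (l m b : ℝ) : ℝ :=
  (Real.log m - Real.log l) / (Real.log b - Real.log l)

/-- The distance of two linear subspaces: the larger one of
`max {dist (v, B) | v ∈ A, ‖v‖ = 1}` and `max {dist (w, A) | w ∈ B, ‖w‖ = 1}`. -/
def subspaceDist {V : Type*} [NormedAddCommGroup V] [NormedSpace ℝ V] (A B : Submodule ℝ V) : ℝ :=
  max (⨆ v : {v : V // v ∈ A ∧ ‖v‖ = 1}, Metric.infDist (v : V) (B : Set V))
    (⨆ w : {w : V // w ∈ B ∧ ‖w‖ = 1}, Metric.infDist (w : V) (A : Set V))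

/-- The distribution `ξ ↦ T_ξ (T^k (W x))`, where `ξ` is an element of `T^k (W x)` with foot point
`x ∈ Λ`, is Hölder continuous with exponent `φ` on the set of all such `ξ` whose velocities have
norm at most one. -/
def IsHolderJetDistribution {V : Type*} [NormedAddCommGroup V] [NormedSpace ℝ V] (k : ℕ)
    (Λ : Set V) (W : V → Set V) (φ : ℝ) : Prop :=
  ∃ C : ℝ, ∀ x ∈ Λ, ∀ y ∈ Λ, ∀ ξ ∈ jetSet (W x) k, ∀ η ∈ jetSet (W y) k,
    jetBase k ξ = x → jetBase k η = y → VelocitiesLeOne k ξ → VelocitiesLeOne k η →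
    subspaceDist (tangentSpaceOf (jetSet (W x) k) ξ) (tangentSpaceOf (jetSet (W y) k) η) ≤
      C * ‖ξ - η‖ ^ φ

end

/-!
A local retraction `r` onto a submanifold `S` induces the local retraction `jetMap r k` onto
`T^k S`, so the tangent spaces of `T^k S` are the fixed spaces of its derivative. A chart which
flattens `M`, `W^uc(x)`, `W^sc(x)` and `W^c(x)` simultaneously turns their jet spaces into linear
ones, which gives the splitting.

Multiplying the velocities by a parameter makes all jets small, and after a rescaling of the
velocities the derivative of the jet map at small jets is a small perturbation of the diagonal
action of `Df` on all components. The distribution `E^sc` is therefore dominated by the rates of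
`Df`. A unit vector of `E^sc(ξ)`, moved to a nearby point `η`, grows slowly along the orbit of `η`
as long as this orbit is close to the one of `ξ`, whereas its distance to `E^sc(η)` would grow
fast. The Hölder exponent results from the time after which the two orbits separate.
-/

section TangentMap

variable {X : Type*} [NormedAddCommGroup X] [NormedSpace ℝ X]

/-- The tangent map `(x, v) ↦ (F x, DF(x) v)` of a self-map of a normed space. The jet maps are its
iterates: `jetMap f (k + 1)` is the tangent map of `jetMap f k` by definition. -/
noncomputable def vectorTangentMap (F : X → X) (p : X × X) : X × X := (F p.1, fderiv ℝ F p.1 p.2)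

lemma contDiffAt_vectorTangentMap {F : X → X} {m : ℕ} {p : X × X}
    (h : ContDiffAt ℝ (m + 1 : ℕ) F p.1) : ContDiffAt ℝ m (vectorTangentMap F) p := by
  have hD : ContDiffAt ℝ m (fderiv ℝ F) p.1 := h.fderiv_right (by norm_cast)
  have hF : ContDiffAt ℝ m F p.1 := h.of_le (by norm_cast; omega)
  exact (hF.comp p contDiffAt_fst).prodMk ((hD.comp p contDiffAt_fst).clm_apply contDiffAt_snd)

lemma fderiv_vectorTangentMap_apply {F : X → X} {p : X × X} (h : ContDiffAt ℝ 2 F p.1)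
    (v : X × X) :
    fderiv ℝ (vectorTangentMap F) p v =
      (fderiv ℝ F p.1 v.1, fderiv ℝ F p.1 v.2 + fderiv ℝ (fderiv ℝ F) p.1 v.1 p.2) := by
  have hF : HasFDerivAt F (fderiv ℝ F p.1) p.1 := (h.differentiableAt (by simp)).hasFDerivAt
  have hD : HasFDerivAt (fderiv ℝ F) (fderiv ℝ (fderiv ℝ F) p.1) p.1 :=
    ((h.fderiv_right (m := 1) (by norm_num)).differentiableAt (by simp)).hasFDerivAt
  have hT := (hF.comp p hasFDerivAt_fst).prodMk
    ((hD.comp p hasFDerivAt_fst).clm_apply hasFDerivAt_snd)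
  exact congrArg (· v) hT.fderiv

lemma mem_tangentConeAt_of_hasFDerivAt {F : X → X} {F' : X →L[ℝ] X} {S S' : Set X} {x v : X}
    (hF : HasFDerivAt F F' x) (hS : ∀ᶠ y in 𝓝 x, y ∈ S → F y ∈ S')
    (hv : v ∈ tangentConeAt ℝ S x) : F' v ∈ tangentConeAt ℝ S' (F x) := by
  rw [← tangentConeAt_inter_nhds hS] at hv
  refine tangentConeAt_mono ?_ (hF.hasFDerivWithinAt.mapsTo_tangent_cone hv)
  rintro _ ⟨y, hy, rfl⟩
  exact hy.2 hy.1

lemma smul_mem_tangentConeAt {S : Set X} {x v : X} (t : ℝ) (h : v ∈ tangentConeAt ℝ S x) :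
    t • v ∈ tangentConeAt ℝ S x := by
  obtain ⟨α, l, hl, c, d, hd, hs, hc⟩ := exists_fun_of_mem_tangentConeAt h
  refine mem_tangentConeAt_of_seq l (fun n => t * c n) d hd hs ?_
  simpa [mul_smul] using hc.const_smul t

end TangentMap

section JetBase

variable {V : Type*} [NormedAddCommGroup V]

/-- The jet at `x` all of whose velocities vanish. -/
def zeroJet : (k : ℕ) → V → JetSpace V k
  | 0, x => x
  | k + 1, x => (zeroJet k x, 0)

lemma jetBase_zeroJet (x : V) : (k : ℕ) → jetBase k (zeroJet k x) = x
  | 0 => rfl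
  | k + 1 => jetBase_zeroJet x k

lemma norm_zeroJet_sub_zeroJet (x y : V) : ∀ k : ℕ, ‖zeroJet k x - zeroJet k y‖ = ‖x - y‖
  | 0 => rfl
  | k + 1 => by
    change max ‖zeroJet k x - zeroJet k y‖ ‖(0 : JetSpace V k) - 0‖ = ‖x - y‖
    rw [norm_zeroJet_sub_zeroJet x y k, sub_zero, norm_zero, max_eq_left (norm_nonneg _)]

lemma continuous_jetBase : (k : ℕ) → Continuous (jetBase (V := V) k)
  | 0 => continuous_id
  | k + 1 => (continuous_jetBase k).comp continuous_fst

lemma eventually_jetBase {k : ℕ} {ξ : JetSpace V k} {P : V → Prop}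
    (h : ∀ᶠ y in 𝓝 (jetBase k ξ), P y) : ∀ᶠ ζ in 𝓝 ξ, P (jetBase k ζ) :=
  (continuous_jetBase k).continuousAt.eventually h

/-- All velocities of the jet have norm at most `τ`; `VelocitiesLeOne` is the case `τ = 1`. -/
def VelocitiesLE (τ : ℝ) : (k : ℕ) → JetSpace V k → Prop
  | 0, _ => True
  | k + 1, p => VelocitiesLE τ k p.1 ∧ ‖p.2‖ ≤ τ

lemma VelocitiesLE.mono {τ τ' : ℝ} (h : τ ≤ τ') : ∀ {k : ℕ} {p : JetSpace V k},
    VelocitiesLE τ k p → VelocitiesLE τ' k p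
  | 0, _, _ => trivial
  | _ + 1, _, hp => ⟨hp.1.mono h, hp.2.trans h⟩

lemma VelocitiesLeOne.velocitiesLE : ∀ {k : ℕ} {p : JetSpace V k},
    VelocitiesLeOne k p → VelocitiesLE 1 k p
  | 0, _, _ => trivial
  | _ + 1, _, hp => ⟨VelocitiesLeOne.velocitiesLE hp.1, hp.2⟩

lemma VelocitiesLE.norm_sub_zeroJet_le {τ : ℝ} (hτ : 0 ≤ τ) : ∀ {k : ℕ} {p : JetSpace V k},
    VelocitiesLE τ k p → ‖p - zeroJet k (jetBase k p)‖ ≤ τ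
  | 0, p, _ => by
    change ‖p - p‖ ≤ τ
    rwa [sub_self, norm_zero]
  | k + 1, p, hp => by
    change max ‖p.1 - zeroJet k (jetBase k p.1)‖ ‖p.2 - 0‖ ≤ τ
    rw [sub_zero]
    exact max_le (VelocitiesLE.norm_sub_zeroJet_le hτ hp.1) hp.2

end JetBase

section JetMap

variable {V : Type*} [NormedAddCommGroup V] [NormedSpace ℝ V]

/-- The linear map acting on all components of a jet as `L`. It is the derivative of the jet map
at a zero jet if `L` is the derivative of the map. -/
def jetDiagonal (L : V →L[ℝ] V) : (k : ℕ) → JetSpace V k →L[ℝ] JetSpace V k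
  | 0 => L
  | k + 1 => (jetDiagonal L k).prodMap (jetDiagonal L k)

lemma jetBase_jetMap (f : V → V) : (k : ℕ) → (ξ : JetSpace V k) →
    jetBase k (jetMap f k ξ) = f (jetBase k ξ)
  | 0, _ => rfl
  | k + 1, p => jetBase_jetMap f k p.1

lemma contDiffAt_jetMap {f : V → V} : (k m : ℕ) → (ξ : JetSpace V k) →
    ContDiffAt ℝ (m + k : ℕ) f (jetBase k ξ) → ContDiffAt ℝ m (jetMap f k) ξ
  | 0, _, _, h => h
  | k + 1, m, p, h => contDiffAt_vectorTangentMap (F := jetMap f k) (p := p)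
      (contDiffAt_jetMap k (m + 1) p.1 (by rwa [show m + 1 + k = m + (k + 1) by ring]))

lemma differentiableAt_jetMap {f : V → V} {k n : ℕ} (hk : k + 1 ≤ n) {ξ : JetSpace V k}
    (h : ContDiffAt ℝ n f (jetBase k ξ)) : DifferentiableAt ℝ (jetMap f k) ξ :=
  (contDiffAt_jetMap k 1 ξ (h.of_le (by norm_cast; omega))).differentiableAt (by simp)

lemma fderiv_jetMap_succ {f : V → V} {k : ℕ} {p : JetSpace V (k + 1)}
    (h : ContDiffAt ℝ (k + 2 : ℕ) f (jetBase (k + 1) p)) (v : JetSpace V (k + 1)) :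
    fderiv ℝ (jetMap f (k + 1)) p v = ((fderiv ℝ (jetMap f k) p.1 v.1,
      fderiv ℝ (jetMap f k) p.1 v.2 + fderiv ℝ (fderiv ℝ (jetMap f k)) p.1 v.1 p.2) :
        JetSpace V k × JetSpace V k) :=
  fderiv_vectorTangentMap_apply (F := jetMap f k) (p := p)
    (contDiffAt_jetMap k 2 p.1 (by rwa [add_comm 2 k])) v

lemma fderiv_jetMap_zeroJet {f : V → V} {x : V} : (k : ℕ) → ContDiffAt ℝ (k + 1 : ℕ) f x →
    fderiv ℝ (jetMap f k) (zeroJet k x) = jetDiagonal (fderiv ℝ f x) k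
  | 0, _ => rfl
  | k + 1, h => by
    ext1 v
    rw [fderiv_jetMap_succ (p := zeroJet (k + 1) x) (by rwa [jetBase_zeroJet])]
    change ((fderiv ℝ (jetMap f k) (zeroJet k x) v.1, fderiv ℝ (jetMap f k) (zeroJet k x) v.2 +
      fderiv ℝ (fderiv ℝ (jetMap f k)) (zeroJet k x) v.1 0) : JetSpace V k × JetSpace V k) =
      (jetDiagonal (fderiv ℝ f x) k v.1, jetDiagonal (fderiv ℝ f x) k v.2)
    rw [fderiv_jetMap_zeroJet k (h.of_le (by norm_cast; omega)), map_zero, add_zero]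

lemma jetMap_id : (k : ℕ) → (ξ : JetSpace V k) → jetMap (id : V → V) k ξ = ξ
  | 0, _ => rfl
  | k + 1, p => by
    have ih : jetMap (id : V → V) k = id := funext (jetMap_id k)
    change ((jetMap id k p.1, fderiv ℝ (jetMap id k) p.1 p.2) : JetSpace V k × JetSpace V k) = p
    rw [ih, fderiv_id]
    rfl

lemma jetMap_continuousLinearMap (L : V →L[ℝ] V) : (k : ℕ) → jetMap L k = jetDiagonal L k
  | 0 => rfl
  | k + 1 => by
    funext p
    change ((jetMap L k p.1, fderiv ℝ (jetMap L k) p.1 p.2) : JetSpace V k × JetSpace V k) = _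
    rw [jetMap_continuousLinearMap L k, (jetDiagonal L k).fderiv]
    rfl

lemma jetMap_comp {f g : V → V} {n : ℕ} : ∀ {k : ℕ}, k ≤ n → ∀ {ξ : JetSpace V k},
    ContDiffAt ℝ n g (jetBase k ξ) → ContDiffAt ℝ n f (g (jetBase k ξ)) →
      jetMap (f ∘ g) k ξ = jetMap f k (jetMap g k ξ)
  | 0, _, _, _, _ => rfl
  | k + 1, hk, p, hg, hf => by
    have hev : jetMap (f ∘ g) k =ᶠ[𝓝 p.1] jetMap f k ∘ jetMap g k := by
      filter_upwards [eventually_jetBase (ξ := p.1) (hg.eventually (by simp)),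
        eventually_jetBase (ξ := p.1) (hg.continuousAt.eventually (hf.eventually (by simp)))]
        with ζ hgζ hfζ
      exact jetMap_comp (by omega) hgζ hfζ
    have hdg := differentiableAt_jetMap (ξ := p.1) hk hg
    have hdf := differentiableAt_jetMap (ξ := jetMap g k p.1) hk (f := f)
      (by rwa [jetBase_jetMap])
    refine Prod.ext hev.self_of_nhds ?_
    change fderiv ℝ (jetMap (f ∘ g) k) p.1 p.2 = _
    rw [hev.fderiv_eq, fderiv_comp _ hdf hdg]
    rfl

lemma jetMap_mem_jetSet {h : V → V} {S S' : Set V} {n : ℕ} : ∀ {k : ℕ}, k ≤ n →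
    ∀ {ξ : JetSpace V k}, ContDiffAt ℝ n h (jetBase k ξ) →
    (∀ᶠ y in 𝓝 (jetBase k ξ), y ∈ S → h y ∈ S') → ξ ∈ jetSet S k → jetMap h k ξ ∈ jetSet S' k
  | 0, _, _, _, hS, hξ => hS.self_of_nhds hξ
  | k + 1, hk, p, hh, hS, hp => by
    have hev : ∀ᶠ ζ in 𝓝 p.1, ζ ∈ jetSet S k → jetMap h k ζ ∈ jetSet S' k := by
      filter_upwards [eventually_jetBase (ξ := p.1) (hh.eventually (by simp)),
        eventually_jetBase (ξ := p.1) (eventually_eventually_nhds.2 hS)] with ζ hhζ hSζ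
      exact jetMap_mem_jetSet (by omega) hhζ hSζ
    exact ⟨hev.self_of_nhds hp.1, mem_tangentConeAt_of_hasFDerivAt
      (differentiableAt_jetMap (ξ := p.1) hk hh).hasFDerivAt hev hp.2⟩

lemma jetMap_eq_self {h : V → V} {S : Set V} {n : ℕ} : ∀ {k : ℕ}, k ≤ n →
    ∀ {ξ : JetSpace V k}, ContDiffAt ℝ n h (jetBase k ξ) →
    (∀ᶠ y in 𝓝 (jetBase k ξ), y ∈ S → h y = y) → ξ ∈ jetSet S k → jetMap h k ξ = ξ
  | 0, _, _, _, hS, hξ => hS.self_of_nhds hξ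
  | k + 1, hk, p, hh, hS, hp => by
    have hev : ∀ᶠ ζ in 𝓝 p.1, ζ ∈ jetSet S k → jetMap h k ζ = ζ := by
      filter_upwards [eventually_jetBase (ξ := p.1) (hh.eventually (by simp)),
        eventually_jetBase (ξ := p.1) (eventually_eventually_nhds.2 hS)] with ζ hhζ hSζ
      exact jetMap_eq_self (by omega) hhζ hSζ
    have hid : HasFDerivWithinAt (jetMap h k) (ContinuousLinearMap.id ℝ _) (jetSet S k) p.1 :=
      (hasFDerivWithinAt_id p.1 _).congr_of_eventuallyEq
        (eventually_nhdsWithin_iff.2 hev) (hev.self_of_nhds hp.1)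
    exact Prod.ext (hev.self_of_nhds hp.1)
      ((differentiableAt_jetMap (ξ := p.1) hk hh).hasFDerivAt.hasFDerivWithinAt.unique_on hid hp.2)

lemma map_tangentSpaceOf_jetSet_le {h : V → V} {S S' : Set V} {n k : ℕ} (hk : k + 1 ≤ n)
    {ξ : JetSpace V k} (hh : ContDiffAt ℝ n h (jetBase k ξ))
    (hS : ∀ᶠ y in 𝓝 (jetBase k ξ), y ∈ S → h y ∈ S') (hξ : ξ ∈ jetSet S k) :
    (tangentSpaceOf (jetSet S k) ξ).map (fderiv ℝ (jetMap h k) ξ).toLinearMap ≤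
      tangentSpaceOf (jetSet S' k) (jetMap h k ξ) := by
  rw [tangentSpaceOf, Submodule.map_span_le]
  exact fun v hv => Submodule.subset_span
    (jetMap_mem_jetSet hk (ξ := ((ξ, v) : JetSpace V k × JetSpace V k)) hh hS ⟨hξ, hv⟩).2

lemma mem_jetSet_of_eventually {S S' : Set V} {k : ℕ} {ξ : JetSpace V k}
    (hS : ∀ᶠ y in 𝓝 (jetBase k ξ), y ∈ S → y ∈ S') (hξ : ξ ∈ jetSet S k) : ξ ∈ jetSet S' k := by
  simpa only [jetMap_id] using jetMap_mem_jetSet (h := id) le_rfl contDiffAt_id hS hξ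

lemma jetSet_univ : (k : ℕ) → jetSet (univ : Set V) k = univ
  | 0 => rfl
  | k + 1 => by
    ext p
    change p.1 ∈ jetSet univ k ∧ p.2 ∈ tangentConeAt ℝ (jetSet univ k) p.1 ↔ _
    rw [jetSet_univ k, tangentConeAt_univ]
    simp

lemma jetSet_mono {S S' : Set V} (h : S ⊆ S') : ∀ k : ℕ, jetSet S k ⊆ jetSet S' k
  | 0 => h
  | k + 1 => fun _ hp => ⟨jetSet_mono h k hp.1, tangentConeAt_mono (jetSet_mono h k) hp.2⟩

lemma tangentSpaceOf_jetSet_mono {S S' : Set V} (h : S ⊆ S') (k : ℕ) (ξ : JetSpace V k) :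
    tangentSpaceOf (jetSet S k) ξ ≤ tangentSpaceOf (jetSet S' k) ξ :=
  Submodule.span_mono (tangentConeAt_mono (jetSet_mono h k))

lemma zeroJet_mem_jetSet {S : Set V} {x : V} (hx : x ∈ S) : ∀ k : ℕ, zeroJet k x ∈ jetSet S k
  | 0 => hx
  | k + 1 => ⟨zeroJet_mem_jetSet hx k, zero_mem_tangentConeAt
      (subset_closure (zeroJet_mem_jetSet hx k))⟩

end JetMap

section JetSubmodule

variable {V : Type*} [NormedAddCommGroup V] [NormedSpace ℝ V]

/-- The subspace of `T^k V` of the jets all of whose components lie in `B`. It is the tangent space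
of `T^k S` at a zero jet if `B` is the tangent space of the submanifold `S`. -/
def jetSubmodule (B : Submodule ℝ V) : (k : ℕ) → Submodule ℝ (JetSpace V k)
  | 0 => B
  | k + 1 => (jetSubmodule B k).prod (jetSubmodule B k)

lemma jetSubmodule_sup (A B : Submodule ℝ V) :
    (k : ℕ) → jetSubmodule (A ⊔ B) k = jetSubmodule A k ⊔ jetSubmodule B k
  | 0 => rfl
  | k + 1 => by
    change (jetSubmodule (A ⊔ B) k).prod (jetSubmodule (A ⊔ B) k) =
      (jetSubmodule A k).prod (jetSubmodule A k) ⊔ (jetSubmodule B k).prod (jetSubmodule B k)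
    rw [jetSubmodule_sup A B k, Submodule.prod_sup_prod]

lemma jetSubmodule_inf (A B : Submodule ℝ V) :
    (k : ℕ) → jetSubmodule (A ⊓ B) k = jetSubmodule A k ⊓ jetSubmodule B k
  | 0 => rfl
  | k + 1 => by
    change (jetSubmodule (A ⊓ B) k).prod (jetSubmodule (A ⊓ B) k) =
      (jetSubmodule A k).prod (jetSubmodule A k) ⊓ (jetSubmodule B k).prod (jetSubmodule B k)
    rw [jetSubmodule_inf A B k, Submodule.prod_inf_prod]

lemma jetSubmodule_bot : (k : ℕ) → jetSubmodule (⊥ : Submodule ℝ V) k = ⊥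
  | 0 => rfl
  | k + 1 => by
    change (jetSubmodule (⊥ : Submodule ℝ V) k).prod (jetSubmodule (⊥ : Submodule ℝ V) k) = ⊥
    rw [jetSubmodule_bot k]
    exact Submodule.prod_bot

lemma jetSubmodule_top : (k : ℕ) → jetSubmodule (⊤ : Submodule ℝ V) k = ⊤
  | 0 => rfl
  | k + 1 => by
    change (jetSubmodule (⊤ : Submodule ℝ V) k).prod (jetSubmodule (⊤ : Submodule ℝ V) k) = ⊤
    rw [jetSubmodule_top k, Submodule.prod_top]

lemma disjoint_jetSubmodule {A B : Submodule ℝ V} (h : Disjoint A B) (k : ℕ) :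
    Disjoint (jetSubmodule A k) (jetSubmodule B k) := by
  rw [disjoint_iff, ← jetSubmodule_inf, disjoint_iff.1 h, jetSubmodule_bot]

lemma mem_jetSubmodule_iff_jetDiagonal {L : V →L[ℝ] V} {B : Submodule ℝ V}
    (hB : ∀ v, v ∈ B ↔ L v = v) :
    ∀ (k : ℕ) (v : JetSpace V k), v ∈ jetSubmodule B k ↔ jetDiagonal L k v = v
  | 0, v => hB v
  | k + 1, v => by
    change v.1 ∈ jetSubmodule B k ∧ v.2 ∈ jetSubmodule B k ↔
      ((jetDiagonal L k v.1, jetDiagonal L k v.2) : JetSpace V k × JetSpace V k) = v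
    rw [mem_jetSubmodule_iff_jetDiagonal hB k, mem_jetSubmodule_iff_jetDiagonal hB k]
    exact ⟨fun h => Prod.ext h.1 h.2, fun h => ⟨congrArg Prod.fst h, congrArg Prod.snd h⟩⟩

lemma norm_jetDiagonal_le {L : V →L[ℝ] V} {B : Submodule ℝ V} {c : ℝ} (hc : 0 ≤ c)
    (h : ∀ v ∈ B, ‖L v‖ ≤ c * ‖v‖) :
    ∀ k : ℕ, ∀ p ∈ jetSubmodule B k, ‖jetDiagonal L k p‖ ≤ c * ‖p‖
  | 0, p, hp => h p hp
  | k + 1, p, hp => by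
    change max ‖jetDiagonal L k p.1‖ ‖jetDiagonal L k p.2‖ ≤ c * max ‖p.1‖ ‖p.2‖
    rw [mul_max_of_nonneg _ _ hc]
    exact max_le_max (norm_jetDiagonal_le hc h k p.1 hp.1) (norm_jetDiagonal_le hc h k p.2 hp.2)

lemma opNorm_jetDiagonal_le (L : V →L[ℝ] V) (k : ℕ) : ‖jetDiagonal L k‖ ≤ ‖L‖ :=
  ContinuousLinearMap.opNorm_le_bound _ (norm_nonneg _) fun p =>
    norm_jetDiagonal_le (B := ⊤) (norm_nonneg L) (fun v _ => L.le_opNorm v) k p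
      (by rw [jetSubmodule_top]; trivial)

end JetSubmodule

section JetScale

variable {V : Type*} [NormedAddCommGroup V] [NormedSpace ℝ V]

/-- The automorphism of `T^k V` induced by the multiplication of the curve parameters by `t`: a
component obtained by `j` differentiations is multiplied by `t ^ j`. It preserves every `T^k S` and
makes the velocities small. -/
def jetScale (V : Type*) [NormedAddCommGroup V] [NormedSpace ℝ V] (t : ℝ) :
    (k : ℕ) → JetSpace V k →L[ℝ] JetSpace V k
  | 0 => ContinuousLinearMap.id ℝ V
  | k + 1 => (jetScale V t k).prodMap (t • jetScale V t k)

lemma jetBase_jetScale (t : ℝ) : (k : ℕ) → (ξ : JetSpace V k) →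
    jetBase k (jetScale V t k ξ) = jetBase k ξ
  | 0, _ => rfl
  | k + 1, p => jetBase_jetScale t k p.1

lemma jetScale_jetScale_inv {t : ℝ} (ht : t ≠ 0) : ∀ (k : ℕ) (p : JetSpace V k),
    jetScale V t k (jetScale V t⁻¹ k p) = p
  | 0, _ => rfl
  | k + 1, p => by
    refine Prod.ext (jetScale_jetScale_inv ht k p.1) ?_
    change t • jetScale V t k (t⁻¹ • jetScale V t⁻¹ k p.2) = p.2
    rw [map_smul, smul_inv_smul₀ ht, jetScale_jetScale_inv ht k p.2]

lemma jetScale_mem_jetSet {S : Set V} (t : ℝ) : ∀ {k : ℕ} {ξ : JetSpace V k},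
    ξ ∈ jetSet S k → jetScale V t k ξ ∈ jetSet S k
  | 0, _, h => h
  | k + 1, _, hp => ⟨jetScale_mem_jetSet t hp.1, smul_mem_tangentConeAt t
      (mem_tangentConeAt_of_hasFDerivAt (jetScale V t k).hasFDerivAt
        (.of_forall fun _ => jetScale_mem_jetSet t) hp.2)⟩

lemma jetScale_mem_tangentSpaceOf {S : Set V} (t : ℝ) {k : ℕ} {ξ v : JetSpace V k}
    (hv : v ∈ tangentSpaceOf (jetSet S k) ξ) :
    jetScale V t k v ∈ tangentSpaceOf (jetSet S k) (jetScale V t k ξ) := by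
  have hle : tangentSpaceOf (jetSet S k) ξ ≤
      (tangentSpaceOf (jetSet S k) (jetScale V t k ξ)).comap (jetScale V t k).toLinearMap :=
    Submodule.span_le.2 fun w hw => Submodule.subset_span <|
      mem_tangentConeAt_of_hasFDerivAt (jetScale V t k).hasFDerivAt
        (.of_forall fun _ => jetScale_mem_jetSet t) hw
  exact hle hv

lemma norm_jetScale_le {t : ℝ} (h0 : 0 ≤ t) (h1 : t ≤ 1) : ∀ (k : ℕ) (p : JetSpace V k),
    ‖jetScale V t k p‖ ≤ ‖p‖
  | 0, _ => le_rfl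
  | k + 1, p => by
    change max ‖jetScale V t k p.1‖ ‖t • jetScale V t k p.2‖ ≤ max ‖p.1‖ ‖p.2‖
    refine max_le_max (norm_jetScale_le h0 h1 k p.1) ?_
    rw [norm_smul, Real.norm_of_nonneg h0]
    exact (mul_le_of_le_one_left (norm_nonneg _) h1).trans (norm_jetScale_le h0 h1 k p.2)

lemma le_norm_jetScale {t : ℝ} (h0 : 0 ≤ t) (h1 : t ≤ 1) : ∀ (k : ℕ) (p : JetSpace V k),
    t ^ k * ‖p‖ ≤ ‖jetScale V t k p‖
  | 0, p => by
    rw [pow_zero, one_mul]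
    exact le_rfl
  | k + 1, p => by
    change t ^ (k + 1) * max ‖p.1‖ ‖p.2‖ ≤ max ‖jetScale V t k p.1‖ ‖t • jetScale V t k p.2‖
    rw [mul_max_of_nonneg _ _ (by positivity), norm_smul, Real.norm_of_nonneg h0, pow_succ',
      mul_assoc, mul_assoc]
    exact max_le_max
      ((mul_le_of_le_one_left (by positivity) h1).trans (le_norm_jetScale h0 h1 k p.1))
      (mul_le_mul_of_nonneg_left (le_norm_jetScale h0 h1 k p.2) h0)

lemma VelocitiesLE.jetScale {τ t : ℝ} (h0 : 0 ≤ t) (h1 : t ≤ 1) : ∀ {k : ℕ} {p : JetSpace V k},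
    VelocitiesLE τ k p → VelocitiesLE (t * τ) k (jetScale V t k p)
  | 0, _, _ => trivial
  | k + 1, p, hp => by
    refine ⟨VelocitiesLE.jetScale h0 h1 hp.1, ?_⟩
    change ‖t • _root_.jetScale V t k p.2‖ ≤ t * τ
    rw [norm_smul, Real.norm_of_nonneg h0]
    exact mul_le_mul_of_nonneg_left ((norm_jetScale_le h0 h1 k p.2).trans hp.2) h0

end JetScale

section RetractionGerm

variable {V : Type*} [NormedAddCommGroup V] [NormedSpace ℝ V]

/-- `r` is, near `x`, a retraction of class `C^n` onto the part of `S` near `x`. Since `D(jetMap r)`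
is then a projection onto the tangent spaces of `T^k S`, such germs replace charts in all estimates
on these tangent spaces. -/
structure IsRetractionGerm (n : ℕ) (r : V → V) (S : Set V) (x : V) : Prop where
  contDiffAt : ContDiffAt ℝ n r x
  eventually_mem : ∀ᶠ y in 𝓝 x, r y ∈ S
  eventually_eq_self : ∀ᶠ y in 𝓝 x, y ∈ S → r y = y

namespace IsRetractionGerm

variable {n k : ℕ} {r : V → V} {S : Set V} {ξ v : JetSpace V k} {x : V}

lemma of_le {m : ℕ} (h : IsRetractionGerm n r S x) (hmn : m ≤ n) : IsRetractionGerm m r S x :=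
  ⟨h.contDiffAt.of_le (by norm_cast), h.eventually_mem, h.eventually_eq_self⟩

lemma eventually_isRetractionGerm (h : IsRetractionGerm n r S x) :
    ∀ᶠ y in 𝓝 x, IsRetractionGerm n r S y := by
  filter_upwards [h.contDiffAt.eventually (by simp),
    eventually_eventually_nhds.2 h.eventually_mem,
    eventually_eventually_nhds.2 h.eventually_eq_self] with y h1 h2 h3
  exact ⟨h1, h2, h3⟩

lemma jetMap_eq_self (h : IsRetractionGerm n r S (jetBase k ξ)) (hk : k ≤ n)
    (hξ : ξ ∈ jetSet S k) : jetMap r k ξ = ξ :=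
  _root_.jetMap_eq_self hk h.contDiffAt h.eventually_eq_self hξ

lemma jetMap_mem (h : IsRetractionGerm n r S (jetBase k ξ)) (hk : k ≤ n) :
    jetMap r k ξ ∈ jetSet S k :=
  jetMap_mem_jetSet (S := univ) hk h.contDiffAt (h.eventually_mem.mono fun _ hy _ => hy)
    (by rw [jetSet_univ]; trivial)

lemma fderiv_mem_tangentConeAt (h : IsRetractionGerm n r S (jetBase k ξ)) (hk : k + 1 ≤ n)
    (hξ : ξ ∈ jetSet S k) (v : JetSpace V k) :
    fderiv ℝ (jetMap r k) ξ v ∈ tangentConeAt ℝ (jetSet S k) ξ := by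
  have hv : fderiv ℝ (jetMap r k) ξ v ∈ tangentConeAt ℝ (jetSet S k) (jetMap r k ξ) :=
    (jetMap_mem (k := k + 1) (ξ := ((ξ, v) : JetSpace V k × JetSpace V k)) h hk).2
  rwa [h.jetMap_eq_self (by omega) hξ] at hv

lemma fderiv_mem (h : IsRetractionGerm n r S (jetBase k ξ)) (hk : k + 1 ≤ n)
    (hξ : ξ ∈ jetSet S k) (v : JetSpace V k) :
    fderiv ℝ (jetMap r k) ξ v ∈ tangentSpaceOf (jetSet S k) ξ :=
  Submodule.subset_span (h.fderiv_mem_tangentConeAt hk hξ v)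

lemma mem_tangentSpaceOf_iff (h : IsRetractionGerm n r S (jetBase k ξ)) (hk : k + 1 ≤ n)
    (hξ : ξ ∈ jetSet S k) :
    v ∈ tangentSpaceOf (jetSet S k) ξ ↔ fderiv ℝ (jetMap r k) ξ v = v := by
  refine ⟨fun hv => ?_, fun hv => hv ▸ h.fderiv_mem hk hξ v⟩
  have hle : tangentSpaceOf (jetSet S k) ξ ≤
      LinearMap.eqLocus (fderiv ℝ (jetMap r k) ξ).toLinearMap LinearMap.id :=
    Submodule.span_le.2 fun w hw => congrArg Prod.snd
      (jetMap_eq_self (k := k + 1) (ξ := ((ξ, w) : JetSpace V k × JetSpace V k)) h hk ⟨hξ, hw⟩)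
  exact hle hv

lemma tangentSpaceOf_zeroJet (h : IsRetractionGerm n r S x) (hk : k + 1 ≤ n) (hx : x ∈ S) :
    tangentSpaceOf (jetSet S k) (zeroJet k x) = jetSubmodule (tangentSpaceOf S x) k := by
  ext v
  have h' : IsRetractionGerm n r S (jetBase k (zeroJet k x)) := by rwa [jetBase_zeroJet]
  rw [h'.mem_tangentSpaceOf_iff hk (zeroJet_mem_jetSet hx k),
    fderiv_jetMap_zeroJet k (h.contDiffAt.of_le (by norm_cast))]
  exact (mem_jetSubmodule_iff_jetDiagonal (fun w =>
    h.mem_tangentSpaceOf_iff (k := 0) (ξ := x) (by omega) hx) k v).symm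

end IsRetractionGerm

end RetractionGerm

section ContDiffAt

variable {E F G : Type*} [NormedAddCommGroup E] [NormedSpace ℝ E] [NormedAddCommGroup F]
  [NormedSpace ℝ F] [NormedAddCommGroup G] [NormedSpace ℝ G]

lemma exists_isOpen_contDiffOn {f : E → F} {n : ℕ} {x : E} (h : ContDiffAt ℝ n f x) :
    ∃ U, IsOpen U ∧ x ∈ U ∧ ContDiffOn ℝ n f U := by
  simpa using ContDiffWithinAt.contDiffOn' (m := n) le_rfl (by simp) h

lemma norm_iteratedFDeriv_comp_le_of_contDiffAt {g : F → G} {f : E → F} {n N : ℕ} {x : E}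
    (hg : ContDiffAt ℝ N g (f x)) (hf : ContDiffAt ℝ N f x) (hn : n ≤ N) {C D : ℝ}
    (hC : ∀ i ≤ n, ‖iteratedFDeriv ℝ i g (f x)‖ ≤ C)
    (hD : ∀ i, 1 ≤ i → i ≤ n → ‖iteratedFDeriv ℝ i f x‖ ≤ D ^ i) :
    ‖iteratedFDeriv ℝ n (g ∘ f) x‖ ≤ n.factorial * C * D ^ n := by
  obtain ⟨T, hT, hxT, hgT⟩ := exists_isOpen_contDiffOn hg
  obtain ⟨S, hS, hxS, hfS⟩ := exists_isOpen_contDiffOn hf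
  have hO : IsOpen (S ∩ f ⁻¹' T) := hfS.continuousOn.isOpen_inter_preimage hS hT
  have hx : x ∈ S ∩ f ⁻¹' T := ⟨hxS, hxT⟩
  rw [← iteratedFDerivWithin_of_isOpen n hO hx]
  refine norm_iteratedFDerivWithin_comp_le hgT (hfS.mono inter_subset_left) (by exact_mod_cast hn)
    hT.uniqueDiffOn hO.uniqueDiffOn (fun y hy => hy.2) hx (fun i hi => ?_) fun i hi0 hi => ?_
  · rw [iteratedFDerivWithin_of_isOpen i hT hxT]
    exact hC i hi
  · rw [iteratedFDerivWithin_of_isOpen i hO hx]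
    exact hD i hi0 hi

end ContDiffAt

section Projections

variable {V : Type*} [NormedAddCommGroup V] [NormedSpace ℝ V]

lemma exists_isProj_opNorm_le (V : Type*) [NormedAddCommGroup V] [NormedSpace ℝ V]
    [FiniteDimensional ℝ V] :
    ∃ C : ℝ, ∀ A : Submodule ℝ V, ∃ P : V →L[ℝ] V, LinearMap.IsProj A P ∧ ‖P‖ ≤ C := by
  let e : V ≃L[ℝ] EuclideanSpace ℝ (Fin (Module.finrank ℝ V)) := toEuclidean
  refine ⟨‖e.symm.toContinuousLinearMap‖ * ‖e.toContinuousLinearMap‖, fun A => ?_⟩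
  let B := A.map e.toLinearMap
  refine ⟨e.symm.toContinuousLinearMap ∘L B.starProjection ∘L e.toContinuousLinearMap,
    ⟨fun v => ?_, fun v hv => ?_⟩, ?_⟩
  · obtain ⟨w, hw, hwv⟩ := B.starProjection_apply_mem (e v)
    change e.symm (B.starProjection (e v)) ∈ A
    rw [← show e w = B.starProjection (e v) from hwv, e.symm_apply_apply]
    exact hw
  · change e.symm (B.starProjection (e v)) = v
    have hBv : B.starProjection (e v) = e v :=
      Submodule.starProjection_eq_self_iff.2 (Submodule.mem_map_of_mem hv)
    rw [hBv, e.symm_apply_apply]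
  · refine (ContinuousLinearMap.opNorm_comp_le _ _).trans ?_
    gcongr
    exact (ContinuousLinearMap.opNorm_comp_le _ _).trans
      (mul_le_of_le_one_left (norm_nonneg _) B.starProjection_norm_le)

lemma isRetractionGerm_of_isProj {A : Submodule ℝ V} {P : V →L[ℝ] V} (hP : LinearMap.IsProj A P)
    (n : ℕ) (x : V) : IsRetractionGerm n P (A : Set V) x where
  contDiffAt := P.contDiff.contDiffAt
  eventually_mem := .of_forall hP.map_mem
  eventually_eq_self := .of_forall hP.map_id

lemma tangentSpaceOf_jetSet_submodule [FiniteDimensional ℝ V] (A : Submodule ℝ V) {k : ℕ}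
    {ξ : JetSpace V k} (hξ : ξ ∈ jetSet (A : Set V) k) :
    tangentSpaceOf (jetSet (A : Set V) k) ξ = jetSubmodule A k := by
  obtain ⟨_, hC⟩ := exists_isProj_opNorm_le V
  obtain ⟨P, hP, -⟩ := hC A
  ext v
  rw [(isRetractionGerm_of_isProj hP (k + 1) (jetBase k ξ)).mem_tangentSpaceOf_iff le_rfl hξ,
    jetMap_continuousLinearMap, ContinuousLinearMap.fderiv, mem_jetSubmodule_iff_jetDiagonal]
  exact fun v => ⟨hP.map_id v, fun hv => hv ▸ hP.map_mem v⟩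

/-- The retraction onto a submanifold given by a chart `Φ` which flattens it, if `P` is a projection
onto the flattened submanifold. -/
def chartRetraction (Φ : OpenPartialHomeomorph V V) (P : V → V) (y : V) : V :=
  Φ.symm (P (Φ y))

namespace Flattens

variable {n : ℕ} {Φ : OpenPartialHomeomorph V V} {S : Set V} {x : V} {A : Submodule ℝ V}
  {P : V →L[ℝ] V}

protected lemma contDiffAt (h : Flattens n Φ S x A) {y : V} (hy : y ∈ Φ.source) :
    ContDiffAt ℝ n Φ y :=
  h.contDiffOn.contDiffAt (Φ.open_source.mem_nhds hy)

protected lemma contDiffAt_symm (h : Flattens n Φ S x A) {z : V} (hz : z ∈ Φ.target) :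
    ContDiffAt ℝ n Φ.symm z :=
  h.contDiffOn_symm.contDiffAt (Φ.open_target.mem_nhds hz)

protected lemma of_le {m n : WithTop ℕ∞} (hmn : m ≤ n) (h : Flattens n Φ S x A) :
    Flattens m Φ S x A :=
  ⟨h.mem_source, h.contDiffOn.of_le hmn, h.contDiffOn_symm.of_le hmn, h.mem_iff⟩

lemma proj_apply_eq_self (h : Flattens n Φ S x A) (hP : LinearMap.IsProj A P) {y : V}
    (hy : y ∈ Φ.source) (hyS : y ∈ S) : P (Φ y) = Φ y :=
  hP.map_id _ ((h.mem_iff y hy).1 hyS)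

lemma isRetractionGerm_chartRetraction (h : Flattens n Φ S x A) (hP : LinearMap.IsProj A P)
    (hx : x ∈ S) : IsRetractionGerm n (chartRetraction Φ P) S x := by
  have hPx : P (Φ x) = Φ x := h.proj_apply_eq_self hP h.mem_source hx
  have hxt : P (Φ x) ∈ Φ.target := hPx.symm ▸ Φ.map_source h.mem_source
  have hPΦ : ContDiffAt ℝ n (P ∘ Φ) x := P.contDiff.contDiffAt.comp x (h.contDiffAt h.mem_source)
  refine ⟨ContDiffAt.comp x (h.contDiffAt_symm hxt) hPΦ, ?_, ?_⟩
  · filter_upwards [hPΦ.continuousAt.eventually (Φ.open_target.mem_nhds hxt)] with y hy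
    refine (h.mem_iff _ (Φ.map_target hy)).2 ?_
    change Φ (Φ.symm (P (Φ y))) ∈ A
    rw [Φ.right_inv (x := P (Φ y)) hy]
    exact hP.map_mem _
  · filter_upwards [Φ.open_source.mem_nhds h.mem_source] with y hy hyS
    rw [chartRetraction, h.proj_apply_eq_self hP hy hyS, Φ.left_inv hy]

lemma exists_isRetractionGerm [FiniteDimensional ℝ V] (h : Flattens n Φ S x A) (hx : x ∈ S) :
    ∃ r, IsRetractionGerm n r S x := by
  obtain ⟨_, hproj⟩ := exists_isProj_opNorm_le V
  obtain ⟨P, hP, -⟩ := hproj A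
  exact ⟨_, h.isRetractionGerm_chartRetraction hP hx⟩

lemma norm_iteratedFDeriv_chartRetraction_le (h : Flattens n Φ S x A)
    (hP : LinearMap.IsProj A P) (hx : x ∈ S) {K R C : ℝ} (hR : ‖x‖ ≤ R) (hC : ‖P‖ ≤ C)
    (hK : ∀ j : ℕ, 1 ≤ j → j ≤ n → ‖iteratedFDeriv ℝ j Φ x‖ ≤ K ∧
      ‖iteratedFDeriv ℝ j Φ.symm (Φ x)‖ ≤ K) {j : ℕ} (hj : j ≤ n) :
    ‖iteratedFDeriv ℝ j (chartRetraction Φ P) x‖ ≤ j.factorial * max K R * max (C * K) 1 ^ j := by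
  have hPx : P (Φ x) = Φ x := h.proj_apply_eq_self hP h.mem_source hx
  have hΦ := h.contDiffAt h.mem_source
  have hs : ContDiffAt ℝ n Φ.symm ((P ∘ Φ) x) := by
    rw [Function.comp_apply, hPx]
    exact h.contDiffAt_symm (Φ.map_source h.mem_source)
  refine norm_iteratedFDeriv_comp_le_of_contDiffAt (g := Φ.symm) (f := P ∘ Φ) hs
    (P.contDiff.contDiffAt.comp x hΦ) hj (fun i hi => ?_) fun i hi0 hi => ?_
  · rw [Function.comp_apply, hPx]
    rcases Nat.eq_zero_or_pos i with rfl | hi0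
    · rw [norm_iteratedFDeriv_zero, Φ.left_inv h.mem_source]
      exact hR.trans (le_max_right _ _)
    · exact (hK i hi0 (hi.trans hj)).2.trans (le_max_left _ _)
  · have hin : (i : WithTop ℕ∞) ≤ n := by exact_mod_cast hi.trans hj
    calc ‖iteratedFDeriv ℝ i (P ∘ Φ) x‖ ≤ ‖P‖ * ‖iteratedFDeriv ℝ i Φ x‖ :=
          P.norm_iteratedFDeriv_comp_left hΦ hin
      _ ≤ C * K := mul_le_mul hC (hK i hi0 (hi.trans hj)).1 (norm_nonneg _)
          ((norm_nonneg P).trans hC)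
      _ ≤ max (C * K) 1 := le_max_left _ _
      _ ≤ max (C * K) 1 ^ i := le_self_pow₀ (le_max_right _ _) (by omega)

end Flattens

lemma IsEmbeddedSubmanifold.of_le {m n : WithTop ℕ∞} {M : Set V} (hM : IsEmbeddedSubmanifold n M)
    (hmn : m ≤ n) : IsEmbeddedSubmanifold m M := fun x hx =>
  let ⟨Φ, A, hΦ⟩ := hM x hx
  ⟨Φ, A, hΦ.of_le hmn⟩

lemma IsEmbeddedSubmanifold.exists_isRetractionGerm [FiniteDimensional ℝ V] {n : ℕ} {M : Set V}
    (hM : IsEmbeddedSubmanifold n M) {x : V} (hx : x ∈ M) : ∃ r, IsRetractionGerm n r M x :=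
  let ⟨_, _, hΦ⟩ := hM x hx
  hΦ.exists_isRetractionGerm hx

lemma IsInvariantLeafFamily.exists_isRetractionGerm [FiniteDimensional ℝ V] {n : ℕ} {M Λ : Set V}
    {h : V → V} {A : V → Submodule ℝ V} {W : V → Set V} (hW : IsInvariantLeafFamily n M Λ h A W)
    {x : V} (hx : x ∈ Λ) : ∃ r, IsRetractionGerm n r (W x) x :=
  let ⟨_, hK⟩ := hW.smooth
  let ⟨_, _, hΦ, _⟩ := hK x hx
  hΦ.exists_isRetractionGerm (hW.mem x hx)

end Projections

section Splitting

variable {V : Type*} [AddCommGroup V] [Module ℝ V]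

namespace IsSplitting

variable {T A B C : Submodule ℝ V}

lemma disjoint_right (h : IsSplitting T A B C) : Disjoint C (B ⊔ A) := by
  rw [sup_comm]
  exact (iSupIndep_fin_three.1 h.2).2.2

lemma swap (h : IsSplitting T A B C) : IsSplitting T A C B := by
  obtain ⟨hsup, hind⟩ := h
  obtain ⟨hA, hB, hC⟩ := iSupIndep_fin_three.1 hind
  refine ⟨by rw [sup_right_comm, hsup], iSupIndep_fin_three.2 ⟨?_, ?_, ?_⟩⟩
  · exact hA.mono_right (sup_comm B C).ge
  · exact hC.mono_right (sup_comm A B).ge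
  · exact hB.mono_right (sup_comm C A).ge

lemma sup_sup_eq (h : IsSplitting T A B C) : C ⊔ (B ⊔ A) = T := by
  rw [← h.1, sup_comm B A, sup_comm C]

lemma sup_inf_sup (h : IsSplitting T A B C) : (B ⊔ A) ⊓ (C ⊔ A) = A := by
  rw [sup_comm B A, sup_inf_assoc_of_le B (le_sup_right : A ≤ C ⊔ A),
    disjoint_iff.1 h.swap.disjoint_right, sup_bot_eq]

lemma map {V' : Type*} [AddCommGroup V'] [Module ℝ V'] (h : IsSplitting T A B C)
    {e : V →ₗ[ℝ] V'} (he : Function.Injective e) :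
    IsSplitting (T.map e) (A.map e) (B.map e) (C.map e) := by
  obtain ⟨hsup, hind⟩ := h
  obtain ⟨hA, hB, hC⟩ := iSupIndep_fin_three.1 hind
  refine ⟨by rw [← Submodule.map_sup, ← Submodule.map_sup, hsup],
    iSupIndep_fin_three.2 ⟨?_, ?_, ?_⟩⟩
  · exact (Submodule.map_sup B C e) ▸ Submodule.disjoint_map he hA
  · exact (Submodule.map_sup C A e) ▸ Submodule.disjoint_map he hB
  · exact (Submodule.map_sup A B e) ▸ Submodule.disjoint_map he hC

end IsSplitting

lemma IsSplitting.jetSubmodule {V : Type*} [NormedAddCommGroup V] [NormedSpace ℝ V]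
    {T A B C : Submodule ℝ V} (h : IsSplitting T A B C) (k : ℕ) :
    IsSplitting (jetSubmodule T k) (jetSubmodule A k) (jetSubmodule B k) (jetSubmodule C k) := by
  obtain ⟨hsup, hind⟩ := h
  obtain ⟨hA, hB, hC⟩ := iSupIndep_fin_three.1 hind
  refine ⟨by rw [← jetSubmodule_sup, ← jetSubmodule_sup, hsup],
    iSupIndep_fin_three.2 ⟨?_, ?_, ?_⟩⟩
  · exact (jetSubmodule_sup B C k) ▸ disjoint_jetSubmodule hA k
  · exact (jetSubmodule_sup C A k) ▸ disjoint_jetSubmodule hB k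
  · exact (jetSubmodule_sup A B k) ▸ disjoint_jetSubmodule hC k

lemma exists_projection_of_disjoint {P Q : Submodule ℝ V} (h : Disjoint P Q) :
    ∃ π : V →ₗ[ℝ] V, (∀ v, π v ∈ P) ∧ (∀ v ∈ Q, π v = 0) ∧ ∀ v ∈ P ⊔ Q, v - π v ∈ Q := by
  obtain ⟨N, hN⟩ := (P ⊔ Q).exists_isCompl
  have hP : IsCompl P (Q ⊔ N) := h.isCompl_sup_right_of_isCompl_sup_left hN
  have hker : ∀ v ∈ Q, P.projection _ hP v = 0 := fun v hv =>
    (Submodule.projection_apply_eq_zero_iff hP).2 (Submodule.mem_sup_left hv)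
  refine ⟨P.projection _ hP, Submodule.projection_apply_mem hP, hker, fun v hv => ?_⟩
  obtain ⟨p, hp, q, hq, rfl⟩ := Submodule.mem_sup.1 hv
  rwa [map_add, (Submodule.projection_eq_self_iff hP p).2 hp, hker q hq, add_zero,
    add_sub_cancel_left]

end Splitting

section FlattenedJets

variable {V : Type*} [NormedAddCommGroup V] [NormedSpace ℝ V]

lemma finiteDimensional_jetSpace [FiniteDimensional ℝ V] :
    (k : ℕ) → FiniteDimensional ℝ (JetSpace V k)
  | 0 => inferInstanceAs (FiniteDimensional ℝ V)
  | k + 1 =>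
    haveI : FiniteDimensional ℝ (JetSpace V k) := finiteDimensional_jetSpace k
    inferInstanceAs (FiniteDimensional ℝ (JetSpace V k × JetSpace V k))

namespace Flattens

variable {Φ : OpenPartialHomeomorph V V} {n k : ℕ} {S : Set V} {x : V} {A : Submodule ℝ V}

lemma jetMap_symm_jetMap (h : Flattens n Φ S x A) (hk : k ≤ n) {ξ : JetSpace V k}
    (hξ : jetBase k ξ ∈ Φ.source) : jetMap Φ.symm k (jetMap Φ k ξ) = ξ := by
  have hΦ : ContDiffAt ℝ n Φ (jetBase k ξ) := h.contDiffAt hξ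
  have hs : ContDiffAt ℝ n Φ.symm (Φ (jetBase k ξ)) := h.contDiffAt_symm (Φ.map_source hξ)
  rw [← jetMap_comp hk hΦ hs]
  refine _root_.jetMap_eq_self (S := univ) hk (hs.comp _ hΦ) ?_ (by rw [jetSet_univ]; trivial)
  filter_upwards [Φ.open_source.mem_nhds hξ] with y hy _
  exact Φ.left_inv hy

lemma fderiv_jetMap_symm_fderiv_jetMap (h : Flattens n Φ S x A) (hk : k + 1 ≤ n)
    {ξ : JetSpace V k} (hξ : jetBase k ξ ∈ Φ.source) (v : JetSpace V k) :
    fderiv ℝ (jetMap Φ.symm k) (jetMap Φ k ξ) (fderiv ℝ (jetMap Φ k) ξ v) = v :=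
  congrArg Prod.snd (h.jetMap_symm_jetMap hk (ξ := ((ξ, v) : JetSpace V k × JetSpace V k)) hξ)

lemma tangentSpaceOf_jetSet [FiniteDimensional ℝ V] (h : Flattens n Φ S x A) (hk : k + 1 ≤ n)
    {ξ : JetSpace V k} (hξ : ξ ∈ jetSet S k) (hb : jetBase k ξ ∈ Φ.source) :
    tangentSpaceOf (jetSet S k) ξ =
      (jetSubmodule A k).comap (fderiv ℝ (jetMap Φ k) ξ).toLinearMap := by
  have hb' : jetBase k (jetMap Φ k ξ) ∈ Φ.target := by
    rw [jetBase_jetMap]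
    exact Φ.map_source hb
  have hS : ∀ᶠ y in 𝓝 (jetBase k ξ), y ∈ S → Φ y ∈ (A : Set V) := by
    filter_upwards [Φ.open_source.mem_nhds hb] with y hy using (h.mem_iff y hy).1
  have hA : ∀ᶠ y in 𝓝 (jetBase k (jetMap Φ k ξ)), y ∈ (A : Set V) → Φ.symm y ∈ S := by
    filter_upwards [Φ.open_target.mem_nhds hb'] with y hy hyA
    exact (h.mem_iff _ (Φ.map_target hy)).2 (by rwa [Φ.right_inv hy])
  have hξ' := jetMap_mem_jetSet (by omega) (h.contDiffAt hb) hS hξ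
  have hle := map_tangentSpaceOf_jetSet_le hk (h.contDiffAt hb) hS hξ
  have hge := map_tangentSpaceOf_jetSet_le hk (h.contDiffAt_symm hb') hA hξ'
  rw [tangentSpaceOf_jetSet_submodule A hξ'] at hle hge
  rw [h.jetMap_symm_jetMap (by omega) hb] at hge
  refine le_antisymm (Submodule.map_le_iff_le_comap.1 hle) fun v hv => ?_
  rw [← h.fderiv_jetMap_symm_fderiv_jetMap hk hb v]
  exact hge (Submodule.mem_map_of_mem hv)

lemma exists_injective_comap_eq_map [FiniteDimensional ℝ V] (h : Flattens n Φ S x A)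
    (hk : k + 1 ≤ n) {ξ : JetSpace V k} (hb : jetBase k ξ ∈ Φ.source) :
    ∃ e : JetSpace V k →ₗ[ℝ] JetSpace V k, Function.Injective e ∧
      ∀ B : Submodule ℝ (JetSpace V k),
        B.comap (fderiv ℝ (jetMap Φ k) ξ).toLinearMap = B.map e := by
  have : FiniteDimensional ℝ (JetSpace V k) := finiteDimensional_jetSpace k
  have hinj : Function.Injective (fderiv ℝ (jetMap Φ k) ξ).toLinearMap :=
    Function.LeftInverse.injective (h.fderiv_jetMap_symm_fderiv_jetMap hk hb)
  let e := LinearEquiv.ofInjectiveEndo _ hinj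
  exact ⟨e.symm, e.symm.injective, fun B => Submodule.comap_equiv_eq_map_symm e B⟩

end Flattens

lemma IsSplitting.exists_jet_splitting [FiniteDimensional ℝ V] {T A B C : Submodule ℝ V}
    (h : IsSplitting T A B C) {k : ℕ} {M WB WC WA : Set V} {Φ : OpenPartialHomeomorph V V} {x : V}
    (hM : Flattens (k + 1 : ℕ) Φ M x T) (hB : Flattens (k + 1 : ℕ) Φ WB x (B ⊔ A))
    (hC : Flattens (k + 1 : ℕ) Φ WC x (C ⊔ A)) (hA : Flattens (k + 1 : ℕ) Φ WA x A)
    {ξ : JetSpace V k} (hξ : ξ ∈ jetSet WA k) (hξM : ξ ∈ jetSet M k) (hξB : ξ ∈ jetSet WB k)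
    (hξC : ξ ∈ jetSet WC k) (hb : jetBase k ξ = x) :
    ∃ Fc Fu Fs : Submodule ℝ (JetSpace V k),
      IsSplitting (tangentSpaceOf (jetSet M k) ξ) Fc Fu Fs ∧
      Fu ⊔ Fc = tangentSpaceOf (jetSet WB k) ξ ∧ Fs ⊔ Fc = tangentSpaceOf (jetSet WC k) ξ ∧
      tangentSpaceOf (jetSet WB k) ξ ⊓ tangentSpaceOf (jetSet WC k) ξ = Fc ∧
      Fc = tangentSpaceOf (jetSet WA k) ξ := by
  have hb' : jetBase k ξ ∈ Φ.source := hb ▸ hM.mem_source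
  obtain ⟨e, he, hcomap⟩ := hM.exists_injective_comap_eq_map le_rfl hb'
  rw [hM.tangentSpaceOf_jetSet le_rfl hξM hb', hB.tangentSpaceOf_jetSet le_rfl hξB hb',
    hC.tangentSpaceOf_jetSet le_rfl hξC hb', hA.tangentSpaceOf_jetSet le_rfl hξ hb']
  have hs := (h.jetSubmodule k).map he
  simp only [hcomap, jetSubmodule_sup, Submodule.map_sup]
  exact ⟨_, _, _, hs, rfl, rfl, hs.sup_inf_sup, rfl⟩

end FlattenedJets

section AdaptedChart

variable {V : Type*} [NormedAddCommGroup V] [NormedSpace ℝ V]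

lemma exists_openPartialHomeomorph_of_contDiffAt {E F : Type*} [NormedAddCommGroup E]
    [NormedSpace ℝ E] [CompleteSpace E] [NormedAddCommGroup F] [NormedSpace ℝ F] {n : ℕ}
    (hn : n ≠ 0) {Ψ : E → F} {x : E} {L : E ≃L[ℝ] F} (hc : ContDiffAt ℝ n Ψ x)
    (hL : HasFDerivAt Ψ (L : E →L[ℝ] F) x) {p : E → Prop} (hp : ∀ᶠ y in 𝓝 x, p y) :
    ∃ Φ : OpenPartialHomeomorph E F, ⇑Φ = Ψ ∧ x ∈ Φ.source ∧
      ContDiffOn ℝ n Φ Φ.source ∧ ContDiffOn ℝ n Φ.symm Φ.target ∧ ∀ y ∈ Φ.source, p y := by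
  have hn' : (n : WithTop ℕ∞) ≠ 0 := by exact_mod_cast hn
  let e := hc.toOpenPartialHomeomorph Ψ hL hn'
  have hx : x ∈ e.source := hc.mem_toOpenPartialHomeomorph_source hL hn'
  have hxt : Ψ x ∈ e.target := hc.image_mem_toOpenPartialHomeomorph_target hL hn'
  have hex : e.symm (Ψ x) = x := e.left_inv hx
  have hs : ContDiffAt ℝ n e.symm (Ψ x) :=
    e.contDiffAt_symm (f₀' := L) hxt (by rw [hex]; exact hL) (by rw [hex]; exact hc)
  obtain ⟨U, hU, hxU, hcU⟩ := exists_isOpen_contDiffOn hc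
  obtain ⟨U', hU', hxU', hcU'⟩ := exists_isOpen_contDiffOn hs
  obtain ⟨O, hpO, hO, hxO⟩ := eventually_nhds_iff.1 hp
  have hopen : IsOpen (e.source ∩ e ⁻¹' U' ∩ (U ∩ O)) :=
    (e.isOpen_inter_preimage hU').inter (hU.inter hO)
  refine ⟨e.restrOpen _ hopen, rfl, ⟨hx, ⟨hx, hxU'⟩, hxU, hxO⟩,
    hcU.mono fun y hy => hy.2.2.1, hcU'.mono fun y hy => ?_, fun y hy => hpO y hy.2.2.2⟩
  have hy' : e (e.symm y) ∈ U' := hy.2.1.2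
  rwa [e.right_inv hy.1] at hy'

namespace IsRetractionGerm

variable {n : ℕ} {r : V → V} {S : Set V} {x : V}

lemma apply_eq_self (h : IsRetractionGerm n r S x) (hx : x ∈ S) : r x = x :=
  h.eventually_eq_self.self_of_nhds hx

lemma hasFDerivAt (h : IsRetractionGerm n r S x) (hn : n ≠ 0) :
    HasFDerivAt r (fderiv ℝ r x) x :=
  (h.contDiffAt.differentiableAt (by exact_mod_cast hn)).hasFDerivAt

lemma fderiv_apply_mem (h : IsRetractionGerm n r S x) (hn : n ≠ 0) (hx : x ∈ S) (v : V) :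
    fderiv ℝ r x v ∈ tangentSpaceOf S x :=
  h.fderiv_mem (k := 0) (ξ := x) (by omega) hx v

lemma fderiv_apply_eq_self (h : IsRetractionGerm n r S x) (hn : n ≠ 0) (hx : x ∈ S) {v : V}
    (hv : v ∈ tangentSpaceOf S x) : fderiv ℝ r x v = v :=
  (h.mem_tangentSpaceOf_iff (k := 0) (ξ := x) (by omega) hx).1 hv

lemma injective_id_add_proj_fderiv_sub_id (h : IsRetractionGerm n r S x) (hn : n ≠ 0) (hx : x ∈ S)
    {P : V →L[ℝ] V} (hP : LinearMap.IsProj (tangentSpaceOf S x) P) :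
    Function.Injective (ContinuousLinearMap.id ℝ V +
      P ∘L (fderiv ℝ r x - ContinuousLinearMap.id ℝ V)).toLinearMap := by
  refine (injective_iff_map_eq_zero _).2 fun v hv => ?_
  replace hv : v + P (fderiv ℝ r x v - v) = 0 := hv
  have hvT : v ∈ tangentSpaceOf S x := by
    rw [eq_neg_of_add_eq_zero_left hv]
    exact neg_mem (hP.map_mem _)
  rwa [h.fderiv_apply_eq_self hn hx hvT, sub_self, map_zero, add_zero] at hv

lemma eventually_mem_iff [FiniteDimensional ℝ V] (h : IsRetractionGerm n r S x) (hn : n ≠ 0)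
    (hx : x ∈ S) {Ψ : V → V} (hΨ : ContDiffAt ℝ n Ψ x)
    (hΨ' : HasFDerivAt Ψ (ContinuousLinearMap.id ℝ V) x)
    (hm : ∀ᶠ y in 𝓝 x, y ∈ S → Ψ y ∈ tangentSpaceOf S x) :
    ∀ᶠ y in 𝓝 x, y ∈ S ↔ Ψ y ∈ tangentSpaceOf S x := by
  have := FiniteDimensional.complete ℝ V
  obtain ⟨_, hproj⟩ := exists_isProj_opNorm_le V
  obtain ⟨P, hP, -⟩ := hproj (tangentSpaceOf S x)
  have hrx : r x = x := h.apply_eq_self hx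
  have hr : Tendsto r (𝓝 x) (𝓝 x) := by simpa only [hrx] using h.contDiffAt.continuousAt.tendsto
  -- `F` agrees with `Ψ` on `S` and is locally injective. If `Ψ y` is tangent, then
  -- `F y = Ψ (r y) = F (r y)`, hence `y = r y ∈ S`.
  let F : V → V := fun y => Ψ y + P (Ψ (r y) - Ψ y)
  have hΨr : ContDiffAt ℝ n (Ψ ∘ r) x := (hrx.symm ▸ hΨ).comp x h.contDiffAt
  have hΨr' : HasFDerivAt (Ψ ∘ r) (fderiv ℝ r x) x :=
    HasFDerivAt.comp x (g' := ContinuousLinearMap.id ℝ V) (by rwa [hrx]) (h.hasFDerivAt hn)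
  have hF : ContDiffAt ℝ n F x := hΨ.add (P.contDiff.contDiffAt.comp x (hΨr.sub hΨ))
  let D := (LinearEquiv.ofInjectiveEndo _
    (h.injective_id_add_proj_fderiv_sub_id hn hx hP)).toContinuousLinearEquiv
  have hF' : HasFDerivAt F (D : V →L[ℝ] V) x :=
    (hΨ'.add (P.hasFDerivAt.comp x (hΨr'.sub hΨ'))).congr_fderiv (by ext v; rfl)
  obtain ⟨e, he, hxe, -, -, -⟩ := exists_openPartialHomeomorph_of_contDiffAt hn hF hF' hm
  have hsource := e.open_source.mem_nhds hxe
  filter_upwards [hm, hr.eventually hm, hsource, hr hsource, h.eventually_mem,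
    hr.eventually h.eventually_eq_self] with y hy hry hye hrye hrS hrr
  refine ⟨hy, fun hyT => ?_⟩
  have hFy : F y = F (r y) := by
    change Ψ y + P (Ψ (r y) - Ψ y) = Ψ (r y) + P (Ψ (r (r y)) - Ψ (r y))
    rw [hrr hrS, hP.map_id _ (sub_mem (hry hrS) hyT), sub_self, map_zero, add_zero,
      add_sub_cancel]
  rw [e.injOn hye hrye (by rwa [he])]
  exact hrS

end IsRetractionGerm

/-- Coordinates near `x` adapted to a manifold with retraction `rM` and to two submanifolds with
retractions `rB`, `rC`. Here `P`, `πB`, `πC` are projections onto the tangent space of the manifold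
and onto the complements of the tangent space of either submanifold in that of the other one. -/
def adaptedChart (P πB πC : V →L[ℝ] V) (rM rB rC : V → V) (x y : V) : V :=
  P (y - x) + (y - rM y - P (y - rM y)) - πB (P (rC y - x)) - πC (P (rB y - x))

section AdaptedChartLemmas

variable {T A B C : Submodule ℝ V} {P πB πC : V →L[ℝ] V} {rM rB rC : V → V} {x y : V}

lemma contDiffAt_adaptedChart {n : ℕ} (hM : ContDiffAt ℝ n rM x) (hB : ContDiffAt ℝ n rB x)
    (hC : ContDiffAt ℝ n rC x) : ContDiffAt ℝ n (adaptedChart P πB πC rM rB rC x) x := by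
  unfold adaptedChart
  fun_prop

lemma hasFDerivAt_adaptedChart {LM LB LC : V →L[ℝ] V} (hM : HasFDerivAt rM LM x)
    (hB : HasFDerivAt rB LB x) (hC : HasFDerivAt rC LC x) (hPM : ∀ v, P (LM v) = LM v)
    (hPC : ∀ v, πB (P (LC v)) = 0) (hPB : ∀ v, πC (P (LB v)) = 0) :
    HasFDerivAt (adaptedChart P πB πC rM rB rC x) (ContinuousLinearMap.id ℝ V) x := by
  have hid : HasFDerivAt (fun y : V => y) (ContinuousLinearMap.id ℝ V) x := hasFDerivAt_id x
  have hsubM := hid.sub hM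
  refine ((((P.hasFDerivAt.comp x (hid.sub_const x)).add
    (hsubM.sub (P.hasFDerivAt.comp x hsubM))).sub
    ((πB ∘L P).hasFDerivAt.comp x (hC.sub_const x))).sub
    ((πC ∘L P).hasFDerivAt.comp x (hB.sub_const x))).congr_fderiv ?_
  ext v
  change P v + (v - LM v - P (v - LM v)) - πB (P (LC v)) - πC (P (LB v)) = v
  rw [hPC, hPB, map_sub, hPM]
  abel

lemma adaptedChart_comm :
    adaptedChart P πB πC rM rB rC x y = adaptedChart P πC πB rM rC rB x y :=
  sub_right_comm _ _ _

lemma adaptedChart_mem (hP : ∀ v, P v ∈ T) (hB : ∀ v, πB v ∈ T) (hC : ∀ v, πC v ∈ T)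
    (hM : rM y = y) : adaptedChart P πB πC rM rB rC x y ∈ T := by
  rw [adaptedChart, hM, sub_self, map_zero, sub_zero, add_zero]
  exact sub_mem (sub_mem (hP _) (hB _)) (hC _)

lemma adaptedChart_mem_of_sub_mem (hP : ∀ v, P v - πC (P v) ∈ T) (hB : ∀ v, πB v ∈ T)
    (hM : rM y = y) (hr : rB y = y) : adaptedChart P πB πC rM rB rC x y ∈ T := by
  rw [adaptedChart, hM, hr, sub_self, map_zero, sub_zero, add_zero, sub_right_comm]
  exact sub_mem (hP _) (hB _)

end AdaptedChartLemmas

namespace IsSplitting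

variable {n : ℕ} {M WB WC WA : Set V} {rM rB rC : V → V} {x : V} {T A B C : Submodule ℝ V}

lemma exists_adaptedChart [FiniteDimensional ℝ V] (h : IsSplitting T A B C) (hn : n ≠ 0)
    (hM : IsRetractionGerm n rM M x) (hB : IsRetractionGerm n rB WB x)
    (hC : IsRetractionGerm n rC WC x) (hBx : x ∈ WB) (hCx : x ∈ WC) (hBM : WB ⊆ M) (hCM : WC ⊆ M)
    (hT : tangentSpaceOf M x = T) (hTB : tangentSpaceOf WB x = B ⊔ A)
    (hTC : tangentSpaceOf WC x = C ⊔ A) :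
    ∃ Ψ : V → V, ContDiffAt ℝ n Ψ x ∧ HasFDerivAt Ψ (ContinuousLinearMap.id ℝ V) x ∧
      (∀ᶠ y in 𝓝 x, y ∈ M → Ψ y ∈ T) ∧ (∀ᶠ y in 𝓝 x, y ∈ WB → Ψ y ∈ B ⊔ A) ∧
      ∀ᶠ y in 𝓝 x, y ∈ WC → Ψ y ∈ C ⊔ A := by
  obtain ⟨_, hproj⟩ := exists_isProj_opNorm_le V
  obtain ⟨P, hP, -⟩ := hproj T
  obtain ⟨πB, hπB, hπB0, hπB1⟩ := exists_projection_of_disjoint h.swap.disjoint_right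
  obtain ⟨πC, hπC, hπC0, hπC1⟩ := exists_projection_of_disjoint h.disjoint_right
  rw [h.swap.sup_sup_eq] at hπB1
  rw [h.sup_sup_eq] at hπC1
  have hBT : B ⊔ A ≤ T := h.sup_sup_eq ▸ le_sup_right
  have hCT : C ⊔ A ≤ T := h.swap.sup_sup_eq ▸ le_sup_right
  have hrM := fun v => hT ▸ hM.fderiv_apply_mem hn (hBM hBx) v
  have hrB := fun v => hTB ▸ hB.fderiv_apply_mem hn hBx v
  have hrC := fun v => hTC ▸ hC.fderiv_apply_mem hn hCx v
  refine ⟨adaptedChart P πB.toContinuousLinearMap πC.toContinuousLinearMap rM rB rC x,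
    contDiffAt_adaptedChart hM.contDiffAt hB.contDiffAt hC.contDiffAt,
    hasFDerivAt_adaptedChart (hM.hasFDerivAt hn) (hB.hasFDerivAt hn) (hC.hasFDerivAt hn)
      (fun v => hP.map_id _ (hrM v)) (fun v => ?_) (fun v => ?_), ?_, ?_, ?_⟩
  · rw [hP.map_id _ (hCT (hrC v))]
    exact hπB0 _ (hrC v)
  · rw [hP.map_id _ (hBT (hrB v))]
    exact hπC0 _ (hrB v)
  · filter_upwards [hM.eventually_eq_self] with y hy hyM
    exact adaptedChart_mem hP.map_mem (fun v => hBT (Submodule.mem_sup_left (hπB v)))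
      (fun v => hCT (Submodule.mem_sup_left (hπC v))) (hy hyM)
  · filter_upwards [hM.eventually_eq_self, hB.eventually_eq_self] with y hy hyB hyW
    exact adaptedChart_mem_of_sub_mem (fun v => hπC1 _ (hP.map_mem v))
      (fun v => Submodule.mem_sup_left (hπB v)) (hy (hBM hyW)) (hyB hyW)
  · filter_upwards [hM.eventually_eq_self, hC.eventually_eq_self] with y hy hyC hyW
    rw [adaptedChart_comm]
    exact adaptedChart_mem_of_sub_mem (fun v => hπB1 _ (hP.map_mem v))
      (fun v => Submodule.mem_sup_left (hπC v)) (hy (hCM hyW)) (hyC hyW)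

lemma exists_flattens [FiniteDimensional ℝ V] (h : IsSplitting T A B C) (hn : n ≠ 0)
    (hM : IsRetractionGerm n rM M x) (hB : IsRetractionGerm n rB WB x)
    (hC : IsRetractionGerm n rC WC x) (hBx : x ∈ WB) (hCx : x ∈ WC) (hBM : WB ⊆ M) (hCM : WC ⊆ M)
    (hT : tangentSpaceOf M x = T) (hTB : tangentSpaceOf WB x = B ⊔ A)
    (hTC : tangentSpaceOf WC x = C ⊔ A) (hA : ∀ᶠ y in 𝓝 x, y ∈ WA ↔ y ∈ WB ∩ WC) :
    ∃ Φ : OpenPartialHomeomorph V V, Flattens n Φ M x T ∧ Flattens n Φ WB x (B ⊔ A) ∧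
      Flattens n Φ WC x (C ⊔ A) ∧ Flattens n Φ WA x A := by
  have := FiniteDimensional.complete ℝ V
  obtain ⟨Ψ, hΨ, hΨ', hmM, hmB, hmC⟩ :=
    h.exists_adaptedChart hn hM hB hC hBx hCx hBM hCM hT hTB hTC
  have hiM := hM.eventually_mem_iff hn (hBM hBx) hΨ hΨ' (by rwa [hT])
  have hiB := hB.eventually_mem_iff hn hBx hΨ hΨ' (by rwa [hTB])
  have hiC := hC.eventually_mem_iff hn hCx hΨ hΨ' (by rwa [hTC])
  rw [hT] at hiM
  rw [hTB] at hiB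
  rw [hTC] at hiC
  obtain ⟨Φ, rfl, hx, hc, hc', hp⟩ := exists_openPartialHomeomorph_of_contDiffAt
    (L := .refl ℝ V) hn hΨ hΨ' (hiM.and (hiB.and (hiC.and hA)))
  refine ⟨Φ, ⟨hx, hc, hc', fun y hy => (hp y hy).1⟩, ⟨hx, hc, hc', fun y hy => (hp y hy).2.1⟩,
    ⟨hx, hc, hc', fun y hy => (hp y hy).2.2.1⟩, ⟨hx, hc, hc', fun y hy => ?_⟩⟩
  obtain ⟨-, hyB, hyC, hyA⟩ := hp y hy
  rw [hyA, mem_inter_iff, hyB, hyC, ← Submodule.mem_inf, h.sup_inf_sup]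

end IsSplitting

end AdaptedChart

section JetBounds

variable {X Y Z : Type*} [NormedAddCommGroup X] [NormedSpace ℝ X] [NormedAddCommGroup Y]
  [NormedSpace ℝ Y] [NormedAddCommGroup Z] [NormedSpace ℝ Z]

lemma norm_iteratedFDeriv_snd_le {p : X × Y} (hp : ‖p.2‖ ≤ 1) :
    ∀ j : ℕ, ‖iteratedFDeriv ℝ j (Prod.snd : X × Y → Y) p‖ ≤ 1
  | 0 => by rwa [norm_iteratedFDeriv_zero]
  | 1 => by
    rw [norm_iteratedFDeriv_one, fderiv_snd]; exact ContinuousLinearMap.norm_snd_le ℝ X Y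
  | j + 2 => by
    have : fderiv ℝ (Prod.snd : X × Y → Y) = fun _ => ContinuousLinearMap.snd ℝ X Y :=
      funext fun _ => fderiv_snd
    rw [← norm_iteratedFDeriv_fderiv, this, iteratedFDeriv_const_of_ne (by lia)]
    simp

lemma norm_iteratedFDeriv_comp_fst_le {F : X → Z} {m : ℕ} {p : X × Y}
    (h : ContDiffAt ℝ m F p.1) :
    ‖iteratedFDeriv ℝ m (fun q : X × Y => F q.1) p‖ ≤ ‖iteratedFDeriv ℝ m F p.1‖ := by
  obtain ⟨U, hUo, hx, hU⟩ := exists_isOpen_contDiffOn h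
  have hVo : IsOpen (ContinuousLinearMap.fst ℝ X Y ⁻¹' U) :=
    hUo.preimage (ContinuousLinearMap.continuous _)
  have hcomp := (ContinuousLinearMap.fst ℝ X Y).iteratedFDerivWithin_comp_right hU
    hUo.uniqueDiffOn hVo.uniqueDiffOn (x := p) hx (i := m) le_rfl
  rw [iteratedFDerivWithin_of_isOpen m hVo (x := p) hx,
    iteratedFDerivWithin_of_isOpen m hUo (x := ContinuousLinearMap.fst ℝ X Y p) hx] at hcomp
  change ‖iteratedFDeriv ℝ m (F ∘ ContinuousLinearMap.fst ℝ X Y) p‖ ≤ _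
  rw [hcomp]
  refine (ContinuousMultilinearMap.norm_compContinuousLinearMap_le _ _).trans ?_
  exact mul_le_of_le_one_right (norm_nonneg _) <| Finset.prod_le_one (fun _ _ => norm_nonneg _)
    fun _ _ => ContinuousLinearMap.norm_fst_le ℝ X Y

lemma norm_iteratedFDeriv_fderiv_apply_le {F : X → Y} {m : ℕ} {p : X × X}
    (h : ContDiffAt ℝ (m + 1 : ℕ) F p.1) (hp : ‖p.2‖ ≤ 1) {C : ℝ}
    (hC : ∀ j : ℕ, 1 ≤ j → j ≤ m + 1 → ‖iteratedFDeriv ℝ j F p.1‖ ≤ C) :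
    ‖iteratedFDeriv ℝ m (fun q : X × X => fderiv ℝ F q.1 q.2) p‖ ≤ 2 ^ m * C := by
  have hDF : ContDiffAt ℝ m (fderiv ℝ F) p.1 := h.fderiv_right (by norm_cast)
  have hC0 : 0 ≤ C := (norm_nonneg _).trans (hC 1 le_rfl (by lia))
  obtain ⟨U, hUo, hpU, hU⟩ := exists_isOpen_contDiffOn (hDF.comp p contDiffAt_fst)
  rw [← iteratedFDerivWithin_of_isOpen m hUo hpU]
  calc
    _ ≤ ∑ i ∈ Finset.range (m + 1), (m.choose i : ℝ) *
          ‖iteratedFDerivWithin ℝ i (fderiv ℝ F ∘ Prod.fst) U p‖ *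
          ‖iteratedFDerivWithin ℝ (m - i) (Prod.snd : X × X → X) U p‖ :=
      norm_iteratedFDerivWithin_clm_apply hU contDiff_snd.contDiffOn hUo.uniqueDiffOn hpU le_rfl
    _ ≤ ∑ i ∈ Finset.range (m + 1), (m.choose i : ℝ) * C := by
      refine Finset.sum_le_sum fun i hi => ?_
      have him : i ≤ m := Finset.mem_range_succ_iff.1 hi
      rw [iteratedFDerivWithin_of_isOpen i hUo hpU,
        iteratedFDerivWithin_of_isOpen (m - i) hUo hpU, mul_assoc]
      have hfst : ‖iteratedFDeriv ℝ i (fderiv ℝ F ∘ Prod.fst : X × X → _) p‖ ≤ C := by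
        refine (norm_iteratedFDeriv_comp_fst_le (hDF.of_le (by exact_mod_cast him))).trans ?_
        rw [norm_iteratedFDeriv_fderiv]
        exact hC (i + 1) (by lia) (by lia)
      gcongr
      exact (mul_le_mul hfst (norm_iteratedFDeriv_snd_le hp _) (norm_nonneg _) hC0).trans_eq
        (mul_one C)
    _ = 2 ^ m * C := by
      rw [← Finset.sum_mul, ← Nat.cast_sum, Nat.sum_range_choose, Nat.cast_pow, Nat.cast_ofNat]

lemma norm_iteratedFDeriv_vectorTangentMap_le {F : X → X} {m : ℕ} (hm : 1 ≤ m) {p : X × X}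
    (h : ContDiffAt ℝ (m + 1 : ℕ) F p.1) (hp : ‖p.2‖ ≤ 1) {C : ℝ}
    (hC : ∀ j : ℕ, 1 ≤ j → j ≤ m + 1 → ‖iteratedFDeriv ℝ j F p.1‖ ≤ C) :
    ‖iteratedFDeriv ℝ m (vectorTangentMap F) p‖ ≤ 2 ^ m * C := by
  have hF : ContDiffAt ℝ m F p.1 := h.of_le (by norm_cast; lia)
  have hDF : ContDiffAt ℝ m (fderiv ℝ F) p.1 := h.fderiv_right (by norm_cast)
  have hfst : ContDiffAt ℝ m (fun q : X × X => F q.1) p := hF.comp p contDiffAt_fst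
  have hsnd : ContDiffAt ℝ m (fun q : X × X => fderiv ℝ F q.1 q.2) p :=
    (hDF.comp p contDiffAt_fst).clm_apply contDiffAt_snd
  change ‖iteratedFDeriv ℝ m (fun q : X × X => (F q.1, fderiv ℝ F q.1 q.2)) p‖ ≤ _
  rw [iteratedFDeriv_prodMk hfst hsnd le_rfl, ContinuousMultilinearMap.opNorm_prod]
  refine max_le ?_ (norm_iteratedFDeriv_fderiv_apply_le h hp hC)
  refine (norm_iteratedFDeriv_comp_fst_le hF).trans ((hC m hm (by lia)).trans ?_)
  exact le_mul_of_one_le_left ((norm_nonneg _).trans (hC 1 le_rfl (by lia)))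
    (one_le_pow₀ one_le_two)

variable {V : Type*} [NormedAddCommGroup V] [NormedSpace ℝ V] {r : V → V} {K : ℝ}

lemma norm_iteratedFDeriv_jetMap_le : ∀ (k m : ℕ), 1 ≤ m →
    ∀ ζ : JetSpace V k, VelocitiesLE 1 k ζ → ContDiffAt ℝ (m + k : ℕ) r (jetBase k ζ) →
    (∀ j : ℕ, 1 ≤ j → j ≤ m + k → ‖iteratedFDeriv ℝ j r (jetBase k ζ)‖ ≤ K) →
    ‖iteratedFDeriv ℝ m (jetMap r k) ζ‖ ≤ 2 ^ ((m + k) * k) * K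
  | 0, m, hm, ζ, _, _, hK => by
    rw [mul_zero, pow_zero, one_mul]; exact hK m hm (by lia)
  | k + 1, m, hm, p, hp, hr, hK => by
    have hK0 : 0 ≤ K := (norm_nonneg _).trans (hK 1 le_rfl (by lia))
    have hpred : ∀ j : ℕ, 1 ≤ j → j ≤ m + 1 →
        ‖iteratedFDeriv ℝ j (jetMap r k) p.1‖ ≤ 2 ^ ((m + 1 + k) * k) * K := fun j hj hjm => by
      refine (norm_iteratedFDeriv_jetMap_le k j hj p.1 hp.1
        (ContDiffAt.of_le hr (by norm_cast; lia)) fun i hi hi' => hK i hi (by lia)).trans ?_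
      gcongr
      exact one_le_two
    have hF : ContDiffAt ℝ (m + 1 : ℕ) (jetMap r k) p.1 :=
      contDiffAt_jetMap k (m + 1) p.1 (by rwa [Nat.add_right_comm])
    calc ‖iteratedFDeriv ℝ m (jetMap r (k + 1)) p‖
        ≤ 2 ^ m * (2 ^ ((m + 1 + k) * k) * K) :=
          norm_iteratedFDeriv_vectorTangentMap_le hm hF hp.2 hpred
      _ = 2 ^ (m + (m + 1 + k) * k) * K := by rw [← mul_assoc, ← pow_add]
      _ ≤ 2 ^ ((m + (k + 1)) * (k + 1)) * K := by
          gcongr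
          exacts [one_le_two, by nlinarith]

lemma norm_fderiv_fderiv_jetMap_le {k : ℕ} {ζ : JetSpace V k} (hζ : VelocitiesLE 1 k ζ)
    (hr : ContDiffAt ℝ (k + 2 : ℕ) r (jetBase k ζ))
    (hK : ∀ j : ℕ, 1 ≤ j → j ≤ k + 2 → ‖iteratedFDeriv ℝ j r (jetBase k ζ)‖ ≤ K) :
    ‖fderiv ℝ (fderiv ℝ (jetMap r k)) ζ‖ ≤ 2 ^ ((2 + k) * k) * K := by
  rw [← norm_iteratedFDeriv_one, norm_iteratedFDeriv_fderiv]
  exact norm_iteratedFDeriv_jetMap_le k 2 one_le_two ζ hζ (by rwa [add_comm])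
    fun j hj hj' => hK j hj (by lia)

lemma norm_fderiv_jetMap_succ_sub_le {k : ℕ} {p : JetSpace V (k + 1)} {a c τ : ℝ}
    (hr : ContDiffAt ℝ (k + 2 : ℕ) r (jetBase (k + 1) p)) (hτ : 0 ≤ τ)
    (ha : ‖fderiv ℝ (jetMap r k) p.1 -
      fderiv ℝ (jetMap r k) (zeroJet k (jetBase (k + 1) p))‖ ≤ a)
    (hc : ‖fderiv ℝ (fderiv ℝ (jetMap r k)) p.1‖ ≤ c) (hp : ‖p.2‖ ≤ τ) :
    ‖fderiv ℝ (jetMap r (k + 1)) p -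
      fderiv ℝ (jetMap r (k + 1)) (zeroJet (k + 1) (jetBase (k + 1) p))‖ ≤ a + c * τ := by
  set x := jetBase (k + 1) p
  have ha0 : 0 ≤ a := (norm_nonneg _).trans ha
  have hc0 : 0 ≤ c := (norm_nonneg (fderiv ℝ (fderiv ℝ (jetMap r k)) p.1)).trans hc
  refine ContinuousLinearMap.opNorm_le_bound _ (by positivity) fun v => ?_
  have hv1 : ‖v.1‖ ≤ ‖v‖ := le_max_left _ _
  have hv2 : ‖v.2‖ ≤ ‖v‖ := le_max_right _ _
  have hfirst (w : JetSpace V k) :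
      ‖fderiv ℝ (jetMap r k) p.1 w - fderiv ℝ (jetMap r k) (zeroJet k x) w‖ ≤ a * ‖w‖ :=
    (fderiv ℝ (jetMap r k) p.1 - fderiv ℝ (jetMap r k) (zeroJet k x)).le_of_opNorm_le ha w
  have hsecond : ‖fderiv ℝ (fderiv ℝ (jetMap r k)) p.1 v.1 p.2‖ ≤ c * ‖v‖ * τ :=
    (ContinuousLinearMap.le_opNorm₂ _ _ _).trans (by gcongr)
  rw [sub_apply, fderiv_jetMap_succ hr v,
    fderiv_jetMap_succ (p := zeroJet (k + 1) x) (by rwa [jetBase_zeroJet]) v]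
  change max ‖fderiv ℝ (jetMap r k) p.1 v.1 - fderiv ℝ (jetMap r k) (zeroJet k x) v.1‖
    ‖(fderiv ℝ (jetMap r k) p.1 v.2 + fderiv ℝ (fderiv ℝ (jetMap r k)) p.1 v.1 p.2) -
      (fderiv ℝ (jetMap r k) (zeroJet k x) v.2 +
        fderiv ℝ (fderiv ℝ (jetMap r k)) (zeroJet k x) v.1 0)‖ ≤ (a + c * τ) * ‖v‖
  refine max_le ?_ ?_
  · exact (hfirst v.1).trans (by gcongr; exact le_add_of_nonneg_right (by positivity))
  · rw [map_zero, add_zero, add_sub_right_comm]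
    calc _ ≤ a * ‖v.2‖ + c * ‖v‖ * τ := norm_add_le_of_le (hfirst v.2) hsecond
      _ ≤ a * ‖v‖ + c * ‖v‖ * τ := by gcongr
      _ = (a + c * τ) * ‖v‖ := by ring

lemma norm_fderiv_jetMap_sub_le {τ : ℝ} (hτ0 : 0 ≤ τ) (hτ : τ ≤ 1) :
    ∀ (k : ℕ) (ζ : JetSpace V k), VelocitiesLE τ k ζ → ContDiffAt ℝ (k + 1 : ℕ) r (jetBase k ζ) →
    (∀ j : ℕ, 1 ≤ j → j ≤ k + 1 → ‖iteratedFDeriv ℝ j r (jetBase k ζ)‖ ≤ K) →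
    ‖fderiv ℝ (jetMap r k) ζ - fderiv ℝ (jetMap r k) (zeroJet k (jetBase k ζ))‖ ≤
      (∑ j ∈ Finset.range k, 2 ^ ((2 + j) * j)) * K * τ
  | 0, ζ, _, _, _ => by
    change ‖fderiv ℝ r ζ - fderiv ℝ r ζ‖ ≤ _
    simp
  | k + 1, p, hp, hr, hK => by
    rw [Finset.sum_range_succ, add_mul, add_mul]
    exact norm_fderiv_jetMap_succ_sub_le hr hτ0
      (norm_fderiv_jetMap_sub_le hτ0 hτ k p.1 hp.1 (ContDiffAt.of_le hr (by norm_cast; lia))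
        fun j hj hj' => hK j hj (by lia))
      (norm_fderiv_fderiv_jetMap_le (hp.1.mono hτ) hr hK) hp.2

end JetBounds

section Gaps

variable {X : Type*} [NormedAddCommGroup X] [NormedSpace ℝ X]

/-- One half of the closeness of two subspaces: every vector of `A` is approximated by a vector
of `B` up to the relative error `ε`. -/
def GapLE (A B : Submodule ℝ X) (ε : ℝ) : Prop := ∀ v ∈ A, ∃ w ∈ B, ‖v - w‖ ≤ ε * ‖v‖

lemma gapLE_of_norm_sub_le {A B : Submodule ℝ X} {P Q : X →L[ℝ] X} {ε : ℝ}
    (hA : ∀ v ∈ A, P v = v) (hB : ∀ v, Q v ∈ B) (h : ‖P - Q‖ ≤ ε) : GapLE A B ε := fun v hv => by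
  refine ⟨Q v, hB v, ?_⟩
  calc ‖v - Q v‖ = ‖(P - Q) v‖ := by rw [sub_apply, hA v hv]
    _ ≤ ε * ‖v‖ := (P - Q).le_of_opNorm_le h v

lemma GapLE.mono {A B : Submodule ℝ X} {ε ε' : ℝ} (h : GapLE A B ε) (hε : ε ≤ ε') :
    GapLE A B ε' := fun v hv => by
  obtain ⟨w, hw, hvw⟩ := h v hv
  exact ⟨w, hw, hvw.trans (by gcongr)⟩

lemma infDist_le_norm_sub {E : Submodule ℝ X} (u : X) {e : X} (he : e ∈ E) :
    Metric.infDist u E ≤ ‖u - e‖ :=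
  (Metric.infDist_le_dist_of_mem (s := (E : Set X)) he).trans_eq (dist_eq_norm u e)

lemma infDist_le_norm (E : Submodule ℝ X) (u : X) : Metric.infDist u E ≤ ‖u‖ := by
  simpa using infDist_le_norm_sub u E.zero_mem

lemma infDist_le_infDist_add_norm_sub (E : Submodule ℝ X) (u v : X) :
    Metric.infDist u E ≤ Metric.infDist v E + ‖u - v‖ :=
  Metric.infDist_le_infDist_add_dist.trans_eq (by rw [dist_eq_norm])

lemma le_infDist_of_forall_le {E : Submodule ℝ X} {u : X} {c : ℝ} (h : ∀ e ∈ E, c ≤ ‖u - e‖) :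
    c ≤ Metric.infDist u E :=
  (Metric.le_infDist ⟨0, E.zero_mem⟩).2 fun e he => dist_eq_norm u e ▸ h e he

lemma infDist_add_mem (E : Submodule ℝ X) (u : X) {e : X} (he : e ∈ E) :
    Metric.infDist (u + e) E = Metric.infDist u E := by
  refine le_antisymm (le_infDist_of_forall_le fun e' he' => ?_)
    (le_infDist_of_forall_le fun e' he' => ?_)
  · simpa using infDist_le_norm_sub (u + e) (E.add_mem he' he)
  · simpa [sub_sub_eq_add_sub] using infDist_le_norm_sub u (E.sub_mem he' he)

lemma exists_norm_sub_eq_infDist [FiniteDimensional ℝ X] (E : Submodule ℝ X) (u : X) :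
    ∃ e ∈ E, ‖u - e‖ = Metric.infDist u E := by
  have : ProperSpace X := FiniteDimensional.proper_real X
  obtain ⟨e, he, hd⟩ :=
    E.closed_of_finiteDimensional.exists_infDist_eq_dist ⟨0, E.zero_mem⟩ u
  exact ⟨e, he, by rw [hd, dist_eq_norm]⟩

lemma GapLE.infDist_le {A B : Submodule ℝ X} {ε : ℝ} (hε : 0 ≤ ε) (h : GapLE A B ε) (w : X) :
    Metric.infDist w B ≤ Metric.infDist w A + 2 * ε * ‖w‖ := by
  have key : (Metric.infDist w B - ε * ‖w‖) / (1 + ε) ≤ Metric.infDist w A := by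
    refine le_infDist_of_forall_le fun a ha => ?_
    obtain ⟨b, hb, hab⟩ := h a ha
    have hna : ‖a‖ ≤ ‖w - a‖ + ‖w‖ := by
      simpa [norm_sub_rev, add_comm] using norm_le_norm_add_norm_sub' a w
    have htri := (infDist_le_norm_sub w hb).trans (norm_sub_le_norm_sub_add_norm_sub w a b)
    rw [div_le_iff₀ (by positivity)]
    nlinarith
  rw [div_le_iff₀ (by positivity)] at key
  nlinarith [infDist_le_norm A w]

lemma le_infDist_apply_of_gapLE [FiniteDimensional ℝ X] {L L₀ : X →L[ℝ] X}
    {A A₀ E E₀ E' E₀' : Submodule ℝ X} {m D ε : ℝ} (hL : ‖L₀ - L‖ ≤ ε) (hD : ‖L‖ ≤ D)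
    (hD₀ : ‖L₀‖ ≤ D) (gA : GapLE A A₀ ε) (gE : GapLE E₀ E ε) (gE' : GapLE E' E₀' ε)
    (hEA : E ≤ A) (hLE : ∀ e ∈ E, L e ∈ E') (hm : 0 ≤ m)
    (h₀ : ∀ u ∈ A₀, m * Metric.infDist u E₀ ≤ Metric.infDist (L₀ u) E₀') :
    ∀ u ∈ A, (m - ε * (3 * m + 3 * D + 1)) * Metric.infDist u E ≤ Metric.infDist (L u) E' := by
  intro u hu
  have hε : 0 ≤ ε := (norm_nonneg _).trans hL
  have hDnn : 0 ≤ D := (norm_nonneg _).trans hD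
  obtain ⟨e, he, hmin⟩ := exists_norm_sub_eq_infDist E u
  set t := u - e with ht
  obtain ⟨t₀, ht₀, htt₀⟩ := gA t (A.sub_mem hu (hEA he))
  have hLt : Metric.infDist (L t) E' = Metric.infDist (L u) E' := by
    rw [ht, map_sub, sub_eq_add_neg, infDist_add_mem E' _ (E'.neg_mem (hLE e he))]
  have htE : Metric.infDist t E = ‖t‖ := by
    rw [hmin, ht, sub_eq_add_neg, infDist_add_mem E u (E.neg_mem he)]
  have hsource : ‖t‖ ≤ Metric.infDist t₀ E₀ + 3 * ε * ‖t‖ := by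
    linarith [gE.infDist_le hε t, infDist_le_infDist_add_norm_sub E₀ t t₀]
  have hLL₀ : ‖L₀ t₀ - L t‖ ≤ D * (ε * ‖t‖) + ε * ‖t‖ := by
    calc ‖L₀ t₀ - L t‖ = ‖L₀ (t₀ - t) + (L₀ - L) t‖ := by simp
      _ ≤ ‖L₀‖ * ‖t₀ - t‖ + ‖L₀ - L‖ * ‖t‖ :=
        norm_add_le_of_le (L₀.le_opNorm _) ((L₀ - L).le_opNorm t)
      _ ≤ D * (ε * ‖t‖) + ε * ‖t‖ := by rw [norm_sub_rev t₀ t]; gcongr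
  have htarget : Metric.infDist (L₀ t₀) E₀' ≤
      Metric.infDist (L u) E' + ε * (3 * D + 1) * ‖t‖ := by
    have hLtD := mul_le_mul_of_nonneg_left (L.le_of_opNorm_le hD t) hε
    linarith [gE'.infDist_le hε (L t), infDist_le_infDist_add_norm_sub E₀' (L₀ t₀) (L t)]
  rw [← hmin]
  linarith [h₀ t₀ ht₀, mul_le_mul_of_nonneg_left hsource hm]

lemma norm_apply_le_of_gapLE {L L₀ : X →L[ℝ] X} {A A₀ : Submodule ℝ X} {l D ε : ℝ}
    (hL : ‖L₀ - L‖ ≤ ε) (hD : ‖L₀‖ ≤ D) (gA : GapLE A A₀ ε) (hl : 0 ≤ l)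
    (h₀ : ∀ v ∈ A₀, ‖L₀ v‖ ≤ l * ‖v‖) :
    ∀ v ∈ A, ‖L v‖ ≤ (l + ε * (l + D + 1)) * ‖v‖ := by
  intro v hv
  obtain ⟨w, hw, hvw⟩ := gA v hv
  have hnw : ‖w‖ ≤ ‖v‖ + ε * ‖v‖ := by
    linarith [norm_le_norm_add_norm_sub' w v, norm_sub_rev v w]
  have hdec : L v = L₀ w + L₀ (v - w) - (L₀ - L) v := by simp
  calc ‖L v‖ ≤ ‖L₀ w‖ + ‖L₀ (v - w)‖ + ‖(L₀ - L) v‖ := by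
        rw [hdec]; exact norm_sub_le_of_le (norm_add_le _ _) le_rfl
    _ ≤ l * (‖v‖ + ε * ‖v‖) + D * (ε * ‖v‖) + ε * ‖v‖ := by
        have hD0 : 0 ≤ D := (norm_nonneg _).trans hD
        gcongr
        · exact (h₀ w hw).trans (by gcongr)
        · exact (L₀.le_of_opNorm_le hD _).trans (by gcongr)
        · exact (L₀ - L).le_of_opNorm_le hL v
    _ = (l + ε * (l + D + 1)) * ‖v‖ := by ring

end Gaps

section JetQuotients

variable {V : Type*} [NormedAddCommGroup V] [NormedSpace ℝ V]

lemma infDist_prod {X Y : Type*} [NormedAddCommGroup X] [NormedSpace ℝ X]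
    [NormedAddCommGroup Y] [NormedSpace ℝ Y] (E : Submodule ℝ X) (F : Submodule ℝ Y) (u : X × Y) :
    Metric.infDist u (E.prod F) = max (Metric.infDist u.1 E) (Metric.infDist u.2 F) := by
  simp only [Metric.infDist, Submodule.prod_coe, Metric.infEDist_prod]
  exact ENNReal.toReal_max (Metric.infEDist_ne_top ⟨0, E.zero_mem⟩)
    (Metric.infEDist_ne_top ⟨0, F.zero_mem⟩)

open scoped Pointwise in
lemma infDist_smul {X : Type*} [NormedAddCommGroup X] [NormedSpace ℝ X] (E : Submodule ℝ X)
    {t : ℝ} (ht : 0 < t) (u : X) : Metric.infDist (t • u) E = t * Metric.infDist u E := by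
  have hE : t • (E : Set X) = E := by
    ext x
    rw [Set.mem_smul_set_iff_inv_smul_mem₀ ht.ne']
    exact E.smul_mem_iff (inv_ne_zero ht.ne')
  conv_lhs => rw [← hE]
  rw [infDist_smul₀ ht.ne', Real.norm_of_nonneg ht.le]

lemma infDist_jetSubmodule_succ (E : Submodule ℝ V) (k : ℕ) (u : JetSpace V (k + 1)) :
    Metric.infDist u (jetSubmodule E (k + 1)) =
      max (Metric.infDist u.1 (jetSubmodule E k)) (Metric.infDist u.2 (jetSubmodule E k)) :=
  infDist_prod _ _ u

lemma le_infDist_jetScale_jetDiagonal {L : V →L[ℝ] V} {A E E' : Submodule ℝ V} {t m : ℝ}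
    (ht0 : 0 < t) (ht1 : t ≤ 1) (hm : 0 ≤ m)
    (h : ∀ u ∈ A, m * Metric.infDist u E ≤ Metric.infDist (L u) E') :
    ∀ (k : ℕ), ∀ u ∈ jetSubmodule A k, m * t ^ k * Metric.infDist u (jetSubmodule E k) ≤
      Metric.infDist (jetScale V t k (jetDiagonal L k u)) (jetSubmodule E' k)
  | 0, u, hu => by rw [pow_zero, mul_one]; exact h u hu
  | k + 1, u, hu => by
    have h1 := le_infDist_jetScale_jetDiagonal ht0 ht1 hm h k u.1 hu.1
    have h2 := le_infDist_jetScale_jetDiagonal ht0 ht1 hm h k u.2 hu.2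
    rw [infDist_jetSubmodule_succ, infDist_jetSubmodule_succ, mul_max_of_nonneg _ _ (by positivity)]
    change _ ≤ max _ (Metric.infDist (t • jetScale V t k (jetDiagonal L k u.2)) _)
    rw [infDist_smul _ ht0]
    refine max_le_max (le_trans ?_ h1) ((le_of_eq ?_).trans (mul_le_mul_of_nonneg_left h2 ht0.le))
    · have := pow_le_pow_of_le_one ht0.le ht1 k.le_succ
      gcongr
      exact Metric.infDist_nonneg
    · ring

end JetQuotients

section Uniformity

lemma exists_uniform_pos_forall_of_isCompact {V : Type*} [PseudoMetricSpace V] {Λ : Set V}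
    (hΛ : IsCompact Λ) {P : V → ℝ → ℝ → Prop}
    (mono : ∀ x τ τ' K K', τ' ≤ τ → K ≤ K' → P x τ K → P x τ' K')
    (h : ∀ x₀ ∈ Λ, ∃ τ K, 0 < τ ∧ ∀ x ∈ Metric.ball x₀ τ, P x τ K) :
    ∃ τ K, 0 < τ ∧ 0 ≤ K ∧ ∀ x ∈ Λ, P x τ K := by
  refine hΛ.induction_on (p := fun s => ∃ τ K, 0 < τ ∧ 0 ≤ K ∧ ∀ x ∈ s, P x τ K) ?_ ?_ ?_ ?_
  · exact ⟨1, 0, one_pos, le_rfl, fun _ h => h.elim⟩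
  · rintro s t hst ⟨τ, K, hτ, hK, ht⟩
    exact ⟨τ, K, hτ, hK, fun x hx => ht x (hst hx)⟩
  · rintro s t ⟨τ, K, hτ, hK, hs⟩ ⟨τ', K', hτ', -, ht⟩
    refine ⟨min τ τ', max K K', lt_min hτ hτ', hK.trans (le_max_left _ _), ?_⟩
    rintro x (hx | hx)
    · exact mono _ _ _ _ _ (min_le_left _ _) (le_max_left _ _) (hs x hx)
    · exact mono _ _ _ _ _ (min_le_right _ _) (le_max_right _ _) (ht x hx)
  · intro x₀ hx₀
    obtain ⟨τ, K, hτ, hP⟩ := h x₀ hx₀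
    exact ⟨Metric.ball x₀ τ, mem_nhdsWithin_of_mem_nhds (Metric.ball_mem_nhds _ hτ), τ, max K 0,
      hτ, le_max_right _ _, fun x hx => mono _ _ _ _ _ le_rfl (le_max_left _ _) (hP x hx)⟩

end Uniformity

section Domination

variable {X : Type*} [NormedAddCommGroup X] [NormedSpace ℝ X]

section Iterates

variable {G : X → X} {S : Set X} (hS : MapsTo G S S) (hG : ∀ ζ ∈ S, DifferentiableAt ℝ G ζ)

include hS hG

lemma differentiableAt_iterate_of_mapsTo {ζ : X} (hζ : ζ ∈ S) :
    ∀ n : ℕ, DifferentiableAt ℝ G^[n] ζ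
  | 0 => differentiableAt_id
  | n + 1 => by
    rw [Function.iterate_succ']
    exact (hG _ (hS.iterate n hζ)).comp ζ (differentiableAt_iterate_of_mapsTo hζ n)

lemma fderiv_iterate_add_apply {ζ : X} (hζ : ζ ∈ S) (m n : ℕ) (v : X) :
    fderiv ℝ G^[m + n] ζ v = fderiv ℝ G^[m] (G^[n] ζ) (fderiv ℝ G^[n] ζ v) := by
  rw [Function.iterate_add, fderiv_comp ζ
    (differentiableAt_iterate_of_mapsTo hS hG (hS.iterate n hζ) m)
    (differentiableAt_iterate_of_mapsTo hS hG hζ n), ContinuousLinearMap.comp_apply]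

lemma fderiv_iterate_succ_apply {ζ : X} (hζ : ζ ∈ S) (n : ℕ) (v : X) :
    fderiv ℝ G^[n + 1] ζ v = fderiv ℝ G (G^[n] ζ) (fderiv ℝ G^[n] ζ v) := by
  rw [add_comm, fderiv_iterate_add_apply hS hG hζ 1 n, Function.iterate_one]

end Iterates

/-- On the `G`-invariant set `S`, the distribution `E` inside `A` is dominated: `D G` expands `E`
at most by `l` and the quotient `A / E` at least by `m`. The constants `D`, `K` and `ρ` control
`G`, its derivative and `A` uniformly on pairs of points of `S` at distance less than `ρ`. -/
structure IsDominatedOn (G : X → X) (S : Set X) (A E : X → Submodule ℝ X) (l m D K ρ : ℝ) :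
    Prop where
  mapsTo : MapsTo G S S
  le : ∀ ζ ∈ S, E ζ ≤ A ζ
  fderiv_mem_left : ∀ ζ ∈ S, ∀ v ∈ A ζ, fderiv ℝ G ζ v ∈ A (G ζ)
  fderiv_mem_right : ∀ ζ ∈ S, ∀ v ∈ E ζ, fderiv ℝ G ζ v ∈ E (G ζ)
  norm_apply_le : ∀ ζ ∈ S, ∀ v ∈ E ζ, ‖fderiv ℝ G ζ v‖ ≤ l * ‖v‖
  le_infDist : ∀ ζ ∈ S, ∀ v ∈ A ζ,
    m * Metric.infDist v (E ζ) ≤ Metric.infDist (fderiv ℝ G ζ v) (E (G ζ))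
  differentiableAt : ∀ ζ ∈ S, DifferentiableAt ℝ G ζ
  norm_fderiv_le : ∀ ζ ∈ S, ‖fderiv ℝ G ζ‖ ≤ D
  norm_sub_le : ∀ ξ ∈ S, ∀ η ∈ S, ‖ξ - η‖ < ρ → ‖G ξ - G η‖ ≤ D * ‖ξ - η‖
  norm_fderiv_sub_le : ∀ ξ ∈ S, ∀ η ∈ S, ‖ξ - η‖ < ρ →
    ‖fderiv ℝ G ξ - fderiv ℝ G η‖ ≤ K * ‖ξ - η‖
  gapLE : ∀ ξ ∈ S, ∀ η ∈ S, ‖ξ - η‖ < ρ → GapLE (A ξ) (A η) (K * ‖ξ - η‖)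

namespace IsDominatedOn

variable {G : X → X} {S : Set X} {A E : X → Submodule ℝ X} {l m D K ρ : ℝ}

lemma fderiv_iterate_mem_right (H : IsDominatedOn G S A E l m D K ρ) (hl : 0 ≤ l) {ζ v : X}
    (hζ : ζ ∈ S) (hv : v ∈ E ζ) :
    ∀ n : ℕ, fderiv ℝ G^[n] ζ v ∈ E (G^[n] ζ) ∧ ‖fderiv ℝ G^[n] ζ v‖ ≤ l ^ n * ‖v‖
  | 0 => by simpa using hv
  | n + 1 => by
    obtain ⟨hmem, hle⟩ := H.fderiv_iterate_mem_right hl hζ hv n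
    have hn := H.mapsTo.iterate n hζ
    rw [fderiv_iterate_succ_apply H.mapsTo H.differentiableAt hζ, Function.iterate_succ_apply',
      pow_succ', mul_assoc]
    exact ⟨H.fderiv_mem_right _ hn _ hmem, (H.norm_apply_le _ hn _ hmem).trans (by gcongr)⟩

lemma fderiv_iterate_mem_left (H : IsDominatedOn G S A E l m D K ρ) (hm : 0 ≤ m) {ζ u : X}
    (hζ : ζ ∈ S) (hu : u ∈ A ζ) :
    ∀ n : ℕ, fderiv ℝ G^[n] ζ u ∈ A (G^[n] ζ) ∧
      m ^ n * Metric.infDist u (E ζ) ≤ Metric.infDist (fderiv ℝ G^[n] ζ u) (E (G^[n] ζ))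
  | 0 => by simpa using hu
  | n + 1 => by
    obtain ⟨hmem, hle⟩ := H.fderiv_iterate_mem_left hm hζ hu n
    have hn := H.mapsTo.iterate n hζ
    rw [fderiv_iterate_succ_apply H.mapsTo H.differentiableAt hζ, Function.iterate_succ_apply',
      pow_succ', mul_assoc]
    exact ⟨H.fderiv_mem_left _ hn _ hmem,
      (mul_le_mul_of_nonneg_left hle hm).trans (H.le_infDist _ hn _ hmem)⟩

lemma norm_iterate_sub_le (H : IsDominatedOn G S A E l m D K ρ) {κ : ℝ} (hD : 0 ≤ D)
    (hDκ : D ≤ κ) (hκ : 1 ≤ κ) {ξ η : X} (hξ : ξ ∈ S) (hη : η ∈ S) :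
    ∀ n : ℕ, κ ^ n * ‖ξ - η‖ < ρ → ‖G^[n] ξ - G^[n] η‖ ≤ D ^ n * ‖ξ - η‖
  | 0, _ => by simp
  | n + 1, hn => by
    have hn' : κ ^ n * ‖ξ - η‖ < ρ :=
      lt_of_le_of_lt (by gcongr; exact n.le_succ) hn
    have ih := H.norm_iterate_sub_le hD hDκ hκ hξ hη n hn'
    have hclose : ‖G^[n] ξ - G^[n] η‖ < ρ := ih.trans_lt (lt_of_le_of_lt (by gcongr) hn')
    rw [Function.iterate_succ_apply', Function.iterate_succ_apply', pow_succ', mul_assoc]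
    exact (H.norm_sub_le _ (H.mapsTo.iterate n hξ) _ (H.mapsTo.iterate n hη) hclose).trans
      (by gcongr)

lemma norm_fderiv_sub_fderiv_apply_iterate_le (H : IsDominatedOn G S A E l m D K ρ) {κ : ℝ}
    (hl : 0 ≤ l) (hD : 0 ≤ D) (hK : 0 ≤ K) (hDκ : D ≤ κ) (hκ : 1 ≤ κ) {ξ η v : X} (hξ : ξ ∈ S)
    (hη : η ∈ S) (hv : v ∈ E ξ) (n : ℕ) (hn : κ ^ n * ‖ξ - η‖ < ρ) :
    ‖(fderiv ℝ G (G^[n] ξ) - fderiv ℝ G (G^[n] η)) (fderiv ℝ G^[n] ξ v)‖ ≤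
      K * ((κ * l) ^ n * ‖ξ - η‖ * ‖v‖) := by
  have hdist := H.norm_iterate_sub_le hD hDκ hκ hξ hη n hn
  have hclose : ‖G^[n] ξ - G^[n] η‖ < ρ := hdist.trans_lt (lt_of_le_of_lt (by gcongr) hn)
  have hlip : ‖fderiv ℝ G (G^[n] ξ) - fderiv ℝ G (G^[n] η)‖ ≤ K * (D ^ n * ‖ξ - η‖) :=
    (H.norm_fderiv_sub_le _ (H.mapsTo.iterate n hξ) _ (H.mapsTo.iterate n hη) hclose).trans
      (by gcongr)
  calc ‖(fderiv ℝ G (G^[n] ξ) - fderiv ℝ G (G^[n] η)) (fderiv ℝ G^[n] ξ v)‖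
      ≤ K * (D ^ n * ‖ξ - η‖) * (l ^ n * ‖v‖) :=
        (ContinuousLinearMap.le_opNorm _ _).trans (mul_le_mul hlip
          (H.fderiv_iterate_mem_right hl hξ hv n).2 (norm_nonneg _) (by positivity))
    _ ≤ K * (κ ^ n * ‖ξ - η‖) * (l ^ n * ‖v‖) := by gcongr
    _ = K * ((κ * l) ^ n * ‖ξ - η‖ * ‖v‖) := by rw [mul_pow]; ring

lemma norm_fderiv_iterate_sub_le (H : IsDominatedOn G S A E l m D K ρ) {κ : ℝ} (hl : 0 < l)
    (hD : 0 ≤ D) (hK : 0 ≤ K) (hDκ : D ≤ κ) (hκ : 1 ≤ κ) (hB : D < κ * l) {ξ η v u : X}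
    (hξ : ξ ∈ S) (hη : η ∈ S) (hv : v ∈ E ξ) (hvu : ‖v - u‖ ≤ K * ‖ξ - η‖ * ‖v‖) :
    ∀ n : ℕ, κ ^ n * ‖ξ - η‖ < ρ → ‖fderiv ℝ G^[n] ξ v - fderiv ℝ G^[n] η u‖ ≤
      (K + K / (κ * l - D)) * ((κ * l) ^ n * ‖ξ - η‖ * ‖v‖)
  | 0, _ => by
    have hquot : 0 ≤ K / (κ * l - D) := div_nonneg hK (sub_nonneg.2 hB.le)
    simp only [Function.iterate_zero, fderiv_id, ContinuousLinearMap.id_apply, pow_zero, one_mul]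
    nlinarith [mul_nonneg hquot (mul_nonneg (norm_nonneg (ξ - η)) (norm_nonneg v))]
  | n + 1, hn => by
    have hn' : κ ^ n * ‖ξ - η‖ < ρ :=
      lt_of_le_of_lt (by gcongr; exact n.le_succ) hn
    have ih := H.norm_fderiv_iterate_sub_le hl hD hK hDκ hκ hB hξ hη hv hvu n hn'
    have hηn := H.mapsTo.iterate n hη
    rw [fderiv_iterate_succ_apply H.mapsTo H.differentiableAt hξ,
      fderiv_iterate_succ_apply H.mapsTo H.differentiableAt hη]
    set Y := fderiv ℝ G^[n] ξ v
    set Z := fderiv ℝ G^[n] η u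
    set r := (κ * l) ^ n * ‖ξ - η‖ * ‖v‖ with hr
    have hfirst : ‖fderiv ℝ G (G^[n] η) (Y - Z)‖ ≤ D * ((K + K / (κ * l - D)) * r) :=
      (ContinuousLinearMap.le_of_opNorm_le _ (H.norm_fderiv_le _ hηn) _).trans (by gcongr)
    have hsecond : ‖(fderiv ℝ G (G^[n] ξ) - fderiv ℝ G (G^[n] η)) Y‖ ≤ K * r :=
      H.norm_fderiv_sub_fderiv_apply_iterate_le hl.le hD hK hDκ hκ hξ hη hv n hn'
    calc ‖fderiv ℝ G (G^[n] ξ) Y - fderiv ℝ G (G^[n] η) Z‖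
        = ‖fderiv ℝ G (G^[n] η) (Y - Z) + (fderiv ℝ G (G^[n] ξ) - fderiv ℝ G (G^[n] η)) Y‖ := by
          rw [map_sub, sub_apply]; abel_nf
      _ ≤ (D * (K + K / (κ * l - D)) + K) * r := by
          linarith [norm_add_le_of_le hfirst hsecond]
      _ ≤ (κ * l * (K + K / (κ * l - D))) * r := by
          have hgain : (κ * l - D) * (K / (κ * l - D)) = K := mul_div_cancel₀ K (by linarith)
          gcongr
          nlinarith [mul_nonneg (sub_nonneg.2 hB.le) hK]
      _ = (K + K / (κ * l - D)) * ((κ * l) ^ (n + 1) * ‖ξ - η‖ * ‖v‖) := by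
          rw [hr, pow_succ]; ring

end IsDominatedOn

lemma exists_nat_pow_mul_le_of_rpow_le {l m κ φ δ s : ℝ} (hl : 0 < l) (hκ : 1 < κ) (hφ : 0 ≤ φ)
    (hm : l * κ ^ φ ≤ m) (hδ : 0 < δ) (hδs : δ ≤ s) :
    ∃ n : ℕ, κ ^ n * δ ≤ s ∧ l ^ n ≤ m ^ n * (κ * δ / s) ^ φ := by
  have hκ0 : 0 < κ := one_pos.trans hκ
  have hs : 0 < s := hδ.trans_le hδs
  obtain ⟨n, hn, hn'⟩ := exists_nat_pow_near ((one_le_div hδ).2 hδs) hκ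
  refine ⟨n, (le_div_iff₀ hδ).1 hn, ?_⟩
  have hone : 1 ≤ (κ ^ φ) ^ n * (κ * δ / s) ^ φ := by
    rw [Real.rpow_pow_comm hκ0.le, ← Real.mul_rpow (by positivity) (by positivity)]
    refine Real.one_le_rpow ?_ hφ
    rw [div_lt_iff₀ hδ, pow_succ] at hn'
    rw [mul_div_assoc', le_div_iff₀ hs]
    linarith
  calc l ^ n ≤ l ^ n * ((κ ^ φ) ^ n * (κ * δ / s) ^ φ) :=
        le_mul_of_one_le_right (by positivity) hone
    _ = (l * κ ^ φ) ^ n * (κ * δ / s) ^ φ := by rw [mul_pow, mul_assoc]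
    _ ≤ m ^ n * (κ * δ / s) ^ φ := by gcongr

namespace IsDominatedOn

variable {G : X → X} {S : Set X} {A E : X → Submodule ℝ X} {l m D K ρ : ℝ}

-- The orbits of `ξ` and `η` are compared up to the time `n` at which `κ ^ n * ‖ξ - η‖ ≈ s`; up to
-- this time they stay close, and `D G ^ n u` is as short as if `u` belonged to `E η`.
lemma infDist_le_of_norm_sub_le (H : IsDominatedOn G S A E l m D K ρ) {κ φ s : ℝ} (hl : 0 < l)
    (hD : 0 ≤ D) (hK : 0 ≤ K) (hDκ : D ≤ κ) (hκ : 1 < κ) (hB : D < κ * l) (hφ : 0 ≤ φ)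
    (hφ1 : φ ≤ 1) (hm : l * κ ^ φ ≤ m) (hs1 : s ≤ 1) (hsρ : s < ρ) {ξ η v : X} (hξ : ξ ∈ S)
    (hη : η ∈ S) (hne : ξ ≠ η) (hδs : ‖ξ - η‖ ≤ s) (hv : v ∈ E ξ) :
    Metric.infDist v (E η) ≤
      (K + (1 + (K + K / (κ * l - D))) * (κ / s) ^ φ) * ‖ξ - η‖ ^ φ * ‖v‖ := by
  set δ := ‖ξ - η‖
  set K' := K + K / (κ * l - D)
  have hδ : 0 < δ := norm_pos_iff.2 (sub_ne_zero.2 hne)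
  have hs : 0 < s := hδ.trans_le hδs
  have hκ0 : 0 < κ := one_pos.trans hκ
  have hm0 : 0 < m := (mul_pos hl (Real.rpow_pos_of_pos hκ0 φ)).trans_le hm
  have : 0 ≤ K' := add_nonneg hK (div_nonneg hK (sub_nonneg.2 hB.le))
  obtain ⟨u, hu, hvu⟩ := H.gapLE ξ hξ η hη (hδs.trans_lt hsρ) v (H.le ξ hξ hv)
  obtain ⟨n, hn, hln⟩ := exists_nat_pow_mul_le_of_rpow_le hl hκ hφ hm hδ hδs
  have hYZ := H.norm_fderiv_iterate_sub_le hl hD hK hDκ hκ.le hB hξ hη hv hvu n (hn.trans_lt hsρ)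
  have hY := (H.fderiv_iterate_mem_right hl.le hξ hv n).2
  have hZ : ‖fderiv ℝ G^[n] η u‖ ≤ (1 + K') * l ^ n * ‖v‖ := by
    have hrate : K' * ((κ * l) ^ n * δ * ‖v‖) ≤ K' * (l ^ n * ‖v‖) := by
      rw [mul_pow]
      have := mul_le_mul_of_nonneg_right (hn.trans hs1) (pow_nonneg hl.le n)
      gcongr
      linarith
    linarith [norm_le_norm_add_norm_sub (fderiv ℝ G^[n] ξ v) (fderiv ℝ G^[n] η u)]
  have hu' : Metric.infDist u (E η) ≤ (1 + K') * (κ * δ / s) ^ φ * ‖v‖ := by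
    refine le_of_mul_le_mul_left ?_ (pow_pos hm0 n)
    calc m ^ n * Metric.infDist u (E η) ≤ ‖fderiv ℝ G^[n] η u‖ :=
          (H.fderiv_iterate_mem_left hm0.le hη hu n).2.trans (infDist_le_norm _ _)
      _ ≤ (1 + K') * (m ^ n * (κ * δ / s) ^ φ) * ‖v‖ := hZ.trans (by gcongr)
      _ = m ^ n * ((1 + K') * (κ * δ / s) ^ φ * ‖v‖) := by ring
  have hδφ : δ ≤ δ ^ φ := by
    simpa using Real.rpow_le_rpow_of_exponent_ge hδ (hδs.trans hs1) hφ1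
  rw [mul_div_right_comm, Real.mul_rpow (by positivity) hδ.le] at hu'
  have hKδ : K * δ * ‖v‖ ≤ K * δ ^ φ * ‖v‖ := by gcongr
  linarith [infDist_le_infDist_add_norm_sub (E η) v u]

theorem exists_infDist_le (H : IsDominatedOn G S A E l m D K ρ) {κ φ : ℝ} (hl : 0 < l)
    (hD : 0 ≤ D) (hK : 0 ≤ K) (hρ : 0 < ρ) (hDκ : D ≤ κ) (hκ : 1 < κ) (hB : D < κ * l)
    (hφ : 0 ≤ φ) (hφ1 : φ ≤ 1) (hm : l * κ ^ φ ≤ m) :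
    ∃ C : ℝ, ∀ ξ ∈ S, ∀ η ∈ S, ∀ v ∈ E ξ, Metric.infDist v (E η) ≤ C * ‖ξ - η‖ ^ φ * ‖v‖ := by
  set s := min 1 (ρ / 2)
  have hs : 0 < s := lt_min one_pos (half_pos hρ)
  have hs1 : s ≤ 1 := min_le_left _ _
  have hκs : 0 < κ / s := by positivity
  have hK' : 0 ≤ K / (κ * l - D) := div_nonneg hK (sub_nonneg.2 hB.le)
  refine ⟨K + (1 + (K + K / (κ * l - D))) * (κ / s) ^ φ, fun ξ hξ η hη v hv => ?_⟩
  rcases eq_or_ne ξ η with rfl | hne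
  · rw [Metric.infDist_zero_of_mem hv]
    positivity
  rcases le_or_gt ‖ξ - η‖ s with hδs | hsδ
  · exact H.infDist_le_of_norm_sub_le hl hD hK hDκ hκ hB hφ hφ1 hm hs1
      ((min_le_right _ _).trans_lt (half_lt_self hρ)) hξ hη hne hδs hv
  · have hone : 1 ≤ (κ / s) ^ φ * ‖ξ - η‖ ^ φ := by
      rw [← Real.mul_rpow hκs.le (norm_nonneg _)]
      refine Real.one_le_rpow ?_ hφ
      rw [div_mul_eq_mul_div, one_le_div hs]
      nlinarith [norm_nonneg (ξ - η)]
    calc Metric.infDist v (E η) ≤ 1 * ‖v‖ := by simpa using infDist_le_norm (E η) v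
      _ ≤ (κ / s) ^ φ * ‖ξ - η‖ ^ φ * ‖v‖ := by gcongr
      _ ≤ (K + (1 + (K + K / (κ * l - D))) * (κ / s) ^ φ) * ‖ξ - η‖ ^ φ * ‖v‖ := by
          gcongr
          nlinarith [Real.rpow_pos_of_pos hκs φ]

end IsDominatedOn

end Domination

section JetStep

variable {V : Type*} [NormedAddCommGroup V] [NormedSpace ℝ V] {t : ℝ} {h : V → V} {n k : ℕ}

/-- The jet map of `h` followed by the multiplication of all velocities by `t`; for small `t` it
does not leave the jets with small velocities. -/
noncomputable def jetStep (t : ℝ) (h : V → V) (k : ℕ) (ξ : JetSpace V k) : JetSpace V k :=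
  jetScale V t k (jetMap h k ξ)

lemma jetBase_jetStep (t : ℝ) (h : V → V) (k : ℕ) (ξ : JetSpace V k) :
    jetBase k (jetStep t h k ξ) = h (jetBase k ξ) := by
  rw [jetStep, jetBase_jetScale, jetBase_jetMap]

lemma contDiffAt_jetStep (t : ℝ) (m : ℕ) {ξ : JetSpace V k}
    (hh : ContDiffAt ℝ (m + k : ℕ) h (jetBase k ξ)) : ContDiffAt ℝ m (jetStep t h k) ξ :=
  (jetScale V t k).contDiff.contDiffAt.comp ξ (contDiffAt_jetMap k m ξ hh)

lemma fderiv_jetStep (t : ℝ) (hk : k + 1 ≤ n) {ξ : JetSpace V k}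
    (hh : ContDiffAt ℝ n h (jetBase k ξ)) :
    fderiv ℝ (jetStep t h k) ξ = (jetScale V t k).comp (fderiv ℝ (jetMap h k) ξ) :=
  ((jetScale V t k).hasFDerivAt.comp ξ (differentiableAt_jetMap hk hh).hasFDerivAt).fderiv

lemma fderiv_jetStep_zeroJet (t : ℝ) (hk : k + 1 ≤ n) {x : V} (hh : ContDiffAt ℝ n h x) :
    fderiv ℝ (jetStep t h k) (zeroJet k x) =
      (jetScale V t k).comp (jetDiagonal (fderiv ℝ h x) k) := by
  rw [fderiv_jetStep t hk (by rwa [jetBase_zeroJet]),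
    fderiv_jetMap_zeroJet k (hh.of_le (by norm_cast))]

lemma norm_fderiv_jetStep_zeroJet_le (ht0 : 0 ≤ t) (ht1 : t ≤ 1) (hk : k + 1 ≤ n) {x : V}
    (hh : ContDiffAt ℝ n h x) : ‖fderiv ℝ (jetStep t h k) (zeroJet k x)‖ ≤ ‖fderiv ℝ h x‖ := by
  rw [fderiv_jetStep_zeroJet t hk hh]
  exact ContinuousLinearMap.opNorm_le_bound _ (norm_nonneg _) fun v =>
    (norm_jetScale_le ht0 ht1 k _).trans
      ((jetDiagonal _ k).le_of_opNorm_le (opNorm_jetDiagonal_le _ k) v)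

variable {S S' : Set V} {ξ : JetSpace V k}

lemma jetStep_mem_jetSet (t : ℝ) (hk : k ≤ n) (hh : ContDiffAt ℝ n h (jetBase k ξ))
    (hS : ∀ᶠ y in 𝓝 (jetBase k ξ), y ∈ S → h y ∈ S') (hξ : ξ ∈ jetSet S k) :
    jetStep t h k ξ ∈ jetSet S' k :=
  jetScale_mem_jetSet t (jetMap_mem_jetSet hk hh hS hξ)

lemma fderiv_jetStep_mem (t : ℝ) (hk : k + 1 ≤ n) (hh : ContDiffAt ℝ n h (jetBase k ξ))
    (hS : ∀ᶠ y in 𝓝 (jetBase k ξ), y ∈ S → h y ∈ S') (hξ : ξ ∈ jetSet S k) {v : JetSpace V k}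
    (hv : v ∈ tangentSpaceOf (jetSet S k) ξ) :
    fderiv ℝ (jetStep t h k) ξ v ∈ tangentSpaceOf (jetSet S' k) (jetStep t h k ξ) := by
  rw [fderiv_jetStep t hk hh]
  exact jetScale_mem_tangentSpaceOf t
    (map_tangentSpaceOf_jetSet_le hk hh hS hξ (Submodule.mem_map_of_mem hv))

end JetStep

section FDerivBounds

variable {X : Type*} [NormedAddCommGroup X] [NormedSpace ℝ X]

/-- On the set `s`, the map `G` is differentiable, and its derivative is bounded by `D` and
Lipschitz with constant `K`. -/
structure HasFDerivBoundsOn (G : X → X) (s : Set X) (D K : ℝ) : Prop where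
  differentiableAt : ∀ ζ ∈ s, DifferentiableAt ℝ G ζ
  norm_fderiv_le : ∀ ζ ∈ s, ‖fderiv ℝ G ζ‖ ≤ D
  norm_fderiv_sub_le : ∀ ξ ∈ s, ∀ η ∈ s, ‖fderiv ℝ G ξ - fderiv ℝ G η‖ ≤ K * ‖ξ - η‖

lemma HasFDerivBoundsOn.mono {G : X → X} {s s' : Set X} {D K K' : ℝ}
    (h : HasFDerivBoundsOn G s D K) (hs : s' ⊆ s) (hK : K ≤ K') : HasFDerivBoundsOn G s' D K' where
  differentiableAt ζ hζ := h.differentiableAt ζ (hs hζ)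
  norm_fderiv_le ζ hζ := h.norm_fderiv_le ζ (hs hζ)
  norm_fderiv_sub_le ξ hξ η hη :=
    (h.norm_fderiv_sub_le ξ (hs hξ) η (hs hη)).trans (by gcongr)

lemma exists_ball_hasFDerivBoundsOn {G : X → X} {p : X} (hG : ContDiffAt ℝ 2 G p) {D : ℝ}
    (hD : ‖fderiv ℝ G p‖ < D) :
    ∃ τ K, 0 < τ ∧ HasFDerivBoundsOn G (Metric.ball p τ) D K := by
  have h1 : ContDiffAt ℝ 1 (fderiv ℝ G) p := hG.fderiv_right (by norm_num)
  obtain ⟨K, s, hs, hK⟩ := h1.exists_lipschitzOnWith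
  have hdiff : ∀ᶠ ζ in 𝓝 p, DifferentiableAt ℝ G ζ :=
    (hG.eventually (by simp)).mono fun ζ hζ => hζ.differentiableAt (by simp)
  obtain ⟨τ, hτ, hb⟩ := Metric.eventually_nhds_iff_ball.1
    (((h1.continuousAt.norm.eventually_lt_const hD).and hdiff).and hs)
  refine ⟨τ, K, hτ, fun ζ hζ => (hb ζ hζ).1.2, fun ζ hζ => (hb ζ hζ).1.1.le, fun ξ hξ η hη => ?_⟩
  simpa only [dist_eq_norm] using hK.dist_le_mul ξ (hb ξ hξ).2 η (hb η hη).2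

end FDerivBounds

lemma exists_uniform_ball_zeroJet {V : Type*} [NormedAddCommGroup V] {Λ : Set V} (hΛ : IsCompact Λ)
    (k : ℕ) {P : Set (JetSpace V k) → ℝ → Prop}
    (mono : ∀ s s' K K', s' ⊆ s → K ≤ K' → P s K → P s' K')
    (h : ∀ x ∈ Λ, ∃ τ K, 0 < τ ∧ P (Metric.ball (zeroJet k x) τ) K) :
    ∃ τ K, 0 < τ ∧ 0 ≤ K ∧ ∀ x ∈ Λ, P (Metric.ball (zeroJet k x) τ) K := by
  refine exists_uniform_pos_forall_of_isCompact hΛ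
    (fun x τ τ' K K' hτ hK => mono _ _ _ _ (Metric.ball_subset_ball hτ) hK) fun x hx => ?_
  obtain ⟨τ, K, hτ, hP⟩ := h x hx
  refine ⟨τ / 2, K, half_pos hτ, fun y hy => mono _ _ _ _ (Metric.ball_subset_ball' ?_) le_rfl hP⟩
  rw [Metric.mem_ball, dist_eq_norm] at hy
  rw [dist_eq_norm, norm_zeroJet_sub_zeroJet]
  linarith

section LeafSystems

variable {V : Type*} [NormedAddCommGroup V] [NormedSpace ℝ V]

/-- A family `W` of submanifolds of `M` through the points of a compact `h`-invariant set `Λ`, which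
is locally invariant under `h`. The submanifolds are described by local retractions, those onto the
`W x` with derivatives bounded uniformly in `x`. -/
structure IsLeafSystem (k : ℕ) (Λ M : Set V) (h : V → V) (W : V → Set V) : Prop where
  isCompact : IsCompact Λ
  mapsTo : MapsTo h Λ Λ
  mapsTo_manifold : MapsTo h M M
  contDiffAt : ∀ x ∈ Λ, ContDiffAt ℝ (k + 2 : ℕ) h x
  mem : ∀ x ∈ Λ, x ∈ W x
  subset : ∀ x ∈ Λ, W x ⊆ M
  invariant : ∀ x ∈ Λ, ∀ᶠ y in 𝓝 x, y ∈ W x → h y ∈ W (h x)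
  retraction_manifold : ∀ x ∈ Λ, ∃ r, IsRetractionGerm (k + 2) r M x
  retraction : ∃ K : ℝ, ∀ x ∈ Λ, ∃ r, IsRetractionGerm (k + 1) r (W x) x ∧
    ∀ j : ℕ, 1 ≤ j → j ≤ k + 1 → ‖iteratedFDeriv ℝ j r x‖ ≤ K

/-- The jets of the submanifolds `W x`, at points of `Λ`, with velocities bounded by `τ`. -/
def smallJets (Λ : Set V) (W : V → Set V) (τ : ℝ) (k : ℕ) : Set (JetSpace V k) :=
  {ζ | jetBase k ζ ∈ Λ ∧ ζ ∈ jetSet (W (jetBase k ζ)) k ∧ VelocitiesLE τ k ζ}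

/-- The tangent space at the jet `ζ` of the jets of the submanifold `W x` through its foot point
`x`, denoted `E_{k+1}(ζ)` in the paper. -/
def leafJetTangent (W : V → Set V) (k : ℕ) (ζ : JetSpace V k) : Submodule ℝ (JetSpace V k) :=
  tangentSpaceOf (jetSet (W (jetBase k ζ)) k) ζ

lemma mem_ball_zeroJet_of_mem_smallJets {k : ℕ} {Λ : Set V} {W : V → Set V} {τ ρ : ℝ}
    {ζ ξ : JetSpace V k} (hτ : 0 ≤ τ) (hτρ : τ ≤ ρ / 2) (hζ : ζ ∈ smallJets Λ W τ k)
    (hξ : ‖ζ - ξ‖ < ρ / 2) : ξ ∈ Metric.ball (zeroJet k (jetBase k ζ)) ρ := by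
  rw [mem_ball_iff_norm]
  calc ‖ξ - zeroJet k (jetBase k ζ)‖ ≤ ‖ζ - ξ‖ + ‖ζ - zeroJet k (jetBase k ζ)‖ :=
        norm_sub_rev ζ ξ ▸ norm_sub_le_norm_sub_add_norm_sub _ _ _
    _ < ρ / 2 + ρ / 2 := add_lt_add_of_lt_of_le hξ ((hζ.2.2.norm_sub_zeroJet_le hτ).trans hτρ)
    _ = ρ := add_halves ρ

lemma eventually_pos_lt_mul_le {τ₀ ε : ℝ} (hτ₀ : 0 < τ₀) (K : ℝ) (hε : 0 < ε) :
    ∀ᶠ τ in 𝓝[>] (0 : ℝ), 0 < τ ∧ τ < τ₀ ∧ K * τ ≤ ε := by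
  have hlim : Tendsto (fun τ : ℝ => K * τ) (𝓝 0) (𝓝 0) := by
    simpa using (continuous_const_mul K).tendsto 0
  filter_upwards [self_mem_nhdsWithin, nhdsWithin_le_nhds (eventually_lt_nhds hτ₀),
    nhdsWithin_le_nhds (hlim.eventually_le_const hε)] with τ h0 h1 h2 using ⟨h0, h1, h2⟩

namespace IsLeafSystem

variable {k : ℕ} {Λ M : Set V} {h : V → V} {W : V → Set V}

lemma of_le {j : ℕ} (H : IsLeafSystem k Λ M h W) (hj : j ≤ k) : IsLeafSystem j Λ M h W where
  isCompact := H.isCompact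
  mapsTo := H.mapsTo
  mapsTo_manifold := H.mapsTo_manifold
  contDiffAt x hx := (H.contDiffAt x hx).of_le (by norm_cast; lia)
  mem := H.mem
  subset := H.subset
  invariant := H.invariant
  retraction_manifold x hx :=
    (H.retraction_manifold x hx).imp fun _ hr => hr.of_le (by lia)
  retraction := H.retraction.imp fun _ hK x hx => (hK x hx).imp fun _ hr =>
    ⟨hr.1.of_le (by lia), fun i hi hij => hr.2 i hi (by lia)⟩

lemma smallJets_subset_jetSet (H : IsLeafSystem k Λ M h W) {τ : ℝ} :
    smallJets Λ W τ k ⊆ jetSet M k :=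
  fun _ hζ => jetSet_mono (H.subset _ hζ.1) k hζ.2.1

lemma leafJetTangent_le (H : IsLeafSystem k Λ M h W) {ζ : JetSpace V k} (hζ : jetBase k ζ ∈ Λ) :
    leafJetTangent W k ζ ≤ tangentSpaceOf (jetSet M k) ζ :=
  tangentSpaceOf_jetSet_mono (H.subset _ hζ) k ζ

lemma jetStep_mem_jetSet (H : IsLeafSystem k Λ M h W) (t : ℝ) {ζ : JetSpace V k}
    (hζ : jetBase k ζ ∈ Λ) (hζW : ζ ∈ jetSet (W (jetBase k ζ)) k) :
    jetStep t h k ζ ∈ jetSet (W (jetBase k (jetStep t h k ζ))) k := by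
  rw [jetBase_jetStep]
  exact _root_.jetStep_mem_jetSet t (by lia) (H.contDiffAt _ hζ) (H.invariant _ hζ) hζW

lemma fderiv_jetStep_mem_leafJetTangent (H : IsLeafSystem k Λ M h W) (t : ℝ) {ζ v : JetSpace V k}
    (hζ : jetBase k ζ ∈ Λ) (hζW : ζ ∈ jetSet (W (jetBase k ζ)) k)
    (hv : v ∈ leafJetTangent W k ζ) :
    fderiv ℝ (jetStep t h k) ζ v ∈ leafJetTangent W k (jetStep t h k ζ) := by
  rw [leafJetTangent, jetBase_jetStep]
  exact fderiv_jetStep_mem t (by lia) (H.contDiffAt _ hζ) (H.invariant _ hζ) hζW hv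

lemma fderiv_jetStep_mem_manifold (H : IsLeafSystem k Λ M h W) (t : ℝ) {ζ v : JetSpace V k}
    (hζ : jetBase k ζ ∈ Λ) (hζM : ζ ∈ jetSet M k) (hv : v ∈ tangentSpaceOf (jetSet M k) ζ) :
    fderiv ℝ (jetStep t h k) ζ v ∈ tangentSpaceOf (jetSet M k) (jetStep t h k ζ) :=
  fderiv_jetStep_mem t (by lia) (H.contDiffAt _ hζ) (.of_forall fun _ hy => H.mapsTo_manifold hy)
    hζM hv

lemma exists_gapLE_manifold (H : IsLeafSystem k Λ M h W) :
    ∃ τ K, 0 < τ ∧ 0 ≤ K ∧ ∀ x ∈ Λ, ∀ ξ ∈ jetSet M k ∩ Metric.ball (zeroJet k x) τ,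
      ∀ η ∈ jetSet M k ∩ Metric.ball (zeroJet k x) τ,
        GapLE (tangentSpaceOf (jetSet M k) ξ) (tangentSpaceOf (jetSet M k) η) (K * ‖ξ - η‖) := by
  refine exists_uniform_ball_zeroJet H.isCompact k (P := fun s K => ∀ ξ ∈ jetSet M k ∩ s,
    ∀ η ∈ jetSet M k ∩ s, GapLE (tangentSpaceOf (jetSet M k) ξ) (tangentSpaceOf (jetSet M k) η)
      (K * ‖ξ - η‖)) (fun s s' K K' hs hK hP ξ hξ η hη =>
    (hP ξ ⟨hξ.1, hs hξ.2⟩ η ⟨hη.1, hs hη.2⟩).mono (by gcongr)) fun x hx => ?_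
  obtain ⟨r, hr⟩ := H.retraction_manifold x hx
  have hr' : ∀ᶠ y in 𝓝 (jetBase k (zeroJet k x)), IsRetractionGerm (k + 2) r M y := by
    rw [jetBase_zeroJet]
    exact hr.eventually_isRetractionGerm
  obtain ⟨τ₁, hτ₁, hb₁⟩ := Metric.eventually_nhds_iff_ball.1 (eventually_jetBase hr')
  obtain ⟨τ₂, K, hτ₂, hb₂⟩ := exists_ball_hasFDerivBoundsOn (contDiffAt_jetMap k 2 (zeroJet k x)
    (by rw [jetBase_zeroJet, add_comm]; exact hr.contDiffAt)) (lt_add_one _)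
  refine ⟨min τ₁ τ₂, K, lt_min hτ₁ hτ₂, fun ξ hξ η hη => ?_⟩
  have hball := Metric.ball_subset_ball (x := zeroJet k x) (min_le_left τ₁ τ₂)
  have hball' := Metric.ball_subset_ball (x := zeroJet k x) (min_le_right τ₁ τ₂)
  exact gapLE_of_norm_sub_le
    (fun v hv => ((hb₁ ξ (hball hξ.2)).mem_tangentSpaceOf_iff (by lia) hξ.1).1 hv)
    ((hb₁ η (hball hη.2)).fderiv_mem (by lia) hη.1)
    (hb₂.norm_fderiv_sub_le ξ (hball' hξ.2) η (hball' hη.2))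

lemma exists_hasFDerivBoundsOn_jetStep (H : IsLeafSystem k Λ M h W) {t D₀ D : ℝ} (ht0 : 0 ≤ t)
    (ht1 : t ≤ 1) (hD₀ : ∀ x ∈ Λ, ‖fderiv ℝ h x‖ ≤ D₀) (hD : D₀ < D) :
    ∃ τ K, 0 < τ ∧ 0 ≤ K ∧ ∀ x ∈ Λ,
      HasFDerivBoundsOn (jetStep t h k) (Metric.ball (zeroJet k x) τ) D K := by
  refine exists_uniform_ball_zeroJet H.isCompact k
    (P := fun s K => HasFDerivBoundsOn (jetStep t h k) s D K)
    (fun s s' K K' hs hK hP => hP.mono hs hK) fun x hx => ?_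
  have hh := H.contDiffAt x hx
  exact exists_ball_hasFDerivBoundsOn
    (contDiffAt_jetStep t 2 (by rwa [jetBase_zeroJet, add_comm]))
    (((norm_fderiv_jetStep_zeroJet_le ht0 ht1 (by lia) hh).trans (hD₀ x hx)).trans_lt hD)

lemma eventually_gapLE_leafJetTangent (H : IsLeafSystem k Λ M h W) {ε : ℝ} (hε : 0 < ε) :
    ∀ᶠ τ in 𝓝[>] (0 : ℝ), ∀ ζ ∈ smallJets Λ W τ k,
      GapLE (leafJetTangent W k ζ) (jetSubmodule (tangentSpaceOf (W (jetBase k ζ)) (jetBase k ζ)) k)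
        ε ∧
      GapLE (jetSubmodule (tangentSpaceOf (W (jetBase k ζ)) (jetBase k ζ)) k) (leafJetTangent W k ζ)
        ε := by
  obtain ⟨K, hK⟩ := H.retraction
  filter_upwards [eventually_pos_lt_mul_le one_pos
    ((∑ j ∈ Finset.range k, (2 : ℝ) ^ ((2 + j) * j)) * K) hε] with τ ⟨hτ, hτ1, hτε⟩ ζ ⟨hx, hζ, hv⟩
  obtain ⟨r, hr, hrK⟩ := hK _ hx
  have hzero := zeroJet_mem_jetSet (H.mem _ hx) k
  have hr₀ : IsRetractionGerm (k + 1) r (W (jetBase k ζ))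
      (jetBase k (zeroJet k (jetBase k ζ))) := by rwa [jetBase_zeroJet]
  have hclose := (norm_fderiv_jetMap_sub_le hτ.le hτ1.le k ζ hv hr.contDiffAt hrK).trans hτε
  rw [← hr.tangentSpaceOf_zeroJet le_rfl (H.mem _ hx)]
  exact ⟨gapLE_of_norm_sub_le (fun v hv => (hr.mem_tangentSpaceOf_iff le_rfl hζ).1 hv)
    (hr₀.fderiv_mem le_rfl hzero) hclose,
    gapLE_of_norm_sub_le (fun v hv => (hr₀.mem_tangentSpaceOf_iff le_rfl hzero).1 hv)
    (hr.fderiv_mem le_rfl hζ) (by rwa [norm_sub_rev])⟩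

lemma eventually_gapLE_manifold (H : IsLeafSystem k Λ M h W) {ε : ℝ} (hε : 0 < ε) :
    ∀ᶠ τ in 𝓝[>] (0 : ℝ), ∀ ζ ∈ smallJets Λ W τ k, GapLE (tangentSpaceOf (jetSet M k) ζ)
      (jetSubmodule (tangentSpaceOf M (jetBase k ζ)) k) ε := by
  obtain ⟨τ₀, K, hτ₀, hK, hgap⟩ := H.exists_gapLE_manifold
  filter_upwards [eventually_pos_lt_mul_le hτ₀ K hε] with τ ⟨hτ, hττ₀, hτε⟩ ζ hζ
  have hdist := hζ.2.2.norm_sub_zeroJet_le hτ.le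
  have hxM := H.subset _ hζ.1 (H.mem _ hζ.1)
  obtain ⟨r, hr⟩ := H.retraction_manifold _ hζ.1
  rw [← hr.tangentSpaceOf_zeroJet (by lia) hxM]
  exact (hgap _ hζ.1 ζ ⟨H.smallJets_subset_jetSet hζ, mem_ball_iff_norm.2 (hdist.trans_lt hττ₀)⟩ _
    ⟨zeroJet_mem_jetSet hxM k, Metric.mem_ball_self hτ₀⟩).mono ((by gcongr : _ ≤ K * τ).trans hτε)

section Rates

variable {t D₀ : ℝ} (ht0 : 0 < t) (ht1 : t ≤ 1) (hD₀ : ∀ x ∈ Λ, ‖fderiv ℝ h x‖ ≤ D₀)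

include ht0 ht1 hD₀

lemma eventually_norm_fderiv_jetStep_sub_le (H : IsLeafSystem k Λ M h W) {ε : ℝ} (hε : 0 < ε) :
    ∀ᶠ τ in 𝓝[>] (0 : ℝ), ∀ ζ ∈ smallJets Λ W τ k,
      ‖fderiv ℝ (jetStep t h k) (zeroJet k (jetBase k ζ)) - fderiv ℝ (jetStep t h k) ζ‖ ≤ ε := by
  obtain ⟨τ₀, K, hτ₀, hK, hb⟩ :=
    H.exists_hasFDerivBoundsOn_jetStep ht0.le ht1 hD₀ (lt_add_one D₀)
  filter_upwards [eventually_pos_lt_mul_le hτ₀ K hε] with τ ⟨hτ, hττ₀, hτε⟩ ζ hζ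
  have hdist := hζ.2.2.norm_sub_zeroJet_le hτ.le
  rw [norm_sub_rev]
  exact ((hb _ hζ.1).norm_fderiv_sub_le ζ (mem_ball_iff_norm.2 (hdist.trans_lt hττ₀)) _
    (Metric.mem_ball_self hτ₀)).trans ((by gcongr : _ ≤ K * τ).trans hτε)

lemma eventually_norm_fderiv_jetStep_apply_le (H : IsLeafSystem k Λ M h W) {l₀ l : ℝ}
    (hD₀0 : 0 ≤ D₀) (hl₀ : 0 ≤ l₀) (hl : l₀ < l)
    (hW : ∀ x ∈ Λ, ∀ v ∈ tangentSpaceOf (W x) x, ‖fderiv ℝ h x v‖ ≤ l₀ * ‖v‖) :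
    ∀ᶠ τ in 𝓝[>] (0 : ℝ), ∀ ζ ∈ smallJets Λ W τ k, ∀ v ∈ leafJetTangent W k ζ,
      ‖fderiv ℝ (jetStep t h k) ζ v‖ ≤ l * ‖v‖ := by
  have hε : 0 < (l - l₀) / (l₀ + D₀ + 1) := div_pos (sub_pos.2 hl) (by positivity)
  filter_upwards [H.eventually_norm_fderiv_jetStep_sub_le ht0 ht1 hD₀ hε,
    H.eventually_gapLE_leafJetTangent hε] with τ hclose hgap ζ hζ v hv
  have hh := H.contDiffAt _ hζ.1
  have hrate := norm_apply_le_of_gapLE (hclose ζ hζ)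
    ((norm_fderiv_jetStep_zeroJet_le ht0.le ht1 (by lia) hh).trans (hD₀ _ hζ.1)) (hgap ζ hζ).1 hl₀
    (fun w hw => by
      rw [fderiv_jetStep_zeroJet t (by lia) hh]
      exact (norm_jetScale_le ht0.le ht1 k _).trans (norm_jetDiagonal_le hl₀ (hW _ hζ.1) k w hw))
    v hv
  rwa [div_mul_cancel₀ _ (by positivity), add_sub_cancel] at hrate

lemma eventually_mapsTo_smallJets (H : IsLeafSystem k Λ M h W) {l₀ l : ℝ} (hD₀0 : 0 ≤ D₀)
    (hl₀ : 0 ≤ l₀) (hl : l₀ < l) (htl : t * l ≤ 1)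
    (hW : ∀ x ∈ Λ, ∀ v ∈ tangentSpaceOf (W x) x, ‖fderiv ℝ h x v‖ ≤ l₀ * ‖v‖) :
    ∀ᶠ τ in 𝓝[>] (0 : ℝ), MapsTo (jetStep t h k) (smallJets Λ W τ k) (smallJets Λ W τ k) := by
  induction k with
  | zero =>
    refine .of_forall fun τ ζ hζ => ⟨?_, H.jetStep_mem_jetSet t hζ.1 hζ.2.1, trivial⟩
    exact H.mapsTo hζ.1
  | succ k ih =>
    have H' := H.of_le k.le_succ
    filter_upwards [ih H', self_mem_nhdsWithin,
      H'.eventually_norm_fderiv_jetStep_apply_le ht0 ht1 hD₀ hD₀0 hl₀ hl hW] with τ hmaps hτ hrate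
    rintro ⟨ζ, v⟩ ⟨hx, hζ, hvel⟩
    have hsmall : ζ ∈ smallJets Λ W τ k := ⟨hx, hζ.1, hvel.1⟩
    have hvnorm := hrate ζ hsmall v (Submodule.subset_span hζ.2)
    rw [fderiv_jetStep t le_rfl ((H'.contDiffAt (jetBase k ζ) hx).of_le (by norm_cast; lia))]
      at hvnorm
    refine ⟨(hmaps hsmall).1, H.jetStep_mem_jetSet t hx hζ, (hmaps hsmall).2.2, ?_⟩
    calc _ = t * _ := norm_smul_of_nonneg ht0.le _
      _ ≤ t * (l * τ) := mul_le_mul_of_nonneg_left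
        (hvnorm.trans (mul_le_mul_of_nonneg_left hvel.2 (hl₀.trans hl.le))) ht0.le
      _ ≤ τ := by rw [← mul_assoc]; exact mul_le_of_le_one_left (le_of_lt hτ) htl

lemma eventually_le_infDist_fderiv_jetStep [FiniteDimensional ℝ V] (H : IsLeafSystem k Λ M h W)
    {l₀ l μ m : ℝ} (hD₀0 : 0 ≤ D₀) (hl₀ : 0 ≤ l₀) (hl : l₀ < l) (htl : t * l ≤ 1) (hμ : 0 ≤ μ)
    (hm : m < μ * t ^ k)
    (hW : ∀ x ∈ Λ, ∀ v ∈ tangentSpaceOf (W x) x, ‖fderiv ℝ h x v‖ ≤ l₀ * ‖v‖)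
    (hquot : ∀ x ∈ Λ, ∀ u ∈ tangentSpaceOf M x, μ * Metric.infDist u (tangentSpaceOf (W x) x) ≤
      Metric.infDist (fderiv ℝ h x u) (tangentSpaceOf (W (h x)) (h x))) :
    ∀ᶠ τ in 𝓝[>] (0 : ℝ), ∀ ζ ∈ smallJets Λ W τ k, ∀ u ∈ tangentSpaceOf (jetSet M k) ζ,
      m * Metric.infDist u (leafJetTangent W k ζ) ≤
        Metric.infDist (fderiv ℝ (jetStep t h k) ζ u) (leafJetTangent W k (jetStep t h k ζ)) := by
  have := finiteDimensional_jetSpace (V := V) k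
  set c := 3 * (μ * t ^ k) + 3 * (D₀ + 1) + 1
  have hc0 : 0 < c := by positivity
  set ε := min 1 ((μ * t ^ k - m) / c)
  have hε : 0 < ε := lt_min one_pos (div_pos (sub_pos.2 hm) hc0)
  have hεm : m ≤ μ * t ^ k - ε * c := by
    linarith [(le_div_iff₀ hc0).1 (min_le_right 1 ((μ * t ^ k - m) / c))]
  filter_upwards [H.eventually_norm_fderiv_jetStep_sub_le ht0 ht1 hD₀ hε,
    H.eventually_gapLE_leafJetTangent hε, H.eventually_gapLE_manifold hε,
    H.eventually_mapsTo_smallJets ht0 ht1 hD₀ hD₀0 hl₀ hl htl hW] with τ hclose hgap hgapM hmaps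
  intro ζ hζ u hu
  have hh := H.contDiffAt _ hζ.1
  have hnorm₀ : ‖fderiv ℝ (jetStep t h k) (zeroJet k (jetBase k ζ))‖ ≤ D₀ :=
    (norm_fderiv_jetStep_zeroJet_le ht0.le ht1 (by lia) hh).trans (hD₀ _ hζ.1)
  have hnorm : ‖fderiv ℝ (jetStep t h k) ζ‖ ≤ D₀ + 1 := by
    rw [← sub_sub_cancel (fderiv ℝ (jetStep t h k) (zeroJet k (jetBase k ζ))) (fderiv ℝ _ ζ)]
    exact norm_sub_le_of_le hnorm₀ ((hclose ζ hζ).trans (min_le_left _ _))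
  have hquot' := le_infDist_apply_of_gapLE (hclose ζ hζ) hnorm
    (hnorm₀.trans (lt_add_one D₀).le) (hgapM ζ hζ) (hgap ζ hζ).2 (hgap _ (hmaps hζ)).1
    (H.leafJetTangent_le hζ.1) (fun v => H.fderiv_jetStep_mem_leafJetTangent t hζ.1 hζ.2.1)
    (mul_nonneg hμ (pow_nonneg ht0.le k)) (fun w hw => by
      rw [fderiv_jetStep_zeroJet t (by lia) hh, jetBase_jetStep]
      exact le_infDist_jetScale_jetDiagonal ht0 ht1 hμ (hquot _ hζ.1) k w hw) u hu
  exact (mul_le_mul_of_nonneg_right hεm Metric.infDist_nonneg).trans hquot'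

lemma exists_isDominatedOn [FiniteDimensional ℝ V] (H : IsLeafSystem k Λ M h W) {D l₀ l μ m : ℝ}
    (hD₀0 : 0 ≤ D₀) (hD : D₀ < D) (hl₀ : 0 ≤ l₀) (hl : l₀ < l) (htl : t * l ≤ 1) (hμ : 0 ≤ μ)
    (hm : m < μ * t ^ k)
    (hW : ∀ x ∈ Λ, ∀ v ∈ tangentSpaceOf (W x) x, ‖fderiv ℝ h x v‖ ≤ l₀ * ‖v‖)
    (hquot : ∀ x ∈ Λ, ∀ u ∈ tangentSpaceOf M x, μ * Metric.infDist u (tangentSpaceOf (W x) x) ≤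
      Metric.infDist (fderiv ℝ h x u) (tangentSpaceOf (W (h x)) (h x))) :
    ∃ τ ρ K, 0 < τ ∧ 0 < ρ ∧ 0 ≤ K ∧
      IsDominatedOn (jetStep t h k) (smallJets Λ W τ k) (tangentSpaceOf (jetSet M k))
        (leafJetTangent W k) l m D K ρ := by
  obtain ⟨τ₁, K₁, hτ₁, hK₁, hbounds⟩ := H.exists_hasFDerivBoundsOn_jetStep ht0.le ht1 hD₀ hD
  obtain ⟨τ₂, K₂, hτ₂, -, hgap⟩ := H.exists_gapLE_manifold
  have hevent := (H.eventually_mapsTo_smallJets ht0 ht1 hD₀ hD₀0 hl₀ hl htl hW).and <|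
    (H.eventually_norm_fderiv_jetStep_apply_le ht0 ht1 hD₀ hD₀0 hl₀ hl hW).and <|
    (H.eventually_le_infDist_fderiv_jetStep ht0 ht1 hD₀ hD₀0 hl₀ hl htl hμ hm hW hquot).and
    (eventually_pos_lt_mul_le (half_pos (lt_min hτ₁ hτ₂)) 0 one_pos)
  obtain ⟨τ, hmaps, hrate, hquot', hτ, hτρ, -⟩ := hevent.exists
  have hball : ∀ ζ ∈ smallJets Λ W τ k, ∀ ξ, ‖ζ - ξ‖ < min τ₁ τ₂ / 2 →
      ξ ∈ Metric.ball (zeroJet k (jetBase k ζ)) τ₁ ∩ Metric.ball (zeroJet k (jetBase k ζ)) τ₂ :=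
    fun ζ hζ ξ hξ => by
      have hmem := mem_ball_zeroJet_of_mem_smallJets hτ.le hτρ.le hζ hξ
      exact ⟨Metric.ball_subset_ball (min_le_left _ _) hmem,
        Metric.ball_subset_ball (min_le_right _ _) hmem⟩
  have hself : ∀ ζ ∈ smallJets Λ W τ k, ‖ζ - ζ‖ < min τ₁ τ₂ / 2 := fun ζ _ => by
    rw [sub_self, norm_zero]
    exact half_pos (lt_min hτ₁ hτ₂)
  refine ⟨τ, min τ₁ τ₂ / 2, max K₁ K₂, hτ, half_pos (lt_min hτ₁ hτ₂), hK₁.trans (le_max_left _ _), {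
    mapsTo := hmaps
    le := fun ζ hζ => H.leafJetTangent_le hζ.1
    fderiv_mem_left := fun ζ hζ v =>
      H.fderiv_jetStep_mem_manifold t hζ.1 (H.smallJets_subset_jetSet hζ)
    fderiv_mem_right := fun ζ hζ v => H.fderiv_jetStep_mem_leafJetTangent t hζ.1 hζ.2.1
    norm_apply_le := hrate
    le_infDist := hquot'
    differentiableAt := fun ζ hζ =>
      (hbounds _ hζ.1).differentiableAt ζ (hball ζ hζ ζ (hself ζ hζ)).1
    norm_fderiv_le := fun ζ hζ => (hbounds _ hζ.1).norm_fderiv_le ζ (hball ζ hζ ζ (hself ζ hζ)).1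
    norm_sub_le := fun ξ hξ η _ hξη => by
      rw [norm_sub_rev, norm_sub_rev ξ]
      exact (convex_ball _ _).norm_image_sub_le_of_norm_fderiv_le
        (hbounds _ hξ.1).differentiableAt (hbounds _ hξ.1).norm_fderiv_le
        (hball ξ hξ ξ (hself ξ hξ)).1 (hball ξ hξ η hξη).1
    norm_fderiv_sub_le := fun ξ hξ η _ hξη =>
      ((hbounds _ hξ.1).norm_fderiv_sub_le ξ (hball ξ hξ ξ (hself ξ hξ)).1 η
        (hball ξ hξ η hξη).1).trans (by gcongr; exact le_max_left _ _)
    gapLE := fun ξ hξ η hη hξη =>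
      (hgap _ hξ.1 ξ ⟨H.smallJets_subset_jetSet hξ, (hball ξ hξ ξ (hself ξ hξ)).2⟩ η
        ⟨H.smallJets_subset_jetSet hη, (hball ξ hξ η hξη).2⟩).mono
        (by gcongr; exact le_max_right _ _) }⟩

theorem exists_infDist_leafJetTangent_le [FiniteDimensional ℝ V] (H : IsLeafSystem k Λ M h W)
    {l₀ l μ m κ φ : ℝ} (hD₀0 : 0 ≤ D₀) (hl₀ : 0 ≤ l₀) (hl : l₀ < l) (htl : t * l ≤ 1) (hμ : 0 ≤ μ)
    (hm : m < μ * t ^ k)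
    (hW : ∀ x ∈ Λ, ∀ v ∈ tangentSpaceOf (W x) x, ‖fderiv ℝ h x v‖ ≤ l₀ * ‖v‖)
    (hquot : ∀ x ∈ Λ, ∀ u ∈ tangentSpaceOf M x, μ * Metric.infDist u (tangentSpaceOf (W x) x) ≤
      Metric.infDist (fderiv ℝ h x u) (tangentSpaceOf (W (h x)) (h x)))
    (hκ : 1 < κ) (hDκ : D₀ < κ) (hDκl : D₀ < κ * l) (hφ : 0 ≤ φ) (hφ1 : φ ≤ 1)
    (hrate : l * κ ^ φ ≤ m) :
    ∃ τ C, 0 < τ ∧ ∀ ξ ∈ smallJets Λ W τ k, ∀ η ∈ smallJets Λ W τ k,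
      ∀ v ∈ leafJetTangent W k ξ,
        Metric.infDist v (leafJetTangent W k η) ≤ C * ‖ξ - η‖ ^ φ * ‖v‖ := by
  obtain ⟨D, hD₀D, hD⟩ := exists_between (lt_min hDκ hDκl)
  rw [lt_min_iff] at hD
  have := finiteDimensional_jetSpace (V := V) k
  obtain ⟨τ, ρ, K, hτ, hρ, hK, hdom⟩ :=
    H.exists_isDominatedOn ht0 ht1 hD₀ hD₀0 hD₀D hl₀ hl htl hμ hm hW hquot
  obtain ⟨C, hC⟩ := hdom.exists_infDist_le (hl₀.trans_lt hl) (hD₀0.trans hD₀D.le) hK hρ hD.1.le hκ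
    hD.2 hφ hφ1 hrate
  exact ⟨τ, C, hτ, hC⟩

end Rates

end IsLeafSystem

end LeafSystems

section Cocycle

variable {V : Type*} [NormedAddCommGroup V] [NormedSpace ℝ V]

/-- A linear cocycle `L n x` over `f : Λ → Λ` which leaves the distributions `E` and `E ⊕ U`
invariant, grows on `E` at most at the rate `l` and on `U` at least at the rate `μ`. Only the
growth of `U`, not its invariance, is required: `U` serves to measure the growth transversal
to `E`. -/
structure IsRateCocycle (Λ : Set V) (f : V → V) (L : ℕ → V → V →L[ℝ] V) (E U : V → Submodule ℝ V)
    (C F l μ : ℝ) : Prop where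
  mapsTo : MapsTo f Λ Λ
  zero : ∀ x ∈ Λ, L 0 x = ContinuousLinearMap.id ℝ V
  add : ∀ x ∈ Λ, ∀ a b, L (a + b) x = (L a (f^[b] x)).comp (L b x)
  mem : ∀ x ∈ Λ, ∀ n, ∀ v ∈ E x, L n x v ∈ E (f^[n] x)
  mem_sup : ∀ x ∈ Λ, ∀ n, ∀ v ∈ E x ⊔ U x, L n x v ∈ E (f^[n] x) ⊔ U (f^[n] x)
  norm_le : ∀ x ∈ Λ, ‖L 1 x‖ ≤ F
  upper : ∀ x ∈ Λ, ∀ n, ∀ v ∈ E x, ‖L n x v‖ ≤ C * l ^ n * ‖v‖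
  lower : ∀ x ∈ Λ, ∀ n, ∀ v ∈ U x, C⁻¹ * μ ^ n * ‖v‖ ≤ ‖L n x v‖

namespace IsRateCocycle

variable {Λ : Set V} {f : V → V} {L : ℕ → V → V →L[ℝ] V} {E U : V → Submodule ℝ V}
  {C F l μ θ : ℝ}

lemma add_apply (H : IsRateCocycle Λ f L E U C F l μ) {x : V} (hx : x ∈ Λ) (a b : ℕ) (v : V) :
    L (a + b) x v = L a (f^[b] x) (L b x v) := by
  rw [H.add x hx, ContinuousLinearMap.comp_apply]

lemma infDist_apply_add (H : IsRateCocycle Λ f L E U C F l μ) {x : V} (hx : x ∈ Λ) (n : ℕ)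
    (v : V) {e : V} (he : e ∈ E x) :
    Metric.infDist (L n x (v + e)) (E (f^[n] x)) = Metric.infDist (L n x v) (E (f^[n] x)) := by
  rw [map_add, infDist_add_mem _ _ (H.mem x hx n e he)]

variable [FiniteDimensional ℝ V]

lemma infDist_apply_succ_le (H : IsRateCocycle Λ f L E U C F l μ) {x : V} (hx : x ∈ Λ) (n : ℕ)
    (v : V) :
    Metric.infDist (L (n + 1) x v) (E (f^[n + 1] x)) ≤
      F * Metric.infDist (L n x v) (E (f^[n] x)) := by
  have hxn := H.mapsTo.iterate n hx
  obtain ⟨e, he, hd⟩ := exists_norm_sub_eq_infDist (E (f^[n] x)) (L n x v)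
  have hLe := H.mem _ hxn 1 e he
  rw [add_comm, H.add_apply hx, Function.iterate_add_apply, ← hd]
  refine (infDist_le_norm_sub _ hLe).trans ?_
  rw [← map_sub]
  exact ContinuousLinearMap.le_of_opNorm_le _ (H.norm_le _ hxn) _

lemma infDist_apply_add_le (H : IsRateCocycle Λ f L E U C F l μ) (hF : 0 ≤ F) {x : V}
    (hx : x ∈ Λ) (n : ℕ) (v : V) (j : ℕ) :
    Metric.infDist (L (n + j) x v) (E (f^[n + j] x)) ≤
      F ^ j * Metric.infDist (L n x v) (E (f^[n] x)) := by
  induction j with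
  | zero => simp
  | succ j ih =>
    rw [pow_succ', mul_assoc]
    exact (H.infDist_apply_succ_le hx (n + j) v).trans (mul_le_mul_of_nonneg_left ih hF)

-- Split `v = e + r` with `e ∈ E x` closest to `v` and apply the induction hypothesis to `L 1 x r`.
-- The constant `B` is chosen so that the error terms telescope.
lemma norm_apply_le_of_infDist_apply_le (H : IsRateCocycle Λ f L E U C F l μ) (hC : 0 ≤ C)
    (hl : 0 ≤ l) {B : ℝ} (hB : B * (θ - l) = C * (F + l)) (n : ℕ) {x : V} (hx : x ∈ Λ) {v : V}
    {D : ℝ} (hD : ∀ j ≤ n, Metric.infDist (L j x v) (E (f^[j] x)) ≤ D * θ ^ j) :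
    ‖L n x v‖ ≤ C * l ^ n * ‖v‖ + ((B + C + 1) * θ ^ n - B * l ^ n) * D := by
  induction n generalizing x v D with
  | zero =>
    obtain ⟨e, he, hd⟩ := exists_norm_sub_eq_infDist (E x) v
    have hr : ‖v - e‖ ≤ D := by simpa [hd, H.zero x hx] using hD 0 le_rfl
    have hCe : ‖e‖ ≤ C * ‖e‖ := by simpa [H.zero x hx] using H.upper x hx 0 e he
    have hCev : C * ‖e‖ ≤ C * (‖v‖ + ‖v - e‖) := by gcongr; exact norm_le_norm_add_norm_sub v e
    have hCr := mul_le_mul_of_nonneg_left hr hC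
    have hv := norm_le_norm_add_norm_sub' v e
    rw [H.zero x hx, ContinuousLinearMap.id_apply]
    linarith
  | succ n ih =>
    obtain ⟨e, he, hd⟩ := exists_norm_sub_eq_infDist (E x) v
    have hr : ‖v - e‖ ≤ D := by simpa [hd, H.zero x hx] using hD 0 (Nat.zero_le _)
    have hLr : ‖L 1 x (v - e)‖ ≤ F * D :=
      ((L 1 x).le_of_opNorm_le (H.norm_le x hx) _).trans
        (mul_le_mul_of_nonneg_left hr ((norm_nonneg _).trans (H.norm_le x hx)))
    have hDr : ∀ j ≤ n, Metric.infDist (L j (f x) (L 1 x (v - e))) (E (f^[j] (f x))) ≤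
        D * θ * θ ^ j := fun j hj => by
      have := hD (j + 1) (by lia)
      rwa [← sub_add_cancel v e, H.infDist_apply_add hx _ _ he, H.add_apply hx, pow_succ',
        ← mul_assoc] at this
    have hLe : ‖L (n + 1) x e‖ ≤ C * l ^ (n + 1) * (‖v‖ + D) := by
      refine (H.upper x hx _ e he).trans ?_
      gcongr
      exact (norm_le_norm_add_norm_sub v e).trans (by gcongr)
    calc ‖L (n + 1) x v‖ = ‖L (n + 1) x e + L n (f x) (L 1 x (v - e))‖ := by
          rw [← Function.iterate_one f, ← H.add_apply hx, ← map_add, add_sub_cancel]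
      _ ≤ C * l ^ (n + 1) * (‖v‖ + D) +
          (C * l ^ n * (F * D) + ((B + C + 1) * θ ^ n - B * l ^ n) * (D * θ)) := by
        refine (norm_add_le _ _).trans (add_le_add hLe ?_)
        exact (ih (H.mapsTo hx) hDr).trans (by gcongr)
      _ = _ := by linear_combination -(l ^ n * D) * hB

lemma exists_growth_time (H : IsRateCocycle Λ f L E U C F l μ) (hC : 0 < C) (hF : 0 ≤ F)
    (hl : 0 ≤ l) (hlθ : l < θ) (hθμ : θ < μ) :
    ∃ N : ℕ, ∀ x ∈ Λ, ∀ u ∈ E x ⊔ U x, ∃ j : ℕ, 1 ≤ j ∧ j ≤ N ∧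
      θ ^ j * Metric.infDist u (E x) ≤ Metric.infDist (L j x u) (E (f^[j] x)) := by
  have hθ0 : 0 < θ := hl.trans_lt hlθ
  have hθl : 0 < θ - l := sub_pos.2 hlθ
  obtain ⟨B, hB0, hB⟩ : ∃ B, 0 ≤ B ∧ B * (θ - l) = C * (F + l) :=
    ⟨C * (F + l) / (θ - l), by positivity, div_mul_cancel₀ _ hθl.ne'⟩
  obtain ⟨N, hN⟩ : ∃ N : ℕ, (2 * C + B + 1) * θ ^ (N + 1) < C⁻¹ * μ ^ (N + 1) := by
    have hone := (one_lt_div hθ0).2 hθμ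
    obtain ⟨N, hN⟩ := pow_unbounded_of_one_lt ((2 * C + B + 1) * C) hone
    refine ⟨N, ?_⟩
    have h := hN.trans_le (pow_le_pow_right₀ hone.le (N.le_add_right 1))
    rw [div_pow, lt_div_iff₀ (by positivity)] at h
    rw [inv_mul_eq_div, lt_div_iff₀ hC]
    linarith
  refine ⟨N + 1, fun x hx u hu => ?_⟩
  obtain ⟨e, he, w, hw, rfl⟩ := Submodule.mem_sup.1 hu
  simp only [add_comm e w, infDist_add_mem _ _ he, H.infDist_apply_add hx _ _ he]
  by_contra! hslow
  have hwE := infDist_le_norm (E x) w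
  have hw0 : 0 < ‖w‖ := by
    have := Metric.infDist_nonneg.trans_lt (hslow 1 le_rfl (by lia))
    exact (pos_of_mul_pos_right this (by positivity)).trans_le hwE
  have hD : ∀ j ≤ N + 1, Metric.infDist (L j x w) (E (f^[j] x)) ≤ ‖w‖ * θ ^ j := fun j hj => by
    rcases j.eq_zero_or_pos with rfl | hj0
    · simpa [H.zero x hx] using hwE
    · rw [mul_comm]
      exact (hslow j hj0 hj).le.trans (by gcongr)
  have hupper := H.norm_apply_le_of_infDist_apply_le hC.le hl hB _ hx hD
  have hlower := H.lower x hx (N + 1) w hw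
  have hlθN : C * l ^ (N + 1) * ‖w‖ ≤ C * θ ^ (N + 1) * ‖w‖ := by gcongr
  have hBN : 0 ≤ B * l ^ (N + 1) * ‖w‖ := by positivity
  linarith [mul_lt_mul_of_pos_right hN hw0]

lemma exists_late_growth_time (H : IsRateCocycle Λ f L E U C F l μ) (hC : 0 < C) (hF : 0 ≤ F)
    (hl : 0 ≤ l) (hlθ : l < θ) (hθμ : θ < μ) :
    ∃ N : ℕ, ∀ x ∈ Λ, ∀ u ∈ E x ⊔ U x, ∀ n, ∃ j ≤ N,
      θ ^ (n + j) * Metric.infDist u (E x) ≤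
        Metric.infDist (L (n + j) x u) (E (f^[n + j] x)) := by
  have hθ0 : 0 < θ := hl.trans_lt hlθ
  obtain ⟨N, hN⟩ := H.exists_growth_time hC hF hl hlθ hθμ
  refine ⟨N, fun x hx u hu n => ?_⟩
  induction n with
  | zero => exact ⟨0, N.zero_le, by simp [H.zero x hx]⟩
  | succ n ih =>
    obtain ⟨j, hjN, hj⟩ := ih
    rcases j with _ | j
    · obtain ⟨i, hi1, hiN, hi⟩ := hN _ (H.mapsTo.iterate n hx) _ (H.mem_sup x hx n u hu)
      refine ⟨i - 1, by lia, ?_⟩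
      rw [show n + 1 + (i - 1) = i + n by lia, H.add_apply hx, Function.iterate_add_apply, pow_add,
        mul_assoc]
      exact (mul_le_mul_of_nonneg_left hj (by positivity)).trans hi
    · exact ⟨j, by lia, by rwa [add_assoc n 1 j, add_comm 1 j]⟩

lemma exists_le_infDist_apply (H : IsRateCocycle Λ f L E U C F l μ) (hC : 0 < C) (hF : 1 ≤ F)
    (hl : 0 ≤ l) (hlθ : l < θ) (hθμ : θ < μ) :
    ∃ c : ℝ, 0 < c ∧ ∀ x ∈ Λ, ∀ u ∈ E x ⊔ U x, ∀ n : ℕ,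
      c * θ ^ n * Metric.infDist u (E x) ≤ Metric.infDist (L n x u) (E (f^[n] x)) := by
  have hθ0 : 0 < θ := hl.trans_lt hlθ
  have hF0 : 0 < F := by linarith
  obtain ⟨N, hN⟩ := H.exists_late_growth_time hC hF0.le hl hlθ hθμ
  refine ⟨(min 1 θ / F) ^ N, by positivity, fun x hx u hu n => ?_⟩
  obtain ⟨j, hjN, hj⟩ := hN x hx u hu n
  have hpow : (min 1 θ / F) ^ N ≤ (min 1 θ / F) ^ j := by
    refine pow_le_pow_of_le_one (by positivity) ?_ hjN
    exact (div_le_one hF0).2 ((min_le_left _ _).trans hF)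
  have hd : 0 ≤ Metric.infDist u (E x) := Metric.infDist_nonneg
  calc (min 1 θ / F) ^ N * θ ^ n * Metric.infDist u (E x)
      ≤ (θ / F) ^ j * θ ^ n * Metric.infDist u (E x) := by
        gcongr
        exact hpow.trans (by gcongr; exact min_le_right _ _)
    _ = θ ^ (n + j) * Metric.infDist u (E x) / F ^ j := by rw [div_pow]; ring
    _ ≤ Metric.infDist (L n x u) (E (f^[n] x)) := by
      rw [div_le_iff₀' (by positivity)]
      exact hj.trans (H.infDist_apply_add_le hF0.le hx n u j)

-- A large iterate absorbs the constants at the cost of a small loss in the rates.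
lemma exists_iterate_rates (H : IsRateCocycle Λ f L E U C F l μ) (hC : 0 < C) (hF : 1 ≤ F)
    (hl : 0 ≤ l) {l' m : ℝ} (hl' : l < l') (hm0 : 0 ≤ m) (hm : m < μ) (hlμ : l < μ) :
    ∃ N : ℕ, 1 ≤ N ∧ ∀ x ∈ Λ, (∀ v ∈ E x, ‖L N x v‖ ≤ l' ^ N * ‖v‖) ∧
      ∀ u ∈ E x ⊔ U x,
        m ^ N * Metric.infDist u (E x) ≤ Metric.infDist (L N x u) (E (f^[N] x)) := by
  obtain ⟨θ, hθ, hθμ⟩ := exists_between (max_lt hm hlμ)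
  obtain ⟨hmθ, hlθ⟩ := max_lt_iff.1 hθ
  obtain ⟨c, hc, hlower⟩ := H.exists_le_infDist_apply hC hF hl hlθ hθμ
  have eventually_pow_le : ∀ {a b K : ℝ}, 0 ≤ a → a < b → 0 < K →
      ∀ᶠ n : ℕ in atTop, a ^ n ≤ K * b ^ n := fun {a b K} ha hab hK => by
    have hb := ha.trans_lt hab
    filter_upwards [(tendsto_pow_atTop_nhds_zero_of_lt_one (div_nonneg ha hb.le)
      ((div_lt_one hb).2 hab)).eventually_lt_const hK] with n hn
    rw [div_pow, div_lt_iff₀ (by positivity)] at hn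
    exact hn.le
  obtain ⟨N, ⟨hlN, hmN⟩, hN⟩ := (((eventually_pow_le hl hl' (inv_pos.2 hC)).and
    (eventually_pow_le hm0 hmθ hc)).and (eventually_ge_atTop 1)).exists
  rw [inv_mul_eq_div, le_div_iff₀' hC] at hlN
  refine ⟨N, hN, fun x hx => ⟨fun v hv => (H.upper x hx N v hv).trans (by gcongr), fun u hu => ?_⟩⟩
  exact (mul_le_mul_of_nonneg_right hmN Metric.infDist_nonneg).trans (hlower x hx u hu N)

end IsRateCocycle

end Cocycle

section Iterates

lemma eventually_iterate_mem {X : Type*} [TopologicalSpace X] {f : X → X} {Λ : Set X}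
    {W : X → Set X} (hfΛ : MapsTo f Λ Λ) (hf : ∀ x ∈ Λ, ContinuousAt f x)
    (hW : ∀ x ∈ Λ, ∀ᶠ y in 𝓝 x, y ∈ W x → f y ∈ W (f x)) (j : ℕ) {x : X}
    (hx : x ∈ Λ) : ∀ᶠ y in 𝓝 x, y ∈ W x → f^[j] y ∈ W (f^[j] x) := by
  induction j generalizing x with
  | zero => exact .of_forall fun _ h => h
  | succ j ih =>
    filter_upwards [(hf x hx).eventually (ih (hfΛ hx)), hW x hx] with y hfy hy hyW
    exact hfy (hy hyW)

variable {V : Type*} [NormedAddCommGroup V] [NormedSpace ℝ V] {f : V → V} {Λ : Set V}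

lemma contDiffAt_iterate_of_mapsTo {n : WithTop ℕ∞} (hfΛ : MapsTo f Λ Λ)
    (hf : ∀ x ∈ Λ, ContDiffAt ℝ n f x) {x : V} (hx : x ∈ Λ) : ∀ j : ℕ, ContDiffAt ℝ n f^[j] x
  | 0 => contDiffAt_id
  | j + 1 => by
    rw [Function.iterate_succ']
    exact (hf _ (hfΛ.iterate j hx)).comp x (contDiffAt_iterate_of_mapsTo hfΛ hf hx j)

lemma norm_fderiv_iterate_le (hfΛ : MapsTo f Λ Λ) (hf : ∀ x ∈ Λ, DifferentiableAt ℝ f x) {F : ℝ}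
    (hF : ∀ x ∈ Λ, ‖fderiv ℝ f x‖ ≤ F) {x : V} (hx : x ∈ Λ) (n : ℕ) :
    ‖fderiv ℝ f^[n] x‖ ≤ F ^ n := by
  have hF0 : 0 ≤ F := (norm_nonneg _).trans (hF x hx)
  refine ContinuousLinearMap.opNorm_le_bound _ (pow_nonneg hF0 n) fun v => ?_
  induction n with
  | zero => simp
  | succ n ih =>
    rw [fderiv_iterate_succ_apply hfΛ hf hx, pow_succ', mul_assoc]
    exact (ContinuousLinearMap.le_of_opNorm_le _ (hF _ (hfΛ.iterate n hx)) _).trans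
      (mul_le_mul_of_nonneg_left ih hF0)

lemma HasRates.le_of_norm_fderiv_le {A U : V → Submodule ℝ V} {l μ F : ℝ}
    (hr : HasRates f Λ A U l μ) (hfΛ : MapsTo f Λ Λ) (hf : ∀ x ∈ Λ, DifferentiableAt ℝ f x)
    (hF0 : 0 < F) (hF : ∀ x ∈ Λ, ‖fderiv ℝ f x‖ ≤ F) (hU : ∃ x ∈ Λ, U x ≠ ⊥) : μ ≤ F := by
  obtain ⟨C, hC, hrates⟩ := hr
  obtain ⟨x, hx, hne⟩ := hU
  obtain ⟨v, hv, hv0⟩ := Submodule.exists_mem_ne_zero_of_ne_bot hne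
  by_contra! hμ
  obtain ⟨n, hn⟩ := pow_unbounded_of_one_lt C ((one_lt_div hF0).2 hμ)
  rw [div_pow, lt_div_iff₀ (by positivity), ← lt_inv_mul_iff₀ hC] at hn
  have hle := ((hrates x hx n).2 v hv).trans
    (ContinuousLinearMap.le_of_opNorm_le _ (norm_fderiv_iterate_le hfΛ hf hF hx n) v)
  exact (le_of_mul_le_mul_right hle (norm_pos_iff.2 hv0)).not_gt hn

lemma exists_norm_iteratedFDeriv_le (hΛ : IsCompact Λ) {k : ℕ}
    (hf : ∀ x ∈ Λ, ContDiffAt ℝ k f x) :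
    ∃ B : ℝ, ∀ x ∈ Λ, ∀ j ≤ k, ‖iteratedFDeriv ℝ j f x‖ ≤ B := by
  have bound : ∀ j : ℕ, ∃ B : ℝ, j ≤ k → ∀ x ∈ Λ, ‖iteratedFDeriv ℝ j f x‖ ≤ B := fun j => by
    by_cases hj : j ≤ k
    · obtain ⟨B, hB⟩ := hΛ.exists_bound_of_continuousOn fun x hx =>
        ((hf x hx).iteratedFDeriv_right (m := 0) (i := j)
          (by rw [zero_add]; exact_mod_cast hj)).continuousAt.continuousWithinAt
      exact ⟨B, fun _ => hB⟩
    · exact ⟨0, fun h => absurd h hj⟩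
  choose B hB using bound
  obtain ⟨B', hB'⟩ := ((Finset.range (k + 1)).image B).exists_le
  exact ⟨B', fun x hx j hj => (hB j hj x hx).trans
    (hB' _ (Finset.mem_image_of_mem B (Finset.mem_range.2 (by lia))))⟩

lemma norm_fderiv_le_cNorm (hΛ : IsCompact Λ) {k : ℕ} (hf : ∀ x ∈ Λ, ContDiffAt ℝ k f x)
    (hk : 1 ≤ k) {x : V} (hx : x ∈ Λ) : ‖fderiv ℝ f x‖ ≤ cNorm k f Λ := by
  obtain ⟨B, hB⟩ := exists_norm_iteratedFDeriv_le hΛ hf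
  have hBj : ∀ y ∈ Λ, ∀ j : Fin (k + 1), ‖iteratedFDeriv ℝ j f y‖ ≤ B :=
    fun y hy j => hB y hy j (by lia)
  calc ‖fderiv ℝ f x‖ = ‖iteratedFDeriv ℝ ((⟨1, by lia⟩ : Fin (k + 1)) : ℕ) f x‖ :=
        (norm_iteratedFDeriv_one ..).symm
    _ ≤ ⨆ j : Fin (k + 1), ‖iteratedFDeriv ℝ j f x‖ :=
        le_ciSup (f := fun j : Fin (k + 1) => ‖iteratedFDeriv ℝ j f x‖)
          ⟨B, forall_mem_range.2 (hBj x hx)⟩ _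
    _ ≤ cNorm k f Λ := le_ciSup (f := fun y : Λ => ⨆ j : Fin (k + 1), ‖iteratedFDeriv ℝ j f y‖)
        ⟨B, forall_mem_range.2 fun y => ciSup_le (hBj y y.2)⟩ ⟨x, hx⟩

end Iterates

section Parameters

lemma rpow_holderExponent {l μ b : ℝ} (hl : 0 < l) (hμ : 0 < μ) (hb : l < b) :
    (b / l) ^ holderExponent l μ b = μ / l := by
  have hb0 : 0 < b := hl.trans hb
  have hlog : Real.log b - Real.log l ≠ 0 := (sub_pos.2 (Real.log_lt_log hl hb)).ne'
  rw [Real.rpow_def_of_pos (by positivity), Real.log_div hb0.ne' hl.ne', holderExponent,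
    mul_div_cancel₀ _ hlog, ← Real.log_div hμ.ne' hl.ne', Real.exp_log (by positivity)]

lemma holderExponent_pos {l μ b : ℝ} (hl : 0 < l) (hlμ : l < μ) (hb : l < b) :
    0 < holderExponent l μ b :=
  div_pos (sub_pos.2 (Real.log_lt_log hl hlμ)) (sub_pos.2 (Real.log_lt_log hl hb))

lemma holderExponent_le_one {l μ b : ℝ} (hl : 0 < l) (hlμ : l < μ) (hμb : μ ≤ b) :
    holderExponent l μ b ≤ 1 :=
  (div_le_one (sub_pos.2 (Real.log_lt_log hl (hlμ.trans_le hμb)))).2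
    (sub_le_sub_right (Real.log_le_log (hl.trans hlμ) hμb) _)

variable {l μ a b φ : ℝ}

lemma exists_rate_of_lt_one (hl : 0 < l) (hl1 : l < 1) (hφ : 0 < φ) (hrel : (b / l) ^ φ = μ / l)
    (ha : 0 ≤ a) (hab : a < b) : ∃ l', l < l' ∧ l' ≤ 1 ∧ l' * (a / l') ^ φ < μ := by
  have hlim : ∀ᶠ l' in 𝓝 l, l' * (a / l') ^ φ < μ := by
    have hcont : ContinuousAt (fun l' : ℝ => l' * (a / l') ^ φ) l :=
      continuousAt_id.mul
        ((continuousAt_const.div continuousAt_id hl.ne').rpow_const (Or.inr hφ.le))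
    refine hcont.eventually_lt_const ?_
    rw [← lt_div_iff₀' hl, ← hrel]
    gcongr
  obtain ⟨l', ⟨hμ, hlt⟩, hl'⟩ := (((hlim.and (eventually_lt_nhds hl1)).filter_mono
    nhdsWithin_le_nhds).and (self_mem_nhdsWithin (s := Ioi l))).exists
  exact ⟨l', hl', hlt.le, hμ⟩

lemma exists_rate_of_pow_lt {k : ℕ} (hl : 0 < l) (hφ : 0 < φ) (hrel : (b / l) ^ φ = μ / l)
    (hμ : 0 < μ) (ha : 0 ≤ a) (hab : a ^ (k + 1) * l < b) (hk : 1 ≤ k → l ^ (k + 2) < μ) :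
    ∃ l', l < l' ∧ l' ^ (k + 1) * a ^ φ < μ := by
  have hμl : μ / l ≤ (μ / l ^ (k + 1)) ^ (k + 1) := by
    have hpow : (l ^ (k + 2)) ^ k ≤ μ ^ k := by
      rcases k.eq_zero_or_pos with rfl | hk0
      · simp
      · exact pow_le_pow_left₀ (by positivity) (hk hk0).le k
    rw [div_pow, div_le_div_iff₀ hl (by positivity)]
    calc μ * (l ^ (k + 1)) ^ (k + 1) = μ * l * (l ^ (k + 2)) ^ k := by ring
      _ ≤ μ * l * μ ^ k := by gcongr
      _ = μ ^ (k + 1) * l := by ring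
  have hlt : (a ^ φ) ^ (k + 1) < (μ / l ^ (k + 1)) ^ (k + 1) := by
    refine lt_of_lt_of_le ?_ hμl
    rw [Real.rpow_pow_comm ha, ← hrel]
    gcongr
    rwa [lt_div_iff₀ hl]
  have hl_lt : l ^ (k + 1) * a ^ φ < μ := by
    rw [← lt_div_iff₀' (by positivity)]
    exact lt_of_pow_lt_pow_left₀ (k + 1) (by positivity) hlt
  have hcont : Continuous fun l' : ℝ => l' ^ (k + 1) * a ^ φ := by fun_prop
  obtain ⟨l', hμ', hl'⟩ := ((((hcont.tendsto l).eventually_lt_const hl_lt).filter_mono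
    nhdsWithin_le_nhds).and (self_mem_nhdsWithin (s := Ioi l))).exists
  exact ⟨l', hl', hμ'⟩

-- For `l < 1` no rescaling of the velocities is needed, whereas for `1 ≤ l` the choice of `σ` equal
-- to the new rate keeps them bounded; it costs the factor `σ ^ k`, which the condition on
-- `l ^ (k + 2)` compensates.
lemma exists_scaling {k : ℕ} (hl : 0 < l) (hφ : 0 < φ) (hrel : (b / l) ^ φ = μ / l) (hμ : 0 < μ)
    (ha : 0 ≤ a) (hab : a < b) (hlab : a ^ (k + 1) * l < b) (hk : 1 ≤ k → l ^ (k + 2) < μ) :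
    ∃ σ l' : ℝ, 1 ≤ σ ∧ l < l' ∧ l' ≤ σ ∧ l' * (a * σ / l') ^ φ * σ ^ k < μ := by
  rcases lt_or_ge l 1 with hl1 | hl1
  · obtain ⟨l', hl', hl'1, hlt⟩ := exists_rate_of_lt_one hl hl1 hφ hrel ha hab
    exact ⟨1, l', le_rfl, hl', hl'1, by simpa using hlt⟩
  · obtain ⟨l', hl', hlt⟩ := exists_rate_of_pow_lt hl hφ hrel hμ ha hlab hk
    refine ⟨l', l', hl1.trans hl'.le, hl', le_rfl, ?_⟩
    rw [mul_div_cancel_right₀ _ (hl.trans hl').ne']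
    linarith [pow_succ' l' k, show l' * a ^ φ * l' ^ k = l' ^ (k + 1) * a ^ φ by ring]

lemma two_mul_pow_mul_lt_bConst {V : Type*} [NormedAddCommGroup V] [NormedSpace ℝ V] {f : V → V}
    {Λ : Set V} {k : ℕ} (hF : 1 ≤ cNorm (k + 4) f Λ) :
    (2 * cNorm (k + 4) f Λ) ^ (k + 1) * cNorm (k + 4) f Λ < bConst (k + 1) f Λ := by
  change _ < 3 ^ (4 * (k + 1)) * ((k + 1 + 1).factorial : ℝ) *
    2 ^ ((k + 1 + 2) * (k + 1 + 3) / 2) * cNorm (k + 4) f Λ ^ (k + 4)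
  set F := cNorm (k + 4) f Λ
  have : 0 < F := by linarith
  have hfact : (1 : ℝ) ≤ (k + 1 + 1).factorial := mod_cast Nat.factorial_pos _
  calc (2 * F) ^ (k + 1) * F = 2 ^ (k + 1) * 1 * 1 * F ^ (k + 2) := by ring
    _ < 3 ^ (k + 1) * 1 * 1 * F ^ (k + 2) := by gcongr; norm_num
    _ ≤ _ := by
      gcongr
      · norm_num
      · lia
      · exact one_le_pow₀ one_le_two
      · lia

end Parameters

section HolderDistribution

variable {V : Type*} [NormedAddCommGroup V] [NormedSpace ℝ V]

lemma subspaceDist_le {A B : Submodule ℝ V} {ε : ℝ} (hε : 0 ≤ ε)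
    (hAB : ∀ v ∈ A, Metric.infDist v B ≤ ε * ‖v‖) (hBA : ∀ w ∈ B, Metric.infDist w A ≤ ε * ‖w‖) :
    subspaceDist A B ≤ ε :=
  max_le (Real.iSup_le (fun v => by simpa [v.2.2] using hAB v v.2.1) hε)
    (Real.iSup_le (fun w => by simpa [w.2.2] using hBA w w.2.1) hε)

lemma pow_mul_infDist_tangentSpaceOf_le_jetScale {t : ℝ} (ht0 : 0 < t) (ht1 : t ≤ 1) (S : Set V)
    {k : ℕ} (η v : JetSpace V k) :
    t ^ k * Metric.infDist v (tangentSpaceOf (jetSet S k) η) ≤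
      Metric.infDist (jetScale V t k v) (tangentSpaceOf (jetSet S k) (jetScale V t k η)) := by
  have hinv : jetScale V t⁻¹ k (jetScale V t k η) = η := by
    simpa using jetScale_jetScale_inv (inv_ne_zero ht0.ne') k η
  refine le_infDist_of_forall_le fun e he => ?_
  have he' := jetScale_mem_tangentSpaceOf t⁻¹ he
  rw [hinv] at he'
  calc t ^ k * Metric.infDist v (tangentSpaceOf (jetSet S k) η)
      ≤ t ^ k * ‖v - jetScale V t⁻¹ k e‖ := by gcongr; exact infDist_le_norm_sub v he'
    _ ≤ ‖jetScale V t k (v - jetScale V t⁻¹ k e)‖ := le_norm_jetScale ht0.le ht1 k _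
    _ = ‖jetScale V t k v - e‖ := by rw [map_sub, jetScale_jetScale_inv ht0.ne']

lemma isHolderJetDistribution_of_smallJets {k : ℕ} {Λ : Set V} {W : V → Set V} {φ τ C : ℝ}
    (hφ : 0 ≤ φ) (hτ : 0 < τ) (h : ∀ ξ ∈ smallJets Λ W τ k, ∀ η ∈ smallJets Λ W τ k,
      ∀ v ∈ leafJetTangent W k ξ,
        Metric.infDist v (leafJetTangent W k η) ≤ C * ‖ξ - η‖ ^ φ * ‖v‖) :
    IsHolderJetDistribution k Λ W φ := by
  obtain ⟨t, ht0, ht1, htτ⟩ : ∃ t : ℝ, 0 < t ∧ t ≤ 1 ∧ t ≤ τ :=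
    ⟨min τ 1, by positivity, min_le_right _ _, min_le_left _ _⟩
  have scale_mem : ∀ {ξ : JetSpace V k}, jetBase k ξ ∈ Λ → ξ ∈ jetSet (W (jetBase k ξ)) k →
      VelocitiesLeOne k ξ → jetScale V t k ξ ∈ smallJets Λ W τ k := fun {ξ} hξΛ hξ hξ1 => by
    refine ⟨by rwa [jetBase_jetScale], ?_, (hξ1.velocitiesLE.jetScale ht0.le ht1).mono (by simpa)⟩
    rw [jetBase_jetScale]
    exact jetScale_mem_jetSet t hξ
  have infDist_le : ∀ {ξ η : JetSpace V k}, jetBase k ξ ∈ Λ → jetBase k η ∈ Λ →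
      ξ ∈ jetSet (W (jetBase k ξ)) k → η ∈ jetSet (W (jetBase k η)) k → VelocitiesLeOne k ξ →
      VelocitiesLeOne k η → ∀ v ∈ leafJetTangent W k ξ,
        Metric.infDist v (leafJetTangent W k η) ≤ max C 0 / t ^ k * ‖ξ - η‖ ^ φ * ‖v‖ := by
    intro ξ η hξΛ hηΛ hξ hη hξ1 hη1 v hv
    have hv' : jetScale V t k v ∈ leafJetTangent W k (jetScale V t k ξ) := by
      rw [leafJetTangent, jetBase_jetScale]
      exact jetScale_mem_tangentSpaceOf t hv
    have hdist := h _ (scale_mem hξΛ hξ hξ1) _ (scale_mem hηΛ hη hη1) _ hv'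
    rw [leafJetTangent, jetBase_jetScale, ← map_sub] at hdist
    rw [div_mul_eq_mul_div, div_mul_eq_mul_div, le_div_iff₀' (by positivity)]
    refine (pow_mul_infDist_tangentSpaceOf_le_jetScale ht0 ht1 _ η v).trans (hdist.trans ?_)
    gcongr
    · exact le_max_left _ _
    · exact norm_jetScale_le ht0.le ht1 k _
    · exact norm_jetScale_le ht0.le ht1 k v
  refine ⟨max C 0 / t ^ k, ?_⟩
  rintro _ hx _ hy ξ hξ η hη rfl rfl hξ1 hη1
  refine subspaceDist_le (by positivity) (infDist_le hx hy hξ hη hξ1 hη1) ?_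
  rw [norm_sub_rev]
  exact infDist_le hy hx hη hξ hη1 hξ1

lemma IsInvariantLeafFamily.isLeafSystem [FiniteDimensional ℝ V] {k : ℕ} {M Λ : Set V} {f : V → V}
    {A : V → Submodule ℝ V} {W : V → Set V} (hW : IsInvariantLeafFamily (k + 1) M Λ f A W)
    (hM : IsEmbeddedSubmanifold (k + 2 : ℕ) M) (hfM : MapsTo f M M)
    (hf : ∀ x ∈ Λ, ContDiffAt ℝ (k + 2 : ℕ) f x) (hΛM : Λ ⊆ M) (hΛ : IsCompact Λ)
    (hfΛ : MapsTo f Λ Λ) : IsLeafSystem k Λ M f W := by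
  obtain ⟨C, hC⟩ := exists_isProj_opNorm_le V
  refine ⟨hΛ, hfΛ, hfM, hf, hW.mem, hW.subset, hW.invariant,
    fun x hx => hM.exists_isRetractionGerm (hΛM hx), ?_⟩
  obtain ⟨K, hK⟩ := hW.smooth
  obtain ⟨R, hR⟩ := hΛ.isBounded.exists_norm_le
  refine ⟨(k + 1).factorial * max K (max R 0) * max (C * K) 1 ^ (k + 1), fun x hx => ?_⟩
  obtain ⟨Φ, B, hΦ, hbound⟩ := hK x hx
  obtain ⟨P, hP, hPC⟩ := hC B
  refine ⟨_, hΦ.isRetractionGerm_chartRetraction hP (hW.mem x hx), fun j _ hj => ?_⟩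
  refine (hΦ.norm_iteratedFDeriv_chartRetraction_le hP (hW.mem x hx)
    ((hR x hx).trans (le_max_left R 0)) hPC hbound hj).trans ?_
  gcongr
  exact le_max_right _ _

namespace IsLeafSystem

variable {k : ℕ} {M Λ : Set V} {f : V → V} {W : V → Set V}

lemma iterate (H : IsLeafSystem k Λ M f W) (n : ℕ) : IsLeafSystem k Λ M f^[n] W where
  isCompact := H.isCompact
  mapsTo := H.mapsTo.iterate n
  mapsTo_manifold := H.mapsTo_manifold.iterate n
  contDiffAt _ hx := contDiffAt_iterate_of_mapsTo H.mapsTo H.contDiffAt hx n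
  mem := H.mem
  subset := H.subset
  invariant _ hx := eventually_iterate_mem H.mapsTo (fun x hx => (H.contDiffAt x hx).continuousAt)
    H.invariant n hx
  retraction_manifold := H.retraction_manifold
  retraction := H.retraction

lemma differentiableAt (H : IsLeafSystem k Λ M f W) {x : V} (hx : x ∈ Λ) :
    DifferentiableAt ℝ f x :=
  (H.contDiffAt x hx).differentiableAt (by simp)

lemma fderiv_mem_tangentSpaceOf (H : IsLeafSystem k Λ M f W) {x v : V} (hx : x ∈ Λ)
    (hv : v ∈ tangentSpaceOf (W x) x) : fderiv ℝ f x v ∈ tangentSpaceOf (W (f x)) (f x) :=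
  map_tangentSpaceOf_jetSet_le (k := 0) (ξ := x) (by lia) (H.contDiffAt x hx) (H.invariant x hx)
    (H.mem x hx) (Submodule.mem_map_of_mem hv)

lemma fderiv_mem_tangentSpaceOf_manifold (H : IsLeafSystem k Λ M f W) {x v : V} (hx : x ∈ Λ)
    (hv : v ∈ tangentSpaceOf M x) : fderiv ℝ f x v ∈ tangentSpaceOf M (f x) :=
  map_tangentSpaceOf_jetSet_le (k := 0) (ξ := x) (by lia) (H.contDiffAt x hx)
    (.of_forall fun _ hy => H.mapsTo_manifold hy) (H.subset x hx (H.mem x hx))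
    (Submodule.mem_map_of_mem hv)

variable {U : V → Submodule ℝ V} {F l μ : ℝ}

lemma exists_isRateCocycle (H : IsLeafSystem k Λ M f W)
    (hr : HasRates f Λ (fun x => tangentSpaceOf (W x) x) U l μ)
    (hT : ∀ x ∈ Λ, tangentSpaceOf M x = tangentSpaceOf (W x) x ⊔ U x)
    (hF : ∀ x ∈ Λ, ‖fderiv ℝ f x‖ ≤ F) :
    ∃ C, 0 < C ∧ IsRateCocycle Λ f (fun n x => fderiv ℝ f^[n] x) (fun x => tangentSpaceOf (W x) x)
      U C F l μ := by
  obtain ⟨C, hC, hrates⟩ := hr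
  refine ⟨C, hC, H.mapsTo, fun x _ => fderiv_id, fun x hx a b => ?_,
    fun x hx n v hv => (H.iterate n).fderiv_mem_tangentSpaceOf hx hv, fun x hx n v hv => ?_, hF,
    fun x hx n => (hrates x hx n).1, fun x hx n => (hrates x hx n).2⟩
  · exact ContinuousLinearMap.ext
      (fderiv_iterate_add_apply H.mapsTo (fun x hx => H.differentiableAt hx) hx a b)
  · rw [← hT x hx] at hv
    rw [← hT _ (H.mapsTo.iterate n hx)]
    exact (H.iterate n).fderiv_mem_tangentSpaceOf_manifold hx hv

theorem isHolderJetDistribution [FiniteDimensional ℝ V] (H : IsLeafSystem k Λ M f W)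
    (hr : HasRates f Λ (fun x => tangentSpaceOf (W x) x) U l μ)
    (hT : ∀ x ∈ Λ, tangentSpaceOf M x = tangentSpaceOf (W x) x ⊔ U x)
    (hF : ∀ x ∈ Λ, ‖fderiv ℝ f x‖ ≤ F) (hF1 : 1 ≤ F) (hl : 0 < l) (hlμ : l < μ) {σ l' φ : ℝ}
    (hσ : 1 ≤ σ) (hll' : l < l') (hl'σ : l' ≤ σ) (hφ : 0 ≤ φ) (hφ1 : φ ≤ 1)
    (hrate : l' * (2 * F * σ / l') ^ φ * σ ^ k < μ) : IsHolderJetDistribution k Λ W φ := by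
  have hl'0 : 0 < l' := hl.trans hll'
  have hq : 2 * F ≤ 2 * F * σ / l' := by
    rw [le_div_iff₀ hl'0]
    gcongr
  set q := 2 * F * σ / l' with hq_def
  obtain ⟨m, hm, hmμ⟩ := exists_between hrate
  have hm0 : 0 < m := lt_of_le_of_lt (by positivity) hm
  obtain ⟨l₁, hl₁, hl₁'⟩ := exists_between hll'
  obtain ⟨C, hC, hcocycle⟩ := H.exists_isRateCocycle hr hT hF
  obtain ⟨N, hN, hone⟩ := hcocycle.exists_iterate_rates hC hF1 hl.le hl₁ hm0.le hmμ hlμ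
  have hN0 : N ≠ 0 := by lia
  have hql' : (2 * F * σ) ^ N = q ^ N * l' ^ N := by
    rw [← mul_pow, hq_def, div_mul_cancel₀ _ hl'0.ne']
  have hDN : ∀ x ∈ Λ, ‖fderiv ℝ f^[N] x‖ ≤ F ^ N := fun x hx =>
    norm_fderiv_iterate_le H.mapsTo (fun x hx => H.differentiableAt hx) hF hx N
  obtain ⟨τ, C', hτ, hC'⟩ := (H.iterate N).exists_infDist_leafJetTangent_le
    (t := (σ ^ N)⁻¹) (l₀ := l₁ ^ N) (l := l' ^ N) (μ := m ^ N) (m := (l' * q ^ φ) ^ N)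
    (κ := q ^ N) (φ := φ) (by positivity) (inv_le_one_of_one_le₀ (one_le_pow₀ hσ)) hDN
    (by positivity) (pow_nonneg (hl.trans hl₁).le N)
    (pow_lt_pow_left₀ hl₁' (hl.trans hl₁).le hN0)
    (inv_mul_le_one_of_le₀ (by gcongr) (by positivity)) (by positivity)
    (by
      rw [inv_pow, ← div_eq_mul_inv, lt_div_iff₀ (by positivity), pow_right_comm, ← mul_pow]
      gcongr)
    (fun x hx => (hone x hx).1) (fun x hx u hu => (hone x hx).2 u (hT x hx ▸ hu))
    (one_lt_pow₀ (by linarith) hN0) (by gcongr; linarith)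
    (by rw [← hql']; gcongr; nlinarith) hφ hφ1
    (by rw [mul_pow, Real.rpow_pow_comm (by positivity)])
  exact isHolderJetDistribution_of_smallJets hφ hτ hC'

end IsLeafSystem

theorem IsInvariantLeafFamily.isHolderJetDistribution_of_hasRates [FiniteDimensional ℝ V] {k : ℕ}
    {M Λ : Set V} {f : V → V} {A U : V → Submodule ℝ V} {W : V → Set V} {l μ : ℝ}
    (hW : IsInvariantLeafFamily (k + 1) M Λ f A W) (hM : IsEmbeddedSubmanifold (k + 2 : ℕ) M)
    (hfM : MapsTo f M M) (hf : ∀ x ∈ Λ, ContDiffAt ℝ (k + 4 : ℕ) f x) (hΛM : Λ ⊆ M)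
    (hΛ : IsCompact Λ) (hfΛ : MapsTo f Λ Λ) (hT : ∀ x ∈ Λ, tangentSpaceOf M x = A x ⊔ U x)
    (hl : 0 < l) (hlμ : l < μ) (hr : HasRates f Λ A U l μ) (hU : ∃ x ∈ Λ, U x ≠ ⊥)
    (hk : 1 ≤ k → l ^ (k + 2) < μ) (hF1 : 1 ≤ cNorm (k + 4) f Λ) :
    IsHolderJetDistribution k Λ W (holderExponent l μ (bConst (k + 1) f Λ)) := by
  have hf2 : ∀ x ∈ Λ, ContDiffAt ℝ (k + 2 : ℕ) f x := fun x hx =>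
    (hf x hx).of_le (by norm_cast; lia)
  have hF : ∀ x ∈ Λ, ‖fderiv ℝ f x‖ ≤ cNorm (k + 4) f Λ := fun x hx =>
    norm_fderiv_le_cNorm hΛ hf (by lia) hx
  have hb := two_mul_pow_mul_lt_bConst hF1
  set F := cNorm (k + 4) f Λ
  set b := bConst (k + 1) f Λ
  have hμF : μ ≤ F := hr.le_of_norm_fderiv_le hfΛ
    (fun x hx => (hf2 x hx).differentiableAt (by simp)) (by linarith) hF hU
  have h2Fb : 2 * F < b :=
    calc 2 * F ≤ (2 * F) ^ (k + 1) := le_self_pow₀ (by linarith) (by lia)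
      _ ≤ (2 * F) ^ (k + 1) * F := le_mul_of_one_le_right (by positivity) hF1
      _ < b := hb
  have hφ := holderExponent_pos hl hlμ (show l < b by linarith)
  obtain ⟨σ, l', hσ, hll', hl'σ, hrate⟩ := exists_scaling hl hφ
    (rpow_holderExponent hl (hl.trans hlμ) (by linarith)) (hl.trans hlμ) (by linarith) h2Fb
    (hb.trans_le' (by gcongr; linarith)) hk
  have hrW : HasRates f Λ (fun x => tangentSpaceOf (W x) x) U l μ := by
    obtain ⟨C, hC, hrates⟩ := hr
    exact ⟨C, hC, fun x hx n => by simpa only [hW.tangent x hx] using hrates x hx n⟩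
  exact (hW.isLeafSystem hM hfM hf2 hΛM hΛ hfΛ).isHolderJetDistribution hrW
    (fun x hx => by rw [hW.tangent x hx, hT x hx]) hF hF1 hl hlμ hσ hll' hl'σ hφ.le
    (holderExponent_le_one hl hlμ (by linarith)) hrate

end HolderDistribution

section LeafFamilies

variable {V : Type*} [NormedAddCommGroup V] [NormedSpace ℝ V] {k : ℕ} {M Λ : Set V}

namespace IsInvariantLeafFamily

lemma jetMap_invariant {h : V → V} {A : V → Submodule ℝ V} {W : V → Set V}
    (hW : IsInvariantLeafFamily (k + 1) M Λ h A W)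
    (hh : ∀ x ∈ Λ, ContDiffAt ℝ (k + 1 : ℕ) h x) {x : V} (hx : x ∈ Λ) {ξ : JetSpace V k}
    (hξ : ξ ∈ jetSet (W x) k) (hb : jetBase k ξ = x) :
    jetMap h k ξ ∈ jetSet (W (h x)) k ∧
      (tangentSpaceOf (jetSet (W x) k) ξ).map (fderiv ℝ (jetMap h k) ξ).toLinearMap ≤
        tangentSpaceOf (jetSet (W (h x)) k) (jetMap h k ξ) := by
  subst hb
  exact ⟨jetMap_mem_jetSet k.le_succ (hh _ hx) (hW.invariant _ hx) hξ,
    map_tangentSpaceOf_jetSet_le le_rfl (hh _ hx) (hW.invariant _ hx) hξ⟩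

theorem exists_jet_splitting [FiniteDimensional ℝ V] {f g : V → V} {Ec Eu Es : V → Submodule ℝ V}
    {Wsc Wuc Wc : V → Set V}
    (hWsc : IsInvariantLeafFamily (k + 1) M Λ f (fun x => Es x ⊔ Ec x) Wsc)
    (hWuc : IsInvariantLeafFamily (k + 1) M Λ g (fun x => Eu x ⊔ Ec x) Wuc)
    (hM : IsEmbeddedSubmanifold (k + 1 : ℕ) M) {x : V} (hx : x ∈ Λ)
    (hsplit : IsSplitting (tangentSpaceOf M x) (Ec x) (Eu x) (Es x))
    (hWc : ∀ᶠ y in 𝓝 x, y ∈ Wc x ↔ y ∈ Wuc x ∩ Wsc x) {ξ : JetSpace V k}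
    (hξ : ξ ∈ jetSet (Wc x) k) (hb : jetBase k ξ = x) :
    ∃ Fc Fu Fs : Submodule ℝ (JetSpace V k),
      IsSplitting (tangentSpaceOf (jetSet M k) ξ) Fc Fu Fs ∧
      Fu ⊔ Fc = tangentSpaceOf (jetSet (Wuc x) k) ξ ∧
      Fs ⊔ Fc = tangentSpaceOf (jetSet (Wsc x) k) ξ ∧
      tangentSpaceOf (jetSet (Wuc x) k) ξ ⊓ tangentSpaceOf (jetSet (Wsc x) k) ξ = Fc ∧
      Fc = tangentSpaceOf (jetSet (Wc x) k) ξ := by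
  obtain ⟨rM, hrM⟩ := hM.exists_isRetractionGerm (hWsc.subset x hx (hWsc.mem x hx))
  obtain ⟨ru, hru⟩ := hWuc.exists_isRetractionGerm hx
  obtain ⟨rs, hrs⟩ := hWsc.exists_isRetractionGerm hx
  obtain ⟨Φ, hΦM, hΦu, hΦs, hΦc⟩ := hsplit.exists_flattens k.succ_ne_zero hrM hru hrs
    (hWuc.mem x hx) (hWsc.mem x hx) (hWuc.subset x hx) (hWsc.subset x hx) rfl
    (hWuc.tangent x hx) (hWsc.tangent x hx) hWc
  have hξu : ξ ∈ jetSet (Wuc x) k :=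
    mem_jetSet_of_eventually (by simpa only [hb] using hWc.mono fun y hy h => (hy.1 h).1) hξ
  have hξs : ξ ∈ jetSet (Wsc x) k :=
    mem_jetSet_of_eventually (by simpa only [hb] using hWc.mono fun y hy h => (hy.1 h).2) hξ
  exact hsplit.exists_jet_splitting hΦM hΦu hΦs hΦc hξ
    (jetSet_mono (hWuc.subset x hx) k hξu) hξu hξs hb

end IsInvariantLeafFamily

end LeafFamilies

theorem theoremB1_general {V : Type*} [NormedAddCommGroup V] [NormedSpace ℝ V]
    [FiniteDimensional ℝ V] (M Λ : Set V) (f g : V → V) (Ec Eu Es : V → Submodule ℝ V)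
    (Wsc Wuc Wc : V → Set V) (k : ℕ)
    (hM : IsEmbeddedSubmanifold (k + 2 : ℕ) M) (hfM : MapsTo f M M) (hgM : MapsTo g M M)
    (hf : ∀ x ∈ Λ, ContDiffAt ℝ (k + 4 : ℕ) f x) (hg : ∀ x ∈ Λ, ContDiffAt ℝ (k + 4 : ℕ) g x)
    (hgf : LeftInvOn g f Λ) (hΛM : Λ ⊆ M) (hΛ : IsCompact Λ) (hinv : f '' Λ = Λ)
    (hsplit : ∀ x ∈ Λ, IsSplitting (tangentSpaceOf M x) (Ec x) (Eu x) (Es x))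
    (hWsc : IsInvariantLeafFamily (k + 1) M Λ f (fun x => Es x ⊔ Ec x) Wsc)
    (hWuc : IsInvariantLeafFamily (k + 1) M Λ g (fun x => Eu x ⊔ Ec x) Wuc)
    (hWc : ∀ x ∈ Λ, ∀ᶠ y in 𝓝 x, y ∈ Wc x ↔ y ∈ Wuc x ∩ Wsc x) :
    (∀ x ∈ Λ, ∀ ξ ∈ jetSet (Wc x) k, jetBase k ξ = x →
      ∃ Fc Fu Fs : Submodule ℝ (JetSpace V k),
        IsSplitting (tangentSpaceOf (jetSet M k) ξ) Fc Fu Fs ∧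
        Fu ⊔ Fc = tangentSpaceOf (jetSet (Wuc x) k) ξ ∧
        Fs ⊔ Fc = tangentSpaceOf (jetSet (Wsc x) k) ξ ∧
        tangentSpaceOf (jetSet (Wuc x) k) ξ ⊓ tangentSpaceOf (jetSet (Wsc x) k) ξ = Fc ∧
        Fc = tangentSpaceOf (jetSet (Wc x) k) ξ) ∧
    (∀ x ∈ Λ, ∀ ξ ∈ jetSet (Wsc x) k, jetBase k ξ = x →
      jetMap f k ξ ∈ jetSet (Wsc (f x)) k ∧
      (tangentSpaceOf (jetSet (Wsc x) k) ξ).map (fderiv ℝ (jetMap f k) ξ).toLinearMap ≤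
        tangentSpaceOf (jetSet (Wsc (f x)) k) (jetMap f k ξ)) ∧
    (∀ x ∈ Λ, ∀ ξ ∈ jetSet (Wuc x) k, jetBase k ξ = x →
      jetMap g k ξ ∈ jetSet (Wuc (g x)) k ∧
      (tangentSpaceOf (jetSet (Wuc x) k) ξ).map (fderiv ℝ (jetMap g k) ξ).toLinearMap ≤
        tangentSpaceOf (jetSet (Wuc (g x)) k) (jetMap g k ξ)) ∧
    (∀ lsc lu : ℝ, 0 < lsc → lsc < lu →
      HasRates f Λ (fun x => Es x ⊔ Ec x) Eu lsc lu →
      (∃ x ∈ Λ, Eu x ≠ ⊥) →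
      (1 ≤ k → lsc ^ (k + 2) < lu) →
      1 ≤ cNorm (k + 4) f Λ →
      IsHolderJetDistribution k Λ Wsc (holderExponent lsc lu (bConst (k + 1) f Λ))) ∧
    (∀ luc ls : ℝ, 0 < luc → luc < ls →
      HasRates g Λ (fun x => Eu x ⊔ Ec x) Es luc ls →
      (∃ x ∈ Λ, Es x ≠ ⊥) →
      (1 ≤ k → luc ^ (k + 2) < ls) →
      1 ≤ cNorm (k + 4) g Λ →
      IsHolderJetDistribution k Λ Wuc (holderExponent luc ls (bConst (k + 1) g Λ))) := by
  have hM1 : IsEmbeddedSubmanifold (k + 1 : ℕ) M := hM.of_le (by norm_cast; lia)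
  have hk14 : ((k + 1 : ℕ) : WithTop ℕ∞) ≤ (k + 4 : ℕ) := by norm_cast; lia
  have hfΛ : MapsTo f Λ Λ := mapsTo_iff_image_subset.2 hinv.subset
  have hgΛ : MapsTo g Λ Λ := mapsTo_iff_image_subset.2 (by rw [← hinv, hgf.image_image, hinv])
  have hTsc : ∀ x ∈ Λ, tangentSpaceOf M x = Es x ⊔ Ec x ⊔ Eu x := fun x hx => by
    rw [← (hsplit x hx).1]
    ac_rfl
  have hTuc : ∀ x ∈ Λ, tangentSpaceOf M x = Eu x ⊔ Ec x ⊔ Es x := fun x hx => by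
    rw [← (hsplit x hx).1]
    ac_rfl
  exact ⟨fun x hx ξ hξ hb => hWsc.exists_jet_splitting hWuc hM1 hx (hsplit x hx) (hWc x hx) hξ hb,
    fun x hx ξ => hWsc.jetMap_invariant (fun x hx => (hf x hx).of_le hk14) hx,
    fun x hx ξ => hWuc.jetMap_invariant (fun x hx => (hg x hx).of_le hk14) hx,
    fun _ _ => hWsc.isHolderJetDistribution_of_hasRates hM hfM hf hΛM hΛ hfΛ hTsc,
    fun _ _ => hWuc.isHolderJetDistribution_of_hasRates hM hgM hg hΛM hΛ hgΛ hTuc⟩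

theorem theoremB1 (N : ℕ) (M Λ : Set (EuclideanSpace ℝ (Fin N)))
    (f g : EuclideanSpace ℝ (Fin N) → EuclideanSpace ℝ (Fin N))
    (Ec Eu Es : EuclideanSpace ℝ (Fin N) → Submodule ℝ (EuclideanSpace ℝ (Fin N)))
    (Wsc Wuc Wc : EuclideanSpace ℝ (Fin N) → Set (EuclideanSpace ℝ (Fin N)))
    -- the index `i = k + 1` of the jet distributions
    (k : ℕ)
    (hM : IsEmbeddedSubmanifold ∞ M)
    (hfg : IsDiffeoOf M f g)
    (hΛM : Λ ⊆ M) (hΛ : IsCompact Λ) (hinv : f '' Λ = Λ)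
    (hsplit : ∀ x ∈ Λ, IsSplitting (tangentSpaceOf M x) (Ec x) (Eu x) (Es x))
    -- the center-stable and the center-unstable manifolds are invariant and of class `C^i`
    (hWsc : IsInvariantLeafFamily (k + 1) M Λ f (fun x => Es x ⊔ Ec x) Wsc)
    (hWuc : IsInvariantLeafFamily (k + 1) M Λ g (fun x => Eu x ⊔ Ec x) Wuc)
    -- the center manifolds
    (hWc : ∀ x ∈ Λ, ∀ᶠ y in 𝓝 x, y ∈ Wc x ↔ y ∈ Wuc x ∩ Wsc x) :
    -- the splitting of the jets, and its invariance under the jet maps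
    (∀ x ∈ Λ, ∀ ξ ∈ jetSet (Wc x) k, jetBase k ξ = x →
      ∃ Fc Fu Fs : Submodule ℝ (JetSpace (EuclideanSpace ℝ (Fin N)) k),
        IsSplitting (tangentSpaceOf (jetSet M k) ξ) Fc Fu Fs ∧
        Fu ⊔ Fc = tangentSpaceOf (jetSet (Wuc x) k) ξ ∧
        Fs ⊔ Fc = tangentSpaceOf (jetSet (Wsc x) k) ξ ∧
        tangentSpaceOf (jetSet (Wuc x) k) ξ ⊓ tangentSpaceOf (jetSet (Wsc x) k) ξ = Fc ∧
        Fc = tangentSpaceOf (jetSet (Wc x) k) ξ) ∧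
    (∀ x ∈ Λ, ∀ ξ ∈ jetSet (Wsc x) k, jetBase k ξ = x →
      jetMap f k ξ ∈ jetSet (Wsc (f x)) k ∧
      (tangentSpaceOf (jetSet (Wsc x) k) ξ).map (fderiv ℝ (jetMap f k) ξ).toLinearMap ≤
        tangentSpaceOf (jetSet (Wsc (f x)) k) (jetMap f k ξ)) ∧
    (∀ x ∈ Λ, ∀ ξ ∈ jetSet (Wuc x) k, jetBase k ξ = x →
      jetMap g k ξ ∈ jetSet (Wuc (g x)) k ∧
      (tangentSpaceOf (jetSet (Wuc x) k) ξ).map (fderiv ℝ (jetMap g k) ξ).toLinearMap ≤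
        tangentSpaceOf (jetSet (Wuc (g x)) k) (jetMap g k ξ)) ∧
    -- Hölder continuity of the center-stable distribution
    (∀ lsc lu : ℝ, 0 < lsc → lsc < lu →
      HasRates f Λ (fun x => Es x ⊔ Ec x) Eu lsc lu →
      (∃ x ∈ Λ, Eu x ≠ ⊥) →
      (1 ≤ k → lsc ^ (k + 2) < lu) →
      1 ≤ cNorm (k + 4) f Λ →
      IsHolderJetDistribution k Λ Wsc (holderExponent lsc lu (bConst (k + 1) f Λ))) ∧
    -- Hölder continuity of the center-unstable distribution
    (∀ luc ls : ℝ, 0 < luc → luc < ls →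
      HasRates g Λ (fun x => Eu x ⊔ Ec x) Es luc ls →
      (∃ x ∈ Λ, Es x ≠ ⊥) →
      (1 ≤ k → luc ^ (k + 2) < ls) →
      1 ≤ cNorm (k + 4) g Λ →
      IsHolderJetDistribution k Λ Wuc (holderExponent luc ls (bConst (k + 1) g Λ))) := by
  have hle (m : ℕ) : (m : WithTop ℕ∞) ≤ ∞ := mod_cast le_top
  exact theoremB1_general M Λ f g Ec Eu Es Wsc Wuc Wc k (hM.of_le (hle _)) hfg.mapsTo hfg.mapsTo_inv
    (fun x hx => (hfg.contDiffAt x (hΛM hx)).of_le (hle _))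
    (fun x hx => (hfg.contDiffAt_inv x (hΛM hx)).of_le (hle _)) (hfg.invOn.1.mono hΛM)
    hΛM hΛ hinv hsplit hWsc hWuc hWc
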